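/- Let $d$ be a finite dimension and let $\mathcal S$ be the set of $d\times d$ density matrices. For $\rho_0,\rho_1\in\mathcal S$ put $$D_{\rm CC}(\rho_0,\rho_1)=-\inf_{\{E_b\}}\ \inf_{s\in[0,1]}\ \log\sum_b \big({\rm tr}\,E_b\rho_0\big)^s\big({\rm tr}\,E_b\rho_1\big)^{1-s},\qquad D_{\rm QC}(\rho_0,\rho_1)=-\inf_{s\in[0,1]}\log{\rm tr}\,\rho_0^s\rho_1^{1-s},$$ where $\{E_b\}$ runs over all POVMs with finitely many outcomes (and $\log 0=-\infty$), and $$F(\rho_0,\rho_1)=\Big({\rm tr}\sqrt{\sqrt{\rho_0}\,\rho_1\sqrt{\rho_0}}\Big)^2,\qquad d_{\rm BU}(\rho_0,\rho_1)=\sqrt2\,\big[1-\sqrt{F(\rho_0,\rho_1)}\big]^{1/2}.$$ For $S\subseteq\mathcal S$ and a function $D$ of two states, say that a family $ds^2=(g_\rho)_{\rho\in S}$ of real quadratic forms in the matrix $d\rho$ is the metric induced by $D$ on $S$ if, for every $\rho\in S$, $D(\rho,\rho-d\rho)=g_\rho(d\rho)+o(\|d\rho\|^2)$ as $d\rho\to0$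 with $\rho-d\rho\in S$. A state is strictly mixed if all its eigenvalues are positive, and pure if it is of the form $|\psi\rangle\langle\psi|$. For a state $\rho=\sum_i\lambda_i|i\rangle\langle i|$ put $$ds^2_{\rm BU}=\frac12\sum_{i,j}\frac{|\langle i|d\rho|j\rangle|^2}{\lambda_i+\lambda_j},\qquad ds^2_{\rm QC}=\frac12\sum_{i,j}\frac{|\langle i|d\rho|j\rangle|^2}{(\sqrt{\lambda_i}+\sqrt{\lambda_j})^2},$$ the sums being over the pairs with $\lambda_i+\lambda_j\ne0$. Then: 1. On the strictly mixed states, $d_{\rm BU}^2$ and $1-F$ both induce $ds^2_{\rm BU}$, and $D_{\rm CC}$ induces $ds^2_{\rm CC}=\frac12ds^2_{\rm BU}$; that is, $ds^2_{\rm CC}=\frac12ds^2_{\rm BU}=\frac12[1-F(\rho,\rho-d\rho)]$ to second order. 2. On the pure states, $d_{\rm BU}^2$, $1-F$ and $D_{\rm CC}$ all induce $ds^2_{\rm BU}$; that is, $ds^2_{\rm CC}=1-F(\rho,\rho-d\rho)=ds^2_{\rm BU}$ to second order. On tangent vectors this is the Fubini–Study metric: if $\rho=|\psi\rangle\langle\psi|$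 and $d\rho=|d\psi\rangle\langle\psi|+|\psi\rangle\langle d\psi|$ with ${\rm Re}\langle\psi|d\psi\rangle=0$, then $$ds^2_{\rm BU}=\frac{\langle d\psi|d\psi\rangle}{\langle\psi|\psi\rangle}-\frac{|\langle\psi|d\psi\rangle|^2}{\langle\psi|\psi\rangle^2}.$$ 3. $D_{\rm QC}$ induces $ds^2_{\rm QC}$ on the strictly mixed states and on the pure states. 4. The metric of $D_{\rm CC}$ is discontinuous at the pure states, while that of $D_{\rm QC}$ is not, in the following sense. Let $g^{\rm m}$ and $g^{\rm p}$ be metrics induced by $D_{\rm CC}$ on the strictly mixed states and on the pure states. For every pure $\rho_0$ and every antihermitian $T$, $$\lim_{\rho\to\rho_0,\ \rho\ \text{strictly mixed}}g^{\rm m}_\rho([T,\rho])=\tfrac12\,g^{\rm p}_{\rho_0}([T,\rho_0]),$$ and if $d\ge2$, then for every pure $\rho_0$ there is an antihermitian $T$ for which $g^{\rm m}_\rho([T,\rho])$ does not converge to $g^{\rm p}_{\rho_0}([T,\rho_0])$ as $\rho\to\rho_0$ through strictly mixed states. For metrics $g^{\rm m},g^{\rm p}$ induced by $D_{\rm QC}$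 on these two sets, one has instead $\lim_{\rho\to\rho_0}g^{\rm m}_\rho([T,\rho])=g^{\rm p}_{\rho_0}([T,\rho_0])$ for every pure $\rho_0$ and every antihermitian $T$. -/

import Mathlib

open scoped Matrix Topology ComplexOrder

/-- The states of a quantum system with Hilbert space `ℂⁿ`: density matrices, with the topology of
the space of matrices. -/
abbrev QState (n : Type*) [Fintype n] : Type _ :=
  {ρ : Matrix n n ℂ // ρ.PosSemidef ∧ ρ.trace = 1}

/-- A measurement (POVM) with `M` outcomes. -/
structure POVM (n : Type*) [Fintype n] [DecidableEq n] (M : ℕ) where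
  effect : Fin M → Matrix n n ℂ
  posSemidef : ∀ b, (effect b).PosSemidef
  sum_effect : ∑ b, effect b = 1

noncomputable section

namespace QState

/-- The strictly mixed states: all eigenvalues are positive. -/
def strictlyMixed (n : Type*) [Fintype n] : Set (QState n) :=
  {ρ | ρ.1.PosDef}

/-- The pure states `|ψ⟩⟨ψ|`. -/
def pure (n : Type*) [Fintype n] : Set (QState n) :=
  {ρ | ∃ ψ : n → ℂ, ρ.1 = Matrix.vecMulVec ψ (star ψ)}

variable {n : Type*} [Fintype n] [DecidableEq n]

/-- The probability `tr (E_b ρ)` of the outcome `b`. -/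
def prob {M : ℕ} (E : POVM n M) (ρ : QState n) (b : Fin M) : ℝ :=
  (E.effect b * ρ.1).trace.re

/-- The local (classical) Chernoff measure
`D_CC(ρ, σ) = - inf_{E} inf_{s ∈ [0,1]} log ∑_b p_ρ(b)^s p_σ(b)^{1-s}`, the infimum being over all
POVMs with finitely many outcomes. Here `log 0 = -∞`. -/
def chernoffCC (ρ σ : QState n) : EReal :=
  - ⨅ (M : ℕ) (E : POVM n M) (s : Set.Icc (0 : ℝ) 1),
      ENNReal.log (ENNReal.ofReal
        (∑ b, prob E ρ b ^ (s : ℝ) * prob E σ b ^ (1 - (s : ℝ))))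

/-- The power `ρ^s`, by functional calculus. -/
def pow (ρ : QState n) (s : ℝ) : Matrix n n ℂ :=
  cfc (fun x : ℝ => x ^ s) ρ.1

/-- The quantum Chernoff measure `D_QC(ρ, σ) = - inf_{s ∈ [0,1]} log tr (ρ^s σ^{1-s})`. -/
def chernoffQC (ρ σ : QState n) : EReal :=
  - ⨅ s : Set.Icc (0 : ℝ) 1,
      ENNReal.log (ENNReal.ofReal (ρ.pow s * σ.pow (1 - (s : ℝ))).trace.re)

/-- The fidelity `F(ρ, σ) = (tr √(√ρ σ √ρ))²`. -/
def fidelity (ρ σ : QState n) : ℝ :=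
  (cfc Real.sqrt (cfc Real.sqrt ρ.1 * σ.1 * cfc Real.sqrt ρ.1)).trace.re ^ 2

/-- The Bures-Uhlmann distance `√2 (1 - √F)^{1/2}`. -/
def buresDist (ρ σ : QState n) : ℝ :=
  √2 * √(1 - √(fidelity ρ σ))

/-- The eigenvalues `λ_i` of a state. -/
def eigenvalue (ρ : QState n) : n → ℝ :=
  ρ.2.1.isHermitian.eigenvalues

/-- The matrix element `⟨i|X|j⟩` in the eigenbasis of a state. -/
def eigenEntry (ρ : QState n) (X : Matrix n n ℂ) (i j : n) : ℂ :=
  (star (ρ.2.1.isHermitian.eigenvectorUnitary : Matrix n n ℂ) * X *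
    (ρ.2.1.isHermitian.eigenvectorUnitary : Matrix n n ℂ)) i j

/-- The Bures-Uhlmann line element `½ ∑_{ij} |⟨i|dρ|j⟩|² / (λ_i + λ_j)`, the sum being over the
pairs with `λ_i + λ_j ≠ 0`. -/
def buresMetric (ρ : QState n) (X : Matrix n n ℂ) : ℝ :=
  1 / 2 * ∑ i, ∑ j, ‖ρ.eigenEntry X i j‖ ^ 2 / (ρ.eigenvalue i + ρ.eigenvalue j)

/-- The line element `½ ∑_{ij} |⟨i|dρ|j⟩|² / (√λ_i + √λ_j)²`, the sum being over the
pairs with `λ_i + λ_j ≠ 0`. -/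
def qcMetric (ρ : QState n) (X : Matrix n n ℂ) : ℝ :=
  1 / 2 * ∑ i, ∑ j,
    ‖ρ.eigenEntry X i j‖ ^ 2 / (√(ρ.eigenvalue i) + √(ρ.eigenvalue j)) ^ 2

/-- `g` is the metric (line element) induced by `D` on the set `S` of states: for `ρ ∈ S`, the
map `g ρ` is a quadratic form in `dρ`, and `D(ρ, ρ - dρ) = g ρ dρ + o(‖dρ‖²)` as `dρ → 0` with
`ρ - dρ ∈ S`, where `‖dρ‖² = tr (dρ† dρ)`. -/
structure IsInducedMetric (S : Set (QState n)) (D : QState n → QState n → EReal)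
    (g : QState n → Matrix n n ℂ → ℝ) : Prop where
  quadratic : ∀ ρ ∈ S, ∃ Q : QuadraticForm ℝ (Matrix n n ℂ), ∀ X, g ρ X = Q X
  expansion : ∀ ρ ∈ S, ∀ ε : ℝ, 0 < ε → ∀ᶠ σ in 𝓝[S] ρ,
    ((g ρ (ρ.1 - σ.1) - ε * ((ρ.1 - σ.1)ᴴ * (ρ.1 - σ.1)).trace.re : ℝ) : EReal) ≤ D ρ σ ∧
    D ρ σ ≤ ((g ρ (ρ.1 - σ.1) + ε * ((ρ.1 - σ.1)ᴴ * (ρ.1 - σ.1)).trace.re : ℝ) : EReal)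

end QState

/-- The Fubini-Study line element `⟨dψ|dψ⟩/⟨ψ|ψ⟩ - |⟨ψ|dψ⟩|²/⟨ψ|ψ⟩²`. -/
def fubiniStudy {n : Type*} [Fintype n] (ψ φ : n → ℂ) : ℝ :=
  (star φ ⬝ᵥ φ).re / (star ψ ⬝ᵥ ψ).re - ‖star ψ ⬝ᵥ φ‖ ^ 2 / (star ψ ⬝ᵥ ψ).re ^ 2

end

/-!
# Metrics induced by Chernoff measures, the fidelity and the Bures-Uhlmann distance

Everything is written with matrix elements `⟨i|W|k⟩` between an eigenvector `|i⟩` of `ρ`, with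
eigenvalue `λᵢ`, and an eigenvector `|k⟩` of a second Hermitian matrix `M` near `ρ`, with eigenvalue
`μₖ`. A sum `∑ |⟨i|k⟩|² f(λᵢ) g(μₖ)` is the trace of `f(ρ) g(M)`, while
`⟨i|ρ - M|k⟩ = (λᵢ - μₖ) ⟨i|k⟩`. So a divergence of the form `∑ |⟨i|k⟩|² h(λᵢ, μₖ)`, with `h`
vanishing to second order on the diagonal, is exactly a sum of `|⟨i|dρ|k⟩|² h(λᵢ, μₖ)/(λᵢ - μₖ)²`,
with no perturbation theory of eigenvectors. Replacing the eigenbasis of `M` by that of `ρ` then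
costs only `o(‖dρ‖²)`, by continuity of the functional calculus
(`Matrix.eventually_abs_sum_elt_sub_le`).

*Strictly mixed states.* For `D_QC` the second matrix is `σ = ρ - dρ` itself. Convexity in `s` of
`λ ^ s μ ^ (1 - s)` bounds `1 - tr ρ ^ s σ ^ (1 - s)` above by its tangent at `s = 1/2`. The slope
comes from `chernoffSkew`, which is antisymmetric and vanishes to third order on the diagonal, so
that it contributes nothing to second order, and the value at `s = 1/2` gives `ds²_QC`. For the
fidelity the second matrix is `M = √(√ρ σ √ρ)`: as `tr ρ⁻¹ M² = 1`, the number `2 (1 - √F)` is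
`∑ |⟨i|k⟩|² (λᵢ - mₖ)² / λᵢ`, and `ρ² - M² = √ρ dρ √ρ`
(`QState.two_mul_one_sub_trace_fidelityRoot`). For `D_CC` every measurement contributes one eighth
of its classical Fisher information, up to a factor close to `1`, uniformly in the measurement
because `|tr E_b dρ| ≤ c tr E_b ρ` near `ρ`. The Fisher information is at most the quantum Fisher
information `tr L ρ L = 4 ds²_BU`, `L` being the symmetric logarithmic derivative, with equality for
the measurement in an eigenbasis of `L`.

*Pure states.* If `ρ` and `σ` are pure, then everything is a function of the overlap `F = tr ρ σ`:
the squared norm of `dρ` is `2 (1 - F)`, both line elements are `(1 - F) + O((1 - F)²)`, and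
`tr ρ ^ s σ ^ (1 - s) = F` for `0 < s < 1`. For `D_CC` the test for `ρ` has overlaps of order `s`
equal to `F ^ (1 - s)`, which approach `F` as `s → 0`, and by the Cauchy-Schwarz inequality no
measurement yields less than `F`.

*The limit at pure states.* Since the quadratic forms of an induced metric are determined on
tangent vectors of curves of states (`QState.IsInducedMetric.eq_of_tendsto`), an arbitrary metric
induced by `D_CC` or `D_QC` takes on `[T, ρ]` the values found above. Along `[T, ρ]` the form
`ds²_QC` is continuous in `ρ`, and `ds²_BU` is squeezed between continuous functions of `ρ` which
agree at the pure states. So the limit of `½ ds²_BU` is one half of the pure-state value of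
`D_CC`, and that value is positive for a generator which rotates `|ψ⟩` towards an orthogonal vector.
-/


/-! ### Spectral sums for pairs of Hermitian matrices -/

namespace Matrix

variable {n : Type*} [Fintype n]

/-- The squared Hilbert-Schmidt norm `tr (X† X)`. -/
noncomputable def hsNormSq (X : Matrix n n ℂ) : ℝ := (Xᴴ * X).trace.re

theorem hsNormSq_eq_sum (X : Matrix n n ℂ) : X.hsNormSq = ∑ i, ∑ j, ‖X i j‖ ^ 2 := by
  rw [Finset.sum_comm]
  simp only [hsNormSq, trace, diag, mul_apply, conjTranspose_apply, Complex.re_sum]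
  refine Finset.sum_congr rfl fun i _ => Finset.sum_congr rfl fun j _ => ?_
  rw [← Complex.normSq_eq_norm_sq, Complex.normSq_apply]
  simp

theorem hsNormSq_nonneg (X : Matrix n n ℂ) : 0 ≤ X.hsNormSq := by
  rw [hsNormSq_eq_sum]; positivity

theorem trace_mul_re_nonneg {A B : Matrix n n ℂ} (hA : A.PosSemidef) (hB : B.PosSemidef) :
    0 ≤ (A * B).trace.re := by
  classical
  obtain ⟨C, rfl⟩ : ∃ C : Matrix n n ℂ, A = Cᴴ * C := by
    open scoped MatrixOrder in
    exact CStarAlgebra.nonneg_iff_eq_star_mul_self.mp (Matrix.nonneg_iff_posSemidef.mpr hA)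
  rw [Matrix.mul_assoc, trace_mul_comm]
  exact (Complex.le_def.1 (hB.mul_mul_conjTranspose_same C).trace_nonneg).1

variable [DecidableEq n]

namespace IsHermitian

variable {A B : Matrix n n ℂ}

/-- The matrix element `⟨i|W|k⟩` between an eigenvector `|i⟩` of `A` and an eigenvector `|k⟩`
of `B`. -/
noncomputable def elt (hA : A.IsHermitian) (hB : B.IsHermitian) (W : Matrix n n ℂ) (i k : n) : ℂ :=
  (star (hA.eigenvectorUnitary : Matrix n n ℂ) * W * (hB.eigenvectorUnitary : Matrix n n ℂ)) i k

theorem cfc_eq_mul_diagonal_mul (hA : A.IsHermitian) (f : ℝ → ℝ) :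
    cfc f A = (hA.eigenvectorUnitary : Matrix n n ℂ) *
      diagonal (fun i => (f (hA.eigenvalues i) : ℂ)) *
      star (hA.eigenvectorUnitary : Matrix n n ℂ) := by
  rw [hA.cfc_eq, IsHermitian.cfc, Unitary.conjStarAlgAut_apply]
  rfl

theorem star_mul_cfc (hA : A.IsHermitian) (f : ℝ → ℝ) :
    star (hA.eigenvectorUnitary : Matrix n n ℂ) * cfc f A =
      diagonal (fun i => (f (hA.eigenvalues i) : ℂ)) *
      star (hA.eigenvectorUnitary : Matrix n n ℂ) := by
  rw [hA.cfc_eq_mul_diagonal_mul, ← Matrix.mul_assoc, ← Matrix.mul_assoc]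
  simp

theorem cfc_mul_coe (hA : A.IsHermitian) (f : ℝ → ℝ) :
    cfc f A * (hA.eigenvectorUnitary : Matrix n n ℂ) = (hA.eigenvectorUnitary : Matrix n n ℂ) *
      diagonal (fun i => (f (hA.eigenvalues i) : ℂ)) := by
  rw [hA.cfc_eq_mul_diagonal_mul, Matrix.mul_assoc]
  simp

theorem elt_cfc_mul (hA : A.IsHermitian) (hB : B.IsHermitian) (f : ℝ → ℝ) (W : Matrix n n ℂ)
    (i k : n) : hA.elt hB (cfc f A * W) i k = f (hA.eigenvalues i) * hA.elt hB W i k := by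
  simp only [elt]
  rw [← Matrix.mul_assoc, star_mul_cfc, Matrix.mul_assoc, Matrix.mul_assoc, diagonal_mul,
    ← Matrix.mul_assoc]

theorem elt_mul_cfc (hA : A.IsHermitian) (hB : B.IsHermitian) (f : ℝ → ℝ) (W : Matrix n n ℂ)
    (i k : n) : hA.elt hB (W * cfc f B) i k = hA.elt hB W i k * f (hB.eigenvalues k) := by
  simp only [elt]
  rw [Matrix.mul_assoc, Matrix.mul_assoc, cfc_mul_coe, ← Matrix.mul_assoc, ← Matrix.mul_assoc,
    mul_diagonal]

theorem cfc_one_eq (hA : A.IsHermitian) : cfc (fun _ : ℝ => (1 : ℝ)) A = 1 :=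
  cfc_const_one ℝ A hA

theorem cfc_id_eq (hA : A.IsHermitian) : cfc (fun x : ℝ => x) A = A := cfc_id' ℝ A hA

theorem elt_mul_left (hA : A.IsHermitian) (hB : B.IsHermitian) (W : Matrix n n ℂ)
    (i k : n) : hA.elt hB (A * W) i k = hA.eigenvalues i * hA.elt hB W i k := by
  have := hA.elt_cfc_mul hB (fun x => x) W i k
  rwa [hA.cfc_id_eq] at this

theorem elt_mul_right (hA : A.IsHermitian) (hB : B.IsHermitian) (W : Matrix n n ℂ)
    (i k : n) : hA.elt hB (W * B) i k = hA.elt hB W i k * hB.eigenvalues k := by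
  have := hA.elt_mul_cfc hB (fun x => x) W i k
  rwa [hB.cfc_id_eq] at this

theorem elt_sub (hA : A.IsHermitian) (hB : B.IsHermitian) (W Z : Matrix n n ℂ) (i k : n) :
    hA.elt hB (W - Z) i k = hA.elt hB W i k - hA.elt hB Z i k := by
  simp [elt, Matrix.mul_sub, Matrix.sub_mul]

theorem elt_add (hA : A.IsHermitian) (hB : B.IsHermitian) (W Z : Matrix n n ℂ) (i k : n) :
    hA.elt hB (W + Z) i k = hA.elt hB W i k + hA.elt hB Z i k := by
  simp [elt, Matrix.mul_add, Matrix.add_mul]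

/-- `⟨i|(A - B)|k⟩ = (λᵢ - μₖ)⟨i|k⟩`: differences of the two matrices produce differences of
eigenvalues. -/
theorem elt_sub_self (hA : A.IsHermitian) (hB : B.IsHermitian) (i k : n) :
    hA.elt hB (A - B) i k = (hA.eigenvalues i - hB.eigenvalues k) * hA.elt hB 1 i k := by
  have h1 := hA.elt_mul_left hB 1 i k
  have h2 := hA.elt_mul_right hB 1 i k
  rw [Matrix.mul_one] at h1
  rw [Matrix.one_mul] at h2
  rw [elt_sub, h1, h2]; ring

theorem elt_conjTranspose (hA : A.IsHermitian) (hB : B.IsHermitian) (W : Matrix n n ℂ) (i k : n) :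
    hA.elt hB Wᴴ i k = star (hB.elt hA W k i) := by
  simp only [elt]
  rw [← conjTranspose_apply]
  simp only [star_eq_conjTranspose, conjTranspose_mul, conjTranspose_conjTranspose,
    Matrix.mul_assoc]

theorem norm_elt_swap (hA : A.IsHermitian) {W : Matrix n n ℂ} (hW : W.IsHermitian) (i j : n) :
    ‖hA.elt hA W j i‖ = ‖hA.elt hA W i j‖ := by
  conv_lhs => rw [← hW.eq, elt_conjTranspose, norm_star]

/-- `tr (W Z†)` in terms of matrix elements. -/
theorem trace_mul_conjTranspose_eq_sum (hA : A.IsHermitian) (hB : B.IsHermitian)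
    (W Z : Matrix n n ℂ) :
    (W * Zᴴ).trace = ∑ i, ∑ k, hA.elt hB W i k * star (hA.elt hB Z i k) := by
  set U := (hA.eigenvectorUnitary : Matrix n n ℂ)
  set V := (hB.eigenvectorUnitary : Matrix n n ℂ)
  have hU : U * star U = 1 := Unitary.coe_mul_star_self _
  have hV : V * star V = 1 := Unitary.coe_mul_star_self _
  have : (W * Zᴴ).trace = ((star U * W * V) * (star U * Z * V)ᴴ).trace := by
    simp only [← star_eq_conjTranspose, star_mul, star_star]
    rw [show star U * W * V * (star V * (star Z * U)) = star U * (W * (V * star V) * star Z * U) by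
      simp only [Matrix.mul_assoc], hV, trace_mul_comm (star U),
      Matrix.mul_assoc _ U, hU, Matrix.mul_one, Matrix.mul_one]
  rw [this]
  simp only [trace, diag]
  refine Finset.sum_congr rfl fun i _ => ?_
  rw [mul_apply]
  refine Finset.sum_congr rfl fun k _ => ?_
  rw [conjTranspose_apply]
  rfl

/-- Separable spectral sums are traces. -/
theorem sum_norm_elt_sq_mul (hA : A.IsHermitian) (hB : B.IsHermitian) (f g : ℝ → ℝ)
    (W : Matrix n n ℂ) :
    ∑ i, ∑ k, ‖hA.elt hB W i k‖ ^ 2 * (f (hA.eigenvalues i) * g (hB.eigenvalues k)) =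
      (cfc f A * W * cfc g B * Wᴴ).trace.re := by
  rw [trace_mul_conjTranspose_eq_sum hA hB, Complex.re_sum]
  refine Finset.sum_congr rfl fun i _ => ?_
  rw [Complex.re_sum]
  refine Finset.sum_congr rfl fun k _ => ?_
  rw [elt_mul_cfc, elt_cfc_mul]
  set z := hA.elt hB W i k
  have : (f (hA.eigenvalues i) : ℂ) * z * g (hB.eigenvalues k) * star z =
      ((‖z‖ ^ 2 * (f (hA.eigenvalues i) * g (hB.eigenvalues k)) : ℝ) : ℂ) := by
    have h := Complex.mul_conj' z
    push_cast
    rw [← h]; simp; ring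
  rw [this, Complex.ofReal_re]

theorem sum_norm_elt_sq (hA : A.IsHermitian) (hB : B.IsHermitian) (W : Matrix n n ℂ) :
    ∑ i, ∑ k, ‖hA.elt hB W i k‖ ^ 2 = W.hsNormSq := by
  have h := hA.sum_norm_elt_sq_mul hB (fun _ => 1) (fun _ => 1) W
  rw [hA.cfc_one_eq, hB.cfc_one_eq] at h
  simp only [mul_one, Matrix.one_mul] at h
  rw [h, hsNormSq, trace_mul_comm]

/-- Weighted sums over a single spectrum are traces. -/
theorem sum_norm_elt_sq_mul_left (hA : A.IsHermitian) (hB : B.IsHermitian) (f : ℝ → ℝ)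
    (W : Matrix n n ℂ) :
    ∑ i, ∑ k, ‖hA.elt hB W i k‖ ^ 2 * f (hA.eigenvalues i) = (cfc f A * W * Wᴴ).trace.re := by
  have h := hA.sum_norm_elt_sq_mul hB f (fun _ => 1) W
  rw [hB.cfc_one_eq] at h
  simpa only [mul_one, Matrix.mul_one] using h

theorem sum_norm_elt_sq_mul_right (hA : A.IsHermitian) (hB : B.IsHermitian) (g : ℝ → ℝ)
    (W : Matrix n n ℂ) :
    ∑ i, ∑ k, ‖hA.elt hB W i k‖ ^ 2 * g (hB.eigenvalues k) = (W * cfc g B * Wᴴ).trace.re := by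
  have h := hA.sum_norm_elt_sq_mul hB (fun _ => 1) g W
  rw [hA.cfc_one_eq] at h
  simpa only [one_mul, Matrix.one_mul] using h

end IsHermitian

/-! ### Continuity of the functional calculus -/

open scoped Matrix.Norms.L2Operator in
theorem continuousOn_cfc_of_isOpen {s : Set ℝ} (hs : IsOpen s) {f : ℝ → ℝ}
    (hf : ContinuousOn f s) :
    ContinuousOn (fun A : Matrix n n ℂ => cfc f A) {A | A.IsHermitian ∧ spectrum ℝ A ⊆ s} := by
  refine ContinuousOn.cfc_of_mem_nhdsSet (A := Matrix n n ℂ) (s := s) f (a := id) ?_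
    continuousOn_id (fun A hA => hA.1) hf
  rw [hs.mem_nhdsSet]
  simp only [Set.iUnion_subset_iff]
  exact fun A hA => hA.2

theorem PosDef.spectrum_subset {A : Matrix n n ℂ} (hA : A.PosDef) :
    spectrum ℝ A ⊆ Set.Ioi 0 := by
  rw [hA.isHermitian.spectrum_real_eq_range_eigenvalues]
  rintro _ ⟨i, rfl⟩
  exact hA.eigenvalues_pos i

open scoped Matrix.Norms.L2Operator in
/-- Positive definite matrices are open in the Hermitian ones. -/
theorem PosDef.eventually_nhds {A : Matrix n n ℂ} (hA : A.PosDef) :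
    ∀ᶠ B in 𝓝 A, B.IsHermitian → B.PosDef := by
  have h := upperHemicontinuous_spectrum ℝ (Matrix n n ℂ) |>.upperHemicontinuousAt A (Set.Ioi 0)
    (isOpen_Ioi.mem_nhdsSet.2 hA.spectrum_subset)
  filter_upwards [h] with B hB hH
  rw [hH.posDef_iff_eigenvalues_pos]
  exact fun i => subset_of_mem_nhdsSet hB (hH.eigenvalues_mem_spectrum_real i)

open Filter in
theorem tendsto_cfc_of_posDef {ι : Type*} {l : Filter ι} {B : ι → Matrix n n ℂ}
    {A : Matrix n n ℂ} (hA : A.PosDef) (hB : ∀ᶠ x in l, (B x).PosDef) (h : Tendsto B l (𝓝 A))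
    {f : ℝ → ℝ} (hf : ContinuousOn f (Set.Ioi 0)) :
    Tendsto (fun x => cfc f (B x)) l (𝓝 (cfc f A)) := by
  have := (continuousOn_cfc_of_isOpen (n := n) isOpen_Ioi hf) A
    ⟨hA.isHermitian, hA.spectrum_subset⟩
  refine this.tendsto.comp (tendsto_nhdsWithin_iff.2 ⟨h, ?_⟩)
  filter_upwards [hB] with x hx using ⟨hx.isHermitian, hx.spectrum_subset⟩

omit [DecidableEq n] in
theorem norm_mul_mul_conjTranspose_le (Z D : Matrix n n ℂ) (i : n) {δ : ℝ}
    (hD : ∀ a b, ‖D a b‖ ≤ δ) :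
    ‖(Z * D * Zᴴ) i i‖ ≤ δ * (Fintype.card n) ^ 2 * Z.hsNormSq := by
  have hZ : ∀ a, ‖Z i a‖ ^ 2 ≤ Z.hsNormSq := fun a => by
    rw [hsNormSq_eq_sum]
    exact (Finset.single_le_sum (f := fun a => ‖Z i a‖ ^ 2) (fun _ _ => by positivity)
      (Finset.mem_univ a)).trans (Finset.single_le_sum (f := fun i => ∑ a, ‖Z i a‖ ^ 2)
      (fun _ _ => by positivity) (Finset.mem_univ i))
  have : (Z * D * Zᴴ) i i = ∑ b, ∑ a, Z i a * D a b * star (Z i b) := by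
    simp [mul_apply, Finset.sum_mul]
  rw [this]
  have hterm : ∀ a b, ‖Z i a * D a b * star (Z i b)‖ ≤ δ * Z.hsNormSq := fun a b => by
    rw [norm_mul, norm_mul, norm_star]
    have h1 := hZ a
    have h2 := hZ b
    have h3 : ‖Z i a‖ * ‖Z i b‖ ≤ Z.hsNormSq := by
      nlinarith [sq_nonneg (‖Z i a‖ - ‖Z i b‖)]
    calc ‖Z i a‖ * ‖D a b‖ * ‖Z i b‖ = ‖D a b‖ * (‖Z i a‖ * ‖Z i b‖) := by ring
      _ ≤ δ * Z.hsNormSq := mul_le_mul (hD a b) h3 (by positivity) ((norm_nonneg _).trans (hD a b))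
  calc ‖∑ b, ∑ a, Z i a * D a b * star (Z i b)‖
      ≤ ∑ b : n, ∑ a : n, δ * Z.hsNormSq :=
        norm_sum_le_of_le _ fun b _ => norm_sum_le_of_le _ fun a _ => hterm a b
    _ = δ * (Fintype.card n) ^ 2 * Z.hsNormSq := by
        simp [Finset.sum_const, Finset.card_univ]; ring

/-- A spectral sum over the eigenbases of `A` and of a nearby matrix `B` agrees, up to a small
multiple of `tr (W† W)`, with the sum over the eigenbasis of `A` alone. -/
theorem eventually_abs_sum_elt_sub_le {ι : Type*} {l : Filter ι} {B : ι → Matrix n n ℂ}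
    {A : Matrix n n ℂ} (hA : A.PosDef) (hB : ∀ x, (B x).IsHermitian)
    (hBpos : ∀ᶠ x in l, (B x).PosDef) (h : Filter.Tendsto B l (𝓝 A))
    {f : n → ℝ → ℝ} (hf : ∀ i, ContinuousOn (f i) (Set.Ioi 0)) {ε : ℝ} (hε : 0 < ε) :
    ∀ᶠ x in l, ∀ W : Matrix n n ℂ,
      |∑ i, ∑ k, ‖hA.isHermitian.elt (hB x) W i k‖ ^ 2 * f i ((hB x).eigenvalues k) -
        ∑ i, ∑ j, ‖hA.isHermitian.elt hA.isHermitian W i j‖ ^ 2 *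
          f i (hA.isHermitian.eigenvalues j)| ≤ ε * W.hsNormSq := by
  set δ : ℝ := ε / ((Fintype.card n + 1) * (Fintype.card n + 1) ^ 2) with hδ
  have hδ0 : 0 < δ := by positivity
  have hev : ∀ i a b, ∀ᶠ x in l, ‖(cfc (f i) (B x) - cfc (f i) A) a b‖ ≤ δ := by
    intro i a b
    have h1 := (tendsto_cfc_of_posDef hA hBpos h (hf i)).sub_const (cfc (f i) A)
    rw [sub_self] at h1
    have h2 := ((continuous_id.matrix_elem a b).norm.tendsto (0 : Matrix n n ℂ)).comp h1
    simp only [id, zero_apply, norm_zero] at h2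
    exact h2.eventually (ge_mem_nhds hδ0)
  have hev' : ∀ᶠ x in l, ∀ i a b, ‖(cfc (f i) (B x) - cfc (f i) A) a b‖ ≤ δ := by
    simpa only [Filter.eventually_all] using hev
  filter_upwards [hev'] with x hx W
  set U := (hA.isHermitian.eigenvectorUnitary : Matrix n n ℂ)
  -- The sum over `k` is a diagonal entry of `f i` applied to the matrix, in the eigenbasis of `A`.
  have key : ∀ (C : Matrix n n ℂ) (hC : C.IsHermitian) (i : n),
      ∑ k, ‖hA.isHermitian.elt hC W i k‖ ^ 2 * f i (hC.eigenvalues k) =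
        ((star U * W) * cfc (f i) C * (star U * W)ᴴ) i i := by
    intro C hC i
    rw [hC.cfc_eq_mul_diagonal_mul]
    set V := (hC.eigenvectorUnitary : Matrix n n ℂ)
    have : star U * W * (V * diagonal (fun k => (f i (hC.eigenvalues k) : ℂ)) * star V) *
        (star U * W)ᴴ = (star U * W * V) * diagonal (fun k => (f i (hC.eigenvalues k) : ℂ)) *
          (star U * W * V)ᴴ := by
      simp only [conjTranspose_mul, Matrix.mul_assoc, star_eq_conjTranspose]
    rw [this, mul_apply]
    push_cast
    refine Finset.sum_congr rfl fun k _ => ?_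
    rw [mul_diagonal, conjTranspose_apply, ← Complex.mul_conj']
    simp only [IsHermitian.elt]
    simp only [RCLike.star_def]
    ring
  have hnorm : (star U * W).hsNormSq = W.hsNormSq := by
    simp only [hsNormSq, conjTranspose_mul, star_eq_conjTranspose, conjTranspose_conjTranspose]
    rw [show Wᴴ * U * (Uᴴ * W) = Wᴴ * (U * star U) * W by
      simp only [Matrix.mul_assoc, star_eq_conjTranspose]]
    rw [show U * star U = 1 from Unitary.coe_mul_star_self _, Matrix.mul_one]
  rw [← Finset.sum_sub_distrib]
  have hterm : ∀ i, |∑ k, ‖hA.isHermitian.elt (hB x) W i k‖ ^ 2 * f i ((hB x).eigenvalues k) -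
      ∑ j, ‖hA.isHermitian.elt hA.isHermitian W i j‖ ^ 2 *
        f i (hA.isHermitian.eigenvalues j)| ≤ δ * (Fintype.card n) ^ 2 * W.hsNormSq := by
    intro i
    rw [← Real.norm_eq_abs, ← Complex.norm_real, Complex.ofReal_sub]
    rw [key _ (hB x) i, key _ hA.isHermitian i, ← sub_apply, ← Matrix.sub_mul, ← Matrix.mul_sub,
      ← hnorm]
    exact norm_mul_mul_conjTranspose_le _ _ i (hx i)
  refine (Finset.abs_sum_le_sum_abs _ _).trans ((Finset.sum_le_sum fun i _ => hterm i).trans ?_)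
  rw [Finset.sum_const, Finset.card_univ, nsmul_eq_mul, ← mul_assoc]
  refine mul_le_mul_of_nonneg_right ?_ W.hsNormSq_nonneg
  have hN : (0 : ℝ) ≤ Fintype.card n := Nat.cast_nonneg _
  calc (Fintype.card n : ℝ) * (δ * (Fintype.card n) ^ 2)
      ≤ (Fintype.card n + 1) * (δ * (Fintype.card n + 1) ^ 2) := by gcongr <;> linarith
    _ = ε := by rw [hδ]; field_simp

end Matrix

/-! ### Scalar inequalities -/

/-- Half the derivative at `s = 1/2` of `s a + (1 - s) b - a ^ s b ^ (1 - s)`. It is antisymmetric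
and vanishes to third order on the diagonal. -/
noncomputable def chernoffSkew (a b : ℝ) : ℝ :=
  (a - b) / 2 - √a * √b * ((Real.log a - Real.log b) / 2)

theorem chernoffSkew_swap (a b : ℝ) : chernoffSkew b a = -chernoffSkew a b := by
  unfold chernoffSkew; ring

/-- The graph of the convex function `s ↦ a ^ s b ^ (1 - s)` lies above its tangent at
`s = 1/2`. -/
theorem sub_rpow_mul_rpow_le {a b : ℝ} (ha : 0 < a) (hb : 0 < b) (s : ℝ) :
    s * a + (1 - s) * b - a ^ s * b ^ (1 - s) ≤
      1 / 2 * (√a - √b) ^ 2 + (2 * s - 1) * chernoffSkew a b := by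
  have h1 : a ^ s * b ^ (1 - s) =
      √a * √b * Real.exp ((s - 1 / 2) * (Real.log a - Real.log b)) := by
    rw [Real.sqrt_eq_rpow, Real.sqrt_eq_rpow, Real.rpow_def_of_pos ha, Real.rpow_def_of_pos hb,
      Real.rpow_def_of_pos ha, Real.rpow_def_of_pos hb, ← Real.exp_add, ← Real.exp_add,
      ← Real.exp_add]
    congr 1; ring
  have h2 := Real.add_one_le_exp ((s - 1 / 2) * (Real.log a - Real.log b))
  have h3 : 0 < √a * √b := by positivity
  have h4 := mul_le_mul_of_nonneg_left h2 h3.le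
  rw [h1, chernoffSkew, sub_sq, Real.sq_sqrt ha.le, Real.sq_sqrt hb.le]
  nlinarith

/-- The function has derivative `(1 - z⁻¹)² / 2`, which vanishes to second order at `1`. -/
theorem abs_half_sub_inv_sub_log_le {z : ℝ} (hz : |z - 1| ≤ 1 / 2) :
    |(z - z⁻¹) / 2 - Real.log z| ≤ 2 * |z - 1| ^ 3 := by
  have hpos : ∀ x ∈ Metric.closedBall (1 : ℝ) |z - 1|, 1 / 2 ≤ x ∧ |x - 1| ≤ |z - 1| := by
    intro x hx
    rw [Metric.mem_closedBall, Real.dist_eq] at hx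
    refine ⟨?_, hx⟩
    have := abs_le.1 (hx.trans hz)
    linarith [this.1]
  have hd : ∀ x ∈ Metric.closedBall (1 : ℝ) |z - 1|,
      HasDerivWithinAt (fun x : ℝ => (x - x⁻¹) / 2 - Real.log x) ((1 - x⁻¹) ^ 2 / 2)
        (Metric.closedBall (1 : ℝ) |z - 1|) x := by
    intro x hx
    have hx0 : x ≠ 0 := by linarith [(hpos x hx).1]
    have := (((hasDerivAt_id' x).sub (hasDerivAt_inv hx0)).div_const 2).sub (Real.hasDerivAt_log hx0)
    refine (this.congr_deriv ?_).hasDerivWithinAt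
    field_simp
    ring
  have hb : ∀ x ∈ Metric.closedBall (1 : ℝ) |z - 1|, ‖(1 - x⁻¹) ^ 2 / 2‖ ≤ 2 * |z - 1| ^ 2 := by
    intro x hx
    obtain ⟨h1, h2⟩ := hpos x hx
    have hx0 : 0 < x := by linarith
    rw [Real.norm_eq_abs, abs_of_nonneg (by positivity)]
    have h3 : (1 - x⁻¹) ^ 2 = (x - 1) ^ 2 / x ^ 2 := by field_simp
    have h4 : (x - 1) ^ 2 ≤ |z - 1| ^ 2 := by
      rw [← sq_abs (x - 1)]; gcongr
    rw [h3, div_div, div_le_iff₀ (by positivity)]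
    have h5 : 1 ≤ 4 * x ^ 2 := by nlinarith
    nlinarith [mul_le_mul_of_nonneg_left h5 (sq_nonneg |z - 1|)]
  have := (convex_closedBall (1 : ℝ) |z - 1|).norm_image_sub_le_of_norm_hasDerivWithin_le hd hb
    (Metric.mem_closedBall_self (abs_nonneg _)) (y := z) (by simp [Real.dist_eq])
  simp only [inv_one, sub_self, zero_div, Real.log_one, sub_zero, Real.norm_eq_abs] at this
  calc _ ≤ _ := this
    _ = _ := by ring

theorem abs_sqrt_sub_sqrt_le {a b : ℝ} (ha : 0 < a) (hb : 0 < b) : |√a - √b| ≤ |a - b| / √a := by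
  have h1 : 0 < √a := Real.sqrt_pos.2 ha
  have h2 : 0 < √b := Real.sqrt_pos.2 hb
  rw [le_div_iff₀ h1]
  have : a - b = (√a - √b) * (√a + √b) := by
    linear_combination -Real.sq_sqrt ha.le + Real.sq_sqrt hb.le
  rw [this, abs_mul, abs_of_pos (by positivity : 0 < √a + √b)]
  nlinarith [abs_nonneg (√a - √b)]

/-- With `z = √(a / b)`, `chernoffSkew a b` is `√a √b ((z - z⁻¹) / 2 - log z)`. -/
theorem abs_chernoffSkew_le {a b : ℝ} (ha : 0 < a) (hb : 0 < b) (hab : |a - b| ≤ 1 / 4 * a) :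
    |chernoffSkew a b| ≤ 4 * |a - b| ^ 3 / a ^ 2 := by
  have hb2 : 3 / 4 * a ≤ b := by have := abs_le.1 hab; linarith [this.2]
  set x := √a with hx
  set y := √b with hy
  have hx0 : 0 < x := Real.sqrt_pos.2 ha
  have hy0 : 0 < y := Real.sqrt_pos.2 hb
  have hxa : x ^ 2 = a := Real.sq_sqrt ha.le
  have hyb : y ^ 2 = b := Real.sq_sqrt hb.le
  have h1 : |x - y| ≤ |a - b| / x := abs_sqrt_sub_sqrt_le ha hb
  have hxy : |x - y| ≤ 1 / 4 * x := by
    refine h1.trans ((div_le_iff₀ hx0).2 ?_)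
    nlinarith
  have hy2 : 3 / 4 * x ≤ y := by have := abs_le.1 hxy; linarith [this.2]
  have hz : |x / y - 1| = |x - y| / y := by
    rw [div_sub_one hy0.ne', abs_div, abs_of_pos hy0]
  have hz2 : |x / y - 1| ≤ 1 / 2 := by
    rw [hz, div_le_iff₀ hy0]; linarith
  have hlog : (Real.log a - Real.log b) / 2 = Real.log (x / y) := by
    rw [Real.log_div hx0.ne' hy0.ne', hx, hy, Real.log_sqrt ha.le, Real.log_sqrt hb.le]; ring
  have hsk : chernoffSkew a b = x * y * ((x / y - (x / y)⁻¹) / 2 - Real.log (x / y)) := by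
    rw [chernoffSkew, hlog, ← hx, ← hy, ← hxa, ← hyb]
    field_simp
  have key := abs_half_sub_inv_sub_log_le hz2
  rw [hz] at key
  rw [hsk, abs_mul, abs_of_pos (by positivity : 0 < x * y)]
  calc x * y * |(x / y - (x / y)⁻¹) / 2 - Real.log (x / y)|
      ≤ x * y * (2 * (|x - y| / y) ^ 3) := by gcongr
    _ = 2 * x * |x - y| ^ 3 / y ^ 2 := by field_simp
    _ ≤ 2 * x * (|a - b| / x) ^ 3 / y ^ 2 := by gcongr
    _ = 2 * |a - b| ^ 3 / (x ^ 2 * y ^ 2) := by field_simp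
    _ ≤ 2 * |a - b| ^ 3 / (a * (1 / 2 * a)) := by
        rw [hxa, hyb]
        gcongr
        linarith
    _ = 4 * |a - b| ^ 3 / a ^ 2 := by field_simp; ring

/-- The quotient of `chernoffSkew` by the square of the difference, with the value `0` on the
diagonal, is continuous. -/
theorem continuousOn_chernoffSkew_div {a : ℝ} (ha : 0 < a) :
    ContinuousOn (fun b => chernoffSkew a b / (a - b) ^ 2) (Set.Ioi 0) := by
  intro b hb
  have hb0 : (0 : ℝ) < b := hb
  by_cases hab : a = b
  · subst hab
    refine ContinuousAt.continuousWithinAt ?_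
    rw [ContinuousAt, sub_self, zero_pow two_ne_zero, div_zero]
    have h0 : Filter.Tendsto (fun b => 4 * |a - b| / a ^ 2) (𝓝 a) (𝓝 0) := by
      have : Continuous (fun b => 4 * |a - b| / a ^ 2) := by fun_prop
      simpa using this.tendsto a
    refine squeeze_zero_norm' ?_ h0
    filter_upwards [Metric.ball_mem_nhds a (by positivity : 0 < 1 / 4 * a)] with b hb
    rw [Metric.mem_ball, dist_comm, Real.dist_eq] at hb
    have hbpos : 0 < b := by have := abs_lt.1 hb; linarith [this.2]
    rw [Real.norm_eq_abs, abs_div, abs_of_nonneg (sq_nonneg (a - b))]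
    rcases eq_or_ne a b with rfl | hne
    · simp
    · have : 0 < (a - b) ^ 2 := by have := sub_ne_zero.2 hne; positivity
      rw [div_le_iff₀ this]
      refine (abs_chernoffSkew_le ha hbpos hb.le).trans (le_of_eq ?_)
      rw [← sq_abs (a - b)]; ring
  · unfold chernoffSkew
    refine ContinuousAt.continuousWithinAt ?_
    have h1 : (a - b) ^ 2 ≠ 0 := pow_ne_zero _ (sub_ne_zero.2 hab)
    have h2 := Real.continuousAt_log hb0.ne'
    fun_prop (disch := assumption)

theorem half_sqrt_sub_sq_eq {a b : ℝ} (ha : 0 < a) (hb : 0 < b) :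
    1 / 2 * (√a - √b) ^ 2 = (a - b) ^ 2 * (1 / 2 * ((√a + √b) ^ 2)⁻¹) := by
  have h1 : 0 < √a := Real.sqrt_pos.2 ha
  have h2 : 0 < √b := Real.sqrt_pos.2 hb
  have : a - b = (√a - √b) * (√a + √b) := by
    linear_combination -Real.sq_sqrt ha.le + Real.sq_sqrt hb.le
  rw [this]
  field_simp

/-- For close `a` and `b` the convexity gap is, uniformly in `s`, at most about `(a - b)² / (8 a)`,
which is its value at `s = 1/2` to leading order. -/
theorem sub_rpow_mul_rpow_le_of_abs_sub_le {a b c s : ℝ} (ha : 0 < a) (hc : c ≤ 1 / 4)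
    (hab : |a - b| ≤ c * a) (hs : s ∈ Set.Icc (0 : ℝ) 1) :
    s * a + (1 - s) * b - a ^ s * b ^ (1 - s) ≤ (1 / 8 + 5 * c) * ((a - b) ^ 2 / a) := by
  have hb : (1 - c) * a ≤ b := by have := abs_le.1 hab; linarith [this.2]
  have hc0 : 0 ≤ c := by
    by_contra h
    push Not at h
    nlinarith [abs_nonneg (a - b)]
  have hb0 : 0 < b := lt_of_lt_of_le (by nlinarith) hb
  refine (sub_rpow_mul_rpow_le ha hb0 s).trans ?_
  have h1 : (2 * s - 1) * chernoffSkew a b ≤ 4 * c * ((a - b) ^ 2 / a) := by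
    have h2 : |2 * s - 1| ≤ 1 := abs_le.2 ⟨by linarith [hs.1], by linarith [hs.2]⟩
    refine (le_abs_self _).trans ?_
    rw [abs_mul]
    calc |2 * s - 1| * |chernoffSkew a b| ≤ 1 * (4 * |a - b| ^ 3 / a ^ 2) :=
          mul_le_mul h2 (abs_chernoffSkew_le ha hb0 (hab.trans (by gcongr))) (abs_nonneg _)
            zero_le_one
      _ = 4 * |a - b| * ((a - b) ^ 2 / a ^ 2) := by rw [← sq_abs (a - b)]; ring
      _ ≤ 4 * (c * a) * ((a - b) ^ 2 / a ^ 2) := by gcongr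
      _ = 4 * c * ((a - b) ^ 2 / a) := by field_simp
  have h3 : 1 / 2 * (√a - √b) ^ 2 ≤ (1 / 8 + c) * ((a - b) ^ 2 / a) := by
    rw [half_sqrt_sub_sq_eq ha hb0, div_eq_mul_inv ((a - b) ^ 2), mul_left_comm (1 / 8 + c)]
    refine mul_le_mul_of_nonneg_left ?_ (sq_nonneg _)
    have h4 : (4 - 3 * c) * a ≤ (√a + √b) ^ 2 := by
      have h5 : (1 - c) * a ≤ √a * √b := by
        rw [← Real.sqrt_mul ha.le]
        refine Real.le_sqrt_of_sq_le ?_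
        have : (1 - c) * (1 - c) * (a * a) ≤ (1 - c) * (a * a) := by
          have : (1 - c) * (1 - c) ≤ 1 - c := by nlinarith
          gcongr
        nlinarith
      have h6 := Real.sq_sqrt ha.le
      have h7 := Real.sq_sqrt hb0.le
      nlinarith
    have h8 : 0 < (4 - 3 * c) * a := by nlinarith
    calc 1 / 2 * ((√a + √b) ^ 2)⁻¹ ≤ 1 / 2 * ((4 - 3 * c) * a)⁻¹ := by gcongr
      _ = (1 / (2 * (4 - 3 * c))) * a⁻¹ := by
          have : 4 - 3 * c ≠ 0 := by linarith
          field_simp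
      _ ≤ (1 / 8 + c) * a⁻¹ := by
          gcongr
          rw [div_le_iff₀ (by linarith)]
          nlinarith
  linarith

theorem le_half_sqrt_sub_sq {a b c : ℝ} (ha : 0 < a) (hb : 0 < b) (hab : |a - b| ≤ c * a) :
    (1 / 8 - c) * ((a - b) ^ 2 / a) ≤ 1 / 2 * (√a - √b) ^ 2 := by
  have hb' : b ≤ (1 + c) * a := by have := abs_le.1 hab; linarith [this.1]
  have hc0 : 0 ≤ c := by
    by_contra h
    push Not at h
    nlinarith [abs_nonneg (a - b)]
  rw [half_sqrt_sub_sq_eq ha hb, div_eq_mul_inv ((a - b) ^ 2), mul_left_comm (1 / 8 - c)]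
  refine mul_le_mul_of_nonneg_left ?_ (sq_nonneg _)
  have h4 : (√a + √b) ^ 2 ≤ (4 + 2 * c) * a := by
    nlinarith [Real.sq_sqrt ha.le, Real.sq_sqrt hb.le, sq_nonneg (√a - √b)]
  have h1 : 0 < √a := Real.sqrt_pos.2 ha
  calc (1 / 8 - c) * a⁻¹ ≤ (1 / (2 * (4 + 2 * c))) * a⁻¹ := by
          gcongr
          rw [le_div_iff₀ (by linarith)]
          nlinarith
    _ = 1 / 2 * ((4 + 2 * c) * a)⁻¹ := by field_simp
    _ ≤ 1 / 2 * ((√a + √b) ^ 2)⁻¹ := by gcongr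

/-! ### Logarithms of overlaps -/

/-- Since `log` takes values in `EReal`, the hypothesis `u ≤ 1/2` also excludes `log 0 = -∞`. -/
theorem EReal.neg_coe_le_log_ofReal {u q : ℝ} (hu : u ≤ 1 / 2) (hq : 1 - u ≤ q) :
    -((u + 2 * u ^ 2 : ℝ) : EReal) ≤ ENNReal.log (ENNReal.ofReal q) := by
  have hq0 : 0 < q := by linarith
  rw [ENNReal.log_ofReal_of_pos hq0, ← EReal.coe_neg, EReal.coe_le_coe_iff]
  have h1 : 0 < 1 - u := by linarith
  have h2 := Real.one_sub_inv_le_log_of_pos h1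
  have h3 := Real.log_le_log h1 hq
  have h4 : (1 - u)⁻¹ ≤ 1 + u + 2 * u ^ 2 := by
    rw [inv_le_iff_one_le_mul₀ h1]
    nlinarith [sq_nonneg u]
  linarith

theorem EReal.log_ofReal_le (q : ℝ) :
    ENNReal.log (ENNReal.ofReal q) ≤ ((q - 1 : ℝ) : EReal) := by
  rcases le_or_gt q 0 with h | h
  · rw [ENNReal.ofReal_of_nonpos h, ENNReal.log_zero]; exact bot_le
  · rw [ENNReal.log_ofReal_of_pos h, EReal.coe_le_coe_iff]
    exact Real.log_le_sub_one_of_pos h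

namespace QState

variable {n : Type*} [Fintype n] [DecidableEq n]

/-- An upper bound for `D_CC` needs a lower bound for the overlaps of all measurements and all
orders. -/
theorem chernoffCC_le {ρ σ : QState n} {u : ℝ} (hu : u ≤ 1 / 2)
    (h : ∀ (M : ℕ) (E : POVM n M), ∀ s ∈ Set.Icc (0 : ℝ) 1,
      1 - u ≤ ∑ b, prob E ρ b ^ s * prob E σ b ^ (1 - s)) :
    chernoffCC ρ σ ≤ ((u + 2 * u ^ 2 : ℝ) : EReal) := by
  rw [chernoffCC, EReal.neg_le]
  exact le_iInf fun M => le_iInf fun E => le_iInf fun s =>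
    EReal.neg_coe_le_log_ofReal hu (h M E s s.2)

/-- A lower bound for `D_CC` needs only one measurement and one order. -/
theorem le_chernoffCC {ρ σ : QState n} {v : ℝ} {M : ℕ} (E : POVM n M) {s : ℝ}
    (hs : s ∈ Set.Icc (0 : ℝ) 1) (h : ∑ b, prob E ρ b ^ s * prob E σ b ^ (1 - s) ≤ 1 - v) :
    (v : EReal) ≤ chernoffCC ρ σ := by
  rw [chernoffCC, EReal.le_neg]
  refine iInf_le_of_le M (iInf_le_of_le E (iInf_le_of_le ⟨s, hs⟩ ?_))
  refine (EReal.log_ofReal_le _).trans ?_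
  rw [← EReal.coe_neg, EReal.coe_le_coe_iff]
  linarith

theorem chernoffQC_le {ρ σ : QState n} {u : ℝ} (hu : u ≤ 1 / 2)
    (h : ∀ s ∈ Set.Icc (0 : ℝ) 1, 1 - u ≤ (ρ.pow s * σ.pow (1 - s)).trace.re) :
    chernoffQC ρ σ ≤ ((u + 2 * u ^ 2 : ℝ) : EReal) := by
  rw [chernoffQC, EReal.neg_le]
  exact le_iInf fun s => EReal.neg_coe_le_log_ofReal hu (h s s.2)

theorem le_chernoffQC {ρ σ : QState n} {v s : ℝ} (hs : s ∈ Set.Icc (0 : ℝ) 1)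
    (h : (ρ.pow s * σ.pow (1 - s)).trace.re ≤ 1 - v) : (v : EReal) ≤ chernoffQC ρ σ := by
  rw [chernoffQC, EReal.le_neg]
  refine iInf_le_of_le ⟨s, hs⟩ ?_
  refine (EReal.log_ofReal_le _).trans ?_
  rw [← EReal.coe_neg, EReal.coe_le_coe_iff]
  linarith

/-! ### Line elements as weighted sums of squares -/

omit [DecidableEq n] in
theorem isHermitian (ρ : QState n) : ρ.1.IsHermitian := ρ.2.1.isHermitian

theorem eigenvalue_nonneg (ρ : QState n) (i : n) : 0 ≤ ρ.eigenvalue i := ρ.2.1.eigenvalues_nonneg i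

theorem sum_eigenvalue (ρ : QState n) : ∑ i, ρ.eigenvalue i = 1 := by
  have h := ρ.isHermitian.trace_eq_sum_eigenvalues
  rw [ρ.2.2] at h
  have := congrArg Complex.re h
  simp only [Complex.one_re, Complex.re_sum, Complex.coe_algebraMap,
    Complex.ofReal_re] at this
  exact this.symm

theorem eigenvalue_le_one (ρ : QState n) (i : n) : ρ.eigenvalue i ≤ 1 := by
  rw [← ρ.sum_eigenvalue]
  exact Finset.single_le_sum (fun j _ => ρ.eigenvalue_nonneg j) (Finset.mem_univ i)

theorem eigenvalue_pos {ρ : QState n} (hρ : ρ ∈ strictlyMixed n) (i : n) : 0 < ρ.eigenvalue i :=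
  Matrix.PosDef.eigenvalues_pos (A := ρ.1) hρ i

theorem eigenEntry_eq_elt (ρ : QState n) (X : Matrix n n ℂ) (i j : n) :
    ρ.eigenEntry X i j = ρ.isHermitian.elt ρ.isHermitian X i j := rfl

theorem norm_eigenEntry_swap (ρ : QState n) {X : Matrix n n ℂ} (hX : X.IsHermitian) (i j : n) :
    ‖ρ.eigenEntry X j i‖ = ‖ρ.eigenEntry X i j‖ := ρ.isHermitian.norm_elt_swap hX i j

theorem sum_norm_eigenEntry_sq (ρ : QState n) (X : Matrix n n ℂ) :
    ∑ i, ∑ j, ‖ρ.eigenEntry X i j‖ ^ 2 = X.hsNormSq :=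
  ρ.isHermitian.sum_norm_elt_sq ρ.isHermitian X

/-- A sum symmetrized over the two indices of a Hermitian matrix. -/
theorem sum_norm_eigenEntry_sq_mul_symm (ρ : QState n) {X : Matrix n n ℂ} (hX : X.IsHermitian)
    (c : n → n → ℝ) :
    ∑ i, ∑ j, ‖ρ.eigenEntry X i j‖ ^ 2 * c i j =
      ∑ i, ∑ j, ‖ρ.eigenEntry X i j‖ ^ 2 * ((c i j + c j i) / 2) := by
  have h : ∑ i, ∑ j, ‖ρ.eigenEntry X i j‖ ^ 2 * c i j =
      ∑ i, ∑ j, ‖ρ.eigenEntry X i j‖ ^ 2 * c j i := by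
    rw [Finset.sum_comm]
    exact Finset.sum_congr rfl fun i _ => Finset.sum_congr rfl fun j _ => by
      rw [ρ.norm_eigenEntry_swap hX]
  have h2 : ∑ i, ∑ j, ‖ρ.eigenEntry X i j‖ ^ 2 * ((c i j + c j i) / 2) =
      (∑ i, ∑ j, ‖ρ.eigenEntry X i j‖ ^ 2 * c i j +
        ∑ i, ∑ j, ‖ρ.eigenEntry X i j‖ ^ 2 * c j i) / 2 := by
    simp only [← Finset.sum_add_distrib, Finset.sum_div]
    exact Finset.sum_congr rfl fun i _ => Finset.sum_congr rfl fun j _ => by ring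
  rw [h2, ← h]; ring

theorem sum_norm_eigenEntry_sq_mul_le (ρ : QState n) (X : Matrix n n ℂ) (c : n → n → ℝ)
    (hc : ∀ i j, 0 ≤ c i j) :
    ∑ i, ∑ j, ‖ρ.eigenEntry X i j‖ ^ 2 * c i j ≤ (∑ i, ∑ j, c i j) * X.hsNormSq := by
  rw [← ρ.sum_norm_eigenEntry_sq X, Finset.mul_sum]
  refine Finset.sum_le_sum fun i _ => ?_
  rw [Finset.mul_sum]
  refine Finset.sum_le_sum fun j _ => ?_
  rw [mul_comm]
  refine mul_le_mul_of_nonneg_right ?_ (by positivity)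
  exact (Finset.single_le_sum (f := fun j => c i j) (fun j _ => hc i j) (Finset.mem_univ j)).trans
    (Finset.single_le_sum (f := fun i => ∑ j, c i j)
      (fun i _ => Finset.sum_nonneg fun j _ => hc i j) (Finset.mem_univ i))

theorem buresMetric_eq_sum (ρ : QState n) (X : Matrix n n ℂ) :
    ρ.buresMetric X = ∑ i, ∑ j, ‖ρ.eigenEntry X i j‖ ^ 2 *
      (1 / 2 * (ρ.eigenvalue i + ρ.eigenvalue j)⁻¹) := by
  simp only [buresMetric, Finset.mul_sum]
  exact Finset.sum_congr rfl fun i _ => Finset.sum_congr rfl fun j _ => by ring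

theorem qcMetric_eq_sum (ρ : QState n) (X : Matrix n n ℂ) :
    ρ.qcMetric X = ∑ i, ∑ j, ‖ρ.eigenEntry X i j‖ ^ 2 *
      (1 / 2 * ((√(ρ.eigenvalue i) + √(ρ.eigenvalue j)) ^ 2)⁻¹) := by
  simp only [qcMetric, Finset.mul_sum]
  exact Finset.sum_congr rfl fun i _ => Finset.sum_congr rfl fun j _ => by ring

theorem buresMetric_nonneg (ρ : QState n) (X : Matrix n n ℂ) : 0 ≤ ρ.buresMetric X := by
  rw [buresMetric_eq_sum]
  refine Finset.sum_nonneg fun i _ => Finset.sum_nonneg fun j _ => ?_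
  have := ρ.eigenvalue_nonneg i
  have := ρ.eigenvalue_nonneg j
  positivity

theorem qcMetric_nonneg (ρ : QState n) (X : Matrix n n ℂ) : 0 ≤ ρ.qcMetric X := by
  unfold qcMetric
  positivity

theorem exists_buresMetric_le (ρ : QState n) : ∃ K, ∀ X, ρ.buresMetric X ≤ K * X.hsNormSq := by
  refine ⟨∑ i, ∑ j, 1 / 2 * (ρ.eigenvalue i + ρ.eigenvalue j)⁻¹, fun X => ?_⟩
  rw [buresMetric_eq_sum]
  refine ρ.sum_norm_eigenEntry_sq_mul_le X _ fun i j => ?_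
  have := ρ.eigenvalue_nonneg i
  have := ρ.eigenvalue_nonneg j
  positivity

theorem exists_qcMetric_le (ρ : QState n) : ∃ K, ∀ X, ρ.qcMetric X ≤ K * X.hsNormSq := by
  refine ⟨∑ i, ∑ j, 1 / 2 * ((√(ρ.eigenvalue i) + √(ρ.eigenvalue j)) ^ 2)⁻¹, fun X => ?_⟩
  rw [qcMetric_eq_sum]
  exact ρ.sum_norm_eigenEntry_sq_mul_le X _ fun i j => by positivity

/-- A weighted sum of squared moduli of matrix elements is a quadratic form. -/
theorem exists_quadraticForm_eq_sum (ρ : QState n) (c : n → n → ℝ) :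
    ∃ Q : QuadraticForm ℝ (Matrix n n ℂ), ∀ X,
      ∑ i, ∑ j, ‖ρ.eigenEntry X i j‖ ^ 2 * c i j = Q X := by
  let ev : n → n → Matrix n n ℂ →ₗ[ℝ] ℂ := fun i j =>
    { toFun := fun X => ρ.eigenEntry X i j
      map_add' := fun X Y => by simp [eigenEntry, Matrix.mul_add, Matrix.add_mul]
      map_smul' := fun r X => by
        simp only [eigenEntry, Matrix.mul_smul, Matrix.smul_mul, Matrix.smul_apply, RingHom.id_apply] }
  refine ⟨∑ i, ∑ j, c i j • (QuadraticMap.sq.comp (Complex.reLm ∘ₗ ev i j) +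
    QuadraticMap.sq.comp (Complex.imLm ∘ₗ ev i j)), fun X => ?_⟩
  simp only [_root_.sum_apply, _root_.smul_apply, _root_.add_apply,
    QuadraticMap.comp_apply, QuadraticMap.sq_apply, LinearMap.comp_apply, smul_eq_mul]
  refine Finset.sum_congr rfl fun i _ => Finset.sum_congr rfl fun j _ => ?_
  rw [← Complex.normSq_eq_norm_sq, Complex.normSq_apply, mul_comm]
  rfl

theorem exists_quadraticForm_buresMetric (ρ : QState n) (r : ℝ) :
    ∃ Q : QuadraticForm ℝ (Matrix n n ℂ), ∀ X, r * ρ.buresMetric X = Q X := by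
  obtain ⟨Q, hQ⟩ := ρ.exists_quadraticForm_eq_sum
    fun i j => 1 / 2 * (ρ.eigenvalue i + ρ.eigenvalue j)⁻¹
  exact ⟨r • Q, fun X => by rw [buresMetric_eq_sum, hQ, _root_.smul_apply, smul_eq_mul]⟩

theorem exists_quadraticForm_qcMetric (ρ : QState n) :
    ∃ Q : QuadraticForm ℝ (Matrix n n ℂ), ∀ X, ρ.qcMetric X = Q X := by
  simp only [qcMetric_eq_sum]
  exact ρ.exists_quadraticForm_eq_sum _

/-! ### Passing to the limit `σ → ρ` -/

theorem tendsto_hsNormSq_sub (ρ : QState n) :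
    Filter.Tendsto (fun σ : QState n => (ρ.1 - σ.1).hsNormSq) (𝓝 ρ) (𝓝 0) := by
  have : Continuous fun σ : QState n => (ρ.1 - σ.1).hsNormSq := by
    simp only [Matrix.hsNormSq_eq_sum]
    have : Continuous fun σ : QState n => ρ.1 - σ.1 := by fun_prop
    exact continuous_finsetSum _ fun i _ => continuous_finsetSum _ fun j _ =>
      ((this.matrix_elem i j).norm.pow 2)
  simpa [Matrix.hsNormSq] using this.tendsto ρ

theorem eventually_mul_hsNormSq_le (ρ : QState n) (S : Set (QState n)) (K : ℝ) {δ : ℝ}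
    (hδ : 0 < δ) : ∀ᶠ σ in 𝓝[S] ρ, K * (ρ.1 - σ.1).hsNormSq ≤ δ := by
  have h := (ρ.tendsto_hsNormSq_sub.const_mul K).mono_left (nhdsWithin_le_nhds (s := S))
  rw [mul_zero] at h
  exact h.eventually (ge_mem_nhds hδ)

/-- The corrections of second order in `u ≈ g (dρ)`, such as those in `-log (1 - u)`, do not
affect the line element. -/
theorem eventually_mul_sq_le (ρ : QState n) (S : Set (QState n)) {g : Matrix n n ℂ → ℝ} {K : ℝ}
    (hg0 : ∀ X, 0 ≤ g X) (hg : ∀ X, g X ≤ K * X.hsNormSq) {ε : ℝ} (hε : 0 < ε) :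
    ∀ᶠ σ in 𝓝[S] ρ, ∀ u, |u - g (ρ.1 - σ.1)| ≤ ε * (ρ.1 - σ.1).hsNormSq →
      |u| ≤ 1 / 2 ∧ 2 * u ^ 2 ≤ ε * (ρ.1 - σ.1).hsNormSq := by
  filter_upwards [ρ.eventually_mul_hsNormSq_le S (K + ε) one_half_pos,
    ρ.eventually_mul_hsNormSq_le S (2 * (K + ε) ^ 2) hε] with σ h1 h2 u hu
  set X := ρ.1 - σ.1
  have hX := X.hsNormSq_nonneg
  have hu' : |u| ≤ (K + ε) * X.hsNormSq := by
    have h3 := abs_le.1 hu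
    have h4 := hg X
    have h5 := hg0 X
    exact abs_le.2 ⟨by nlinarith, by nlinarith⟩
  refine ⟨hu'.trans h1, ?_⟩
  calc 2 * u ^ 2 = 2 * |u| ^ 2 := by rw [sq_abs]
    _ ≤ 2 * ((K + ε) * X.hsNormSq) ^ 2 := by gcongr
    _ = (2 * (K + ε) ^ 2 * X.hsNormSq) * X.hsNormSq := by ring
    _ ≤ ε * X.hsNormSq := by gcongr

/-! ### The quantum Chernoff measure on strictly mixed states -/

omit [DecidableEq n] in
theorem eventually_posDef (ρ : QState n) : ∀ᶠ σ : QState n in 𝓝[strictlyMixed n] ρ, σ.1.PosDef :=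
  self_mem_nhdsWithin

omit [DecidableEq n] in
theorem tendsto_val (ρ : QState n) (S : Set (QState n)) :
    Filter.Tendsto (fun σ : QState n => σ.1) (𝓝[S] ρ) (𝓝 ρ.1) :=
  continuous_subtype_val.continuousAt.tendsto.mono_left nhdsWithin_le_nhds

section Overlap

variable (ρ σ : QState n)

theorem sum_overlap_mul_left :
    ∑ i, ∑ k, ‖ρ.isHermitian.elt σ.isHermitian 1 i k‖ ^ 2 * ρ.eigenvalue i = 1 := by
  have h := ρ.isHermitian.sum_norm_elt_sq_mul_left σ.isHermitian (fun x => x) 1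
  rw [ρ.isHermitian.cfc_id_eq] at h
  simpa [ρ.2.2, eigenvalue] using h

theorem sum_overlap_mul_right :
    ∑ i, ∑ k, ‖ρ.isHermitian.elt σ.isHermitian 1 i k‖ ^ 2 * σ.eigenvalue k = 1 := by
  have h := ρ.isHermitian.sum_norm_elt_sq_mul_right σ.isHermitian (fun x => x) 1
  rw [σ.isHermitian.cfc_id_eq] at h
  simpa [σ.2.2, eigenvalue] using h

/-- `tr (ρ^s σ^{1-s})` is a classical overlap of the distributions `λᵢ|⟨i|k⟩|²` and
`μₖ|⟨i|k⟩|²`. -/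
theorem trace_pow_mul_pow (s : ℝ) :
    (ρ.pow s * σ.pow (1 - s)).trace.re =
      1 - ∑ i, ∑ k, ‖ρ.isHermitian.elt σ.isHermitian 1 i k‖ ^ 2 *
        (s * ρ.eigenvalue i + (1 - s) * σ.eigenvalue k -
          ρ.eigenvalue i ^ s * σ.eigenvalue k ^ (1 - s)) := by
  have h := ρ.isHermitian.sum_norm_elt_sq_mul σ.isHermitian (fun x => x ^ s)
    (fun x => x ^ (1 - s)) 1
  simp only [Matrix.mul_one, Matrix.conjTranspose_one] at h
  rw [pow, pow, ← h]
  have h1 := congrArg (s * ·) (sum_overlap_mul_left ρ σ)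
  have h2 := congrArg ((1 - s) * ·) (sum_overlap_mul_right ρ σ)
  simp only [Finset.mul_sum] at h1 h2
  have h3 : ∑ i, ∑ k, ‖ρ.isHermitian.elt σ.isHermitian 1 i k‖ ^ 2 *
        (s * ρ.eigenvalue i + (1 - s) * σ.eigenvalue k -
          ρ.eigenvalue i ^ s * σ.eigenvalue k ^ (1 - s)) =
      ∑ i, ∑ k, s * (‖ρ.isHermitian.elt σ.isHermitian 1 i k‖ ^ 2 * ρ.eigenvalue i) +
      ∑ i, ∑ k, (1 - s) * (‖ρ.isHermitian.elt σ.isHermitian 1 i k‖ ^ 2 * σ.eigenvalue k) -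
      ∑ i, ∑ k, ‖ρ.isHermitian.elt σ.isHermitian 1 i k‖ ^ 2 *
        (ρ.eigenvalue i ^ s * σ.eigenvalue k ^ (1 - s)) := by
    simp only [← Finset.sum_add_distrib, ← Finset.sum_sub_distrib]
    exact Finset.sum_congr rfl fun i _ => Finset.sum_congr rfl fun k _ => by ring
  rw [h3, h1, h2]
  simp only [eigenvalue]
  ring

theorem norm_elt_sub_sq (i k : n) :
    ‖ρ.isHermitian.elt σ.isHermitian (ρ.1 - σ.1) i k‖ ^ 2 =
      (ρ.eigenvalue i - σ.eigenvalue k) ^ 2 * ‖ρ.isHermitian.elt σ.isHermitian 1 i k‖ ^ 2 := by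
  rw [Matrix.IsHermitian.elt_sub_self, norm_mul, mul_pow, ← Complex.ofReal_sub, Complex.norm_real,
    Real.norm_eq_abs, sq_abs]
  rfl

end Overlap

/-- The overlap of order `1/2` gives the line element `ds²_QC`. -/
theorem eventually_abs_sum_sqrt_sub_qcMetric_le {ρ : QState n} (hρ : ρ ∈ strictlyMixed n) {ε : ℝ}
    (hε : 0 < ε) : ∀ᶠ σ : QState n in 𝓝[strictlyMixed n] ρ,
      |∑ i, ∑ k, ‖ρ.isHermitian.elt σ.isHermitian 1 i k‖ ^ 2 *
        (1 / 2 * (√(ρ.eigenvalue i) - √(σ.eigenvalue k)) ^ 2) - ρ.qcMetric (ρ.1 - σ.1)| ≤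
          ε * (ρ.1 - σ.1).hsNormSq := by
  have hcont : ∀ i, ContinuousOn (fun b => 1 / 2 * ((√(ρ.eigenvalue i) + √b) ^ 2)⁻¹)
      (Set.Ioi 0) := by
    intro i b hb
    have h1 : 0 < √(ρ.eigenvalue i) := Real.sqrt_pos.2 (eigenvalue_pos hρ i)
    have h2 : (√(ρ.eigenvalue i) + √b) ^ 2 ≠ 0 := by positivity
    refine ContinuousAt.continuousWithinAt ?_
    fun_prop (disch := assumption)
  filter_upwards [Matrix.eventually_abs_sum_elt_sub_le (A := ρ.1) hρ
    (fun σ : QState n => σ.isHermitian) ρ.eventually_posDef (ρ.tendsto_val _) hcont hε,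
    ρ.eventually_posDef] with σ h hσ
  have h1 := h (ρ.1 - σ.1)
  rw [qcMetric_eq_sum]
  refine le_of_eq_of_le ?_ h1
  congr 2
  refine Finset.sum_congr rfl fun i _ => Finset.sum_congr rfl fun k _ => ?_
  rw [norm_elt_sub_sq, half_sqrt_sub_sq_eq (eigenvalue_pos hρ i) (eigenvalue_pos hσ k)]
  simp only [eigenvalue]
  ring

/-- In the eigenbasis of `ρ` alone the sum would vanish by antisymmetry, so the overlaps have no
dependence on the order `s` to second order in `dρ`. -/
theorem eventually_abs_sum_chernoffSkew_le {ρ : QState n} (hρ : ρ ∈ strictlyMixed n) {ε : ℝ}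
    (hε : 0 < ε) : ∀ᶠ σ : QState n in 𝓝[strictlyMixed n] ρ,
      |∑ i, ∑ k, ‖ρ.isHermitian.elt σ.isHermitian 1 i k‖ ^ 2 *
        chernoffSkew (ρ.eigenvalue i) (σ.eigenvalue k)| ≤ ε * (ρ.1 - σ.1).hsNormSq := by
  filter_upwards [Matrix.eventually_abs_sum_elt_sub_le (A := ρ.1) hρ
    (fun σ : QState n => σ.isHermitian) ρ.eventually_posDef (ρ.tendsto_val _)
    (fun i => continuousOn_chernoffSkew_div (eigenvalue_pos hρ i)) hε] with σ h
  have h1 := h (ρ.1 - σ.1)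
  have h2 := ρ.sum_norm_eigenEntry_sq_mul_symm (ρ.isHermitian.sub σ.isHermitian) fun i j =>
    chernoffSkew (ρ.eigenvalue i) (ρ.eigenvalue j) / (ρ.eigenvalue i - ρ.eigenvalue j) ^ 2
  have h3 : ∀ i j, (chernoffSkew (ρ.eigenvalue i) (ρ.eigenvalue j) /
      (ρ.eigenvalue i - ρ.eigenvalue j) ^ 2 + chernoffSkew (ρ.eigenvalue j) (ρ.eigenvalue i) /
      (ρ.eigenvalue j - ρ.eigenvalue i) ^ 2) / 2 = 0 := by
    intro i j
    rw [chernoffSkew_swap, ← neg_sub (ρ.eigenvalue i), neg_sq]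
    ring
  simp only [h3, mul_zero, Finset.sum_const_zero] at h2
  simp only [eigenEntry_eq_elt, eigenvalue] at h1 h2
  rw [h2, sub_zero] at h1
  refine le_of_eq_of_le ?_ h1
  congr 1
  refine Finset.sum_congr rfl fun i _ => Finset.sum_congr rfl fun k _ => ?_
  rw [norm_elt_sub_sq]
  rcases eq_or_ne (ρ.eigenvalue i) (σ.eigenvalue k) with h4 | h4
  · rw [h4]
    simp [chernoffSkew]
  · have h5 := sub_ne_zero.2 h4
    simp only [eigenvalue] at h5 ⊢
    field_simp

theorem isInducedMetric_chernoffQC_strictlyMixed :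
    IsInducedMetric (strictlyMixed n) chernoffQC qcMetric where
  quadratic ρ _ := ρ.exists_quadraticForm_qcMetric
  expansion ρ hρ ε hε := by
    have hε4 : 0 < ε / 4 := by positivity
    obtain ⟨K, hK⟩ := ρ.exists_qcMetric_le
    filter_upwards [eventually_abs_sum_sqrt_sub_qcMetric_le hρ hε4,
      eventually_abs_sum_chernoffSkew_le hρ hε4,
      ρ.eventually_mul_sq_le (strictlyMixed n) ρ.qcMetric_nonneg hK (half_pos hε),
      ρ.eventually_posDef] with σ h1 h2 h3 hσ
    change ((_ - ε * (ρ.1 - σ.1).hsNormSq : ℝ) : EReal) ≤ _ ∧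
      _ ≤ ((_ + ε * (ρ.1 - σ.1).hsNormSq : ℝ) : EReal)
    set X := ρ.1 - σ.1 with hX
    have hX0 := X.hsNormSq_nonneg
    constructor
    · refine le_chernoffQC (s := 1 / 2) ⟨by norm_num, by norm_num⟩ ?_
      rw [trace_pow_mul_pow]
      have : ∀ i k, (1 / 2 * ρ.eigenvalue i + (1 - 1 / 2) * σ.eigenvalue k -
          ρ.eigenvalue i ^ (1 / 2 : ℝ) * σ.eigenvalue k ^ (1 - 1 / 2 : ℝ)) =
          1 / 2 * (√(ρ.eigenvalue i) - √(σ.eigenvalue k)) ^ 2 := by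
        intro i k
        rw [show (1 - 1 / 2 : ℝ) = 1 / 2 by norm_num, ← Real.sqrt_eq_rpow, ← Real.sqrt_eq_rpow,
          sub_sq, Real.sq_sqrt (ρ.eigenvalue_nonneg i), Real.sq_sqrt (σ.eigenvalue_nonneg k)]
        ring
      simp only [this]
      have := abs_le.1 h1
      nlinarith
    · set u := ρ.qcMetric X + ε / 2 * X.hsNormSq with hu
      obtain ⟨h4, h5⟩ := h3 u (by
        rw [hu, add_sub_cancel_left, abs_of_nonneg (by positivity)])
      refine (chernoffQC_le (u := u) ((le_abs_self _).trans h4) fun s hs => ?_).trans ?_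
      · rw [trace_pow_mul_pow]
        have h6 : ∑ i, ∑ k, ‖ρ.isHermitian.elt σ.isHermitian 1 i k‖ ^ 2 *
              (s * ρ.eigenvalue i + (1 - s) * σ.eigenvalue k -
                ρ.eigenvalue i ^ s * σ.eigenvalue k ^ (1 - s)) ≤
            ∑ i, ∑ k, ‖ρ.isHermitian.elt σ.isHermitian 1 i k‖ ^ 2 *
              (1 / 2 * (√(ρ.eigenvalue i) - √(σ.eigenvalue k)) ^ 2) +
            (2 * s - 1) * ∑ i, ∑ k, ‖ρ.isHermitian.elt σ.isHermitian 1 i k‖ ^ 2 *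
              chernoffSkew (ρ.eigenvalue i) (σ.eigenvalue k) := by
          simp only [Finset.mul_sum, ← Finset.sum_add_distrib]
          refine Finset.sum_le_sum fun i _ => Finset.sum_le_sum fun k _ => ?_
          have := mul_le_mul_of_nonneg_left
            (sub_rpow_mul_rpow_le (eigenvalue_pos hρ i) (eigenvalue_pos hσ k) s)
            (sq_nonneg ‖ρ.isHermitian.elt σ.isHermitian 1 i k‖)
          linarith
        have h7 := abs_le.1 h1
        have h8 : (2 * s - 1) * ∑ i, ∑ k, ‖ρ.isHermitian.elt σ.isHermitian 1 i k‖ ^ 2 *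
              chernoffSkew (ρ.eigenvalue i) (σ.eigenvalue k) ≤ ε / 4 * X.hsNormSq := by
          refine (le_abs_self _).trans ?_
          rw [abs_mul]
          have h9 : |2 * s - 1| ≤ 1 := abs_le.2 ⟨by linarith [hs.1], by linarith [hs.2]⟩
          exact (mul_le_of_le_one_left (abs_nonneg _) h9).trans h2
        linarith [h7.2]
      · rw [EReal.coe_le_coe_iff]
        linarith

end QState

namespace Matrix

variable {n : Type*} [Fintype n] [DecidableEq n] {A : Matrix n n ℂ}

theorem IsHermitian.elt_mul_self_left {B : Matrix n n ℂ} (hA : A.IsHermitian) (hB : B.IsHermitian)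
    (i k : n) : hA.elt hB (A * A) i k = hA.eigenvalues i ^ 2 * hA.elt hB 1 i k := by
  have h := hA.elt_mul_left hB 1 i k
  rw [Matrix.mul_one] at h
  rw [hA.elt_mul_left, h]; ring

theorem IsHermitian.elt_mul_self_right {B : Matrix n n ℂ} (hA : A.IsHermitian)
    (hB : B.IsHermitian) (i k : n) :
    hA.elt hB (B * B) i k = hB.eigenvalues k ^ 2 * hA.elt hB 1 i k := by
  have h := hA.elt_mul_right hB 1 i k
  rw [Matrix.one_mul] at h
  rw [hA.elt_mul_right, h]; ring

theorem isHermitian_cfc (f : ℝ → ℝ) (A : Matrix n n ℂ) : (cfc f A).IsHermitian :=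
  cfc_predicate (p := IsSelfAdjoint) f A

theorem IsHermitian.continuousOn_spectrum (f : ℝ → ℝ) : ContinuousOn f (spectrum ℝ A) :=
  (A.finite_real_spectrum).continuousOn f

theorem IsHermitian.cfc_mul_cfc (f g : ℝ → ℝ) :
    cfc f A * cfc g A = cfc (fun x => f x * g x) A :=
  (cfc_mul f g A (IsHermitian.continuousOn_spectrum f) (IsHermitian.continuousOn_spectrum g)).symm

theorem IsHermitian.cfc_congr_eigenvalues (hA : A.IsHermitian) {f g : ℝ → ℝ}
    (h : ∀ i, f (hA.eigenvalues i) = g (hA.eigenvalues i)) : cfc f A = cfc g A := by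
  rw [hA.cfc_eq_mul_diagonal_mul, hA.cfc_eq_mul_diagonal_mul]
  simp only [h]

theorem PosSemidef.cfc_sqrt_mul_self (hA : A.PosSemidef) :
    cfc Real.sqrt A * cfc Real.sqrt A = A := by
  rw [IsHermitian.cfc_mul_cfc]
  conv_rhs => rw [← hA.isHermitian.cfc_id_eq]
  exact hA.isHermitian.cfc_congr_eigenvalues fun i => Real.mul_self_sqrt (hA.eigenvalues_nonneg i)

theorem IsHermitian.posSemidef_cfc (hA : A.IsHermitian) {f : ℝ → ℝ}
    (hf : ∀ i, 0 ≤ f (hA.eigenvalues i)) : (cfc f A).PosSemidef := by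
  rw [hA.cfc_eq_mul_diagonal_mul]
  refine PosSemidef.mul_mul_conjTranspose_same (PosSemidef.diagonal fun i => ?_) _
  simpa using hf i

theorem IsHermitian.posDef_cfc (hA : A.IsHermitian) {f : ℝ → ℝ}
    (hf : ∀ i, 0 < f (hA.eigenvalues i)) : (cfc f A).PosDef := by
  rw [hA.cfc_eq_mul_diagonal_mul]
  refine (Matrix.IsUnit.posDef_star_right_conjugate_iff ?_).2 (PosDef.diagonal fun i => ?_)
  · exact (Unitary.toUnits hA.eigenvectorUnitary).isUnit
  · simpa using hf i

theorem cfc_sqrt_posSemidef (hA : A.IsHermitian) : (cfc Real.sqrt A).PosSemidef :=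
  hA.posSemidef_cfc fun _ => Real.sqrt_nonneg _

theorem PosDef.cfc_sqrt (hA : A.PosDef) : (cfc Real.sqrt A).PosDef :=
  hA.isHermitian.posDef_cfc fun i => Real.sqrt_pos.2 (hA.eigenvalues_pos i)

theorem PosSemidef.cfc_sqrt_mul_mul (hA : A.PosSemidef) : cfc Real.sqrt A * A * cfc Real.sqrt A =
    A * A := by
  have h := hA.cfc_sqrt_mul_self
  calc cfc Real.sqrt A * A * cfc Real.sqrt A
      = cfc Real.sqrt A * (cfc Real.sqrt A * cfc Real.sqrt A) * cfc Real.sqrt A := by rw [h]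
    _ = (cfc Real.sqrt A * cfc Real.sqrt A) * (cfc Real.sqrt A * cfc Real.sqrt A) := by
        simp only [Matrix.mul_assoc]
    _ = A * A := by rw [h]

theorem PosSemidef.cfc_sqrt_sq (hA : A.PosSemidef) : cfc Real.sqrt (A * A) = A := by
  have h1 : A * A = cfc (fun x : ℝ => x * x) A := by
    rw [← IsHermitian.cfc_mul_cfc, hA.isHermitian.cfc_id_eq]
  rw [h1, ← cfc_comp' (p := IsSelfAdjoint) Real.sqrt (fun x : ℝ => x * x) A (ha := hA.isHermitian)]
  conv_rhs => rw [← hA.isHermitian.cfc_id_eq]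
  exact hA.isHermitian.cfc_congr_eigenvalues fun i => Real.sqrt_mul_self (hA.eigenvalues_nonneg i)

end Matrix

namespace QState

variable {n : Type*} [Fintype n] [DecidableEq n]

/-! ### The fidelity on strictly mixed states -/

/-- The matrix `√(√ρ σ √ρ)`. -/
noncomputable def fidelityRoot (ρ σ : QState n) : Matrix n n ℂ :=
  cfc Real.sqrt (cfc Real.sqrt ρ.1 * σ.1 * cfc Real.sqrt ρ.1)

theorem fidelity_eq (ρ σ : QState n) : fidelity ρ σ = (fidelityRoot ρ σ).trace.re ^ 2 := rfl

theorem sqrt_mul_mul_sqrt_posSemidef (ρ : QState n) {A : Matrix n n ℂ} (hA : A.PosSemidef) :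
    (cfc Real.sqrt ρ.1 * A * cfc Real.sqrt ρ.1).PosSemidef := by
  have := hA.mul_mul_conjTranspose_same (cfc Real.sqrt ρ.1)
  rwa [(Matrix.isHermitian_cfc Real.sqrt ρ.1).eq] at this

theorem isHermitian_fidelityRoot (ρ σ : QState n) : (fidelityRoot ρ σ).IsHermitian :=
  Matrix.isHermitian_cfc _ _

theorem fidelityRoot_posSemidef (ρ σ : QState n) : (fidelityRoot ρ σ).PosSemidef :=
  Matrix.cfc_sqrt_posSemidef (ρ.sqrt_mul_mul_sqrt_posSemidef σ.2.1).isHermitian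

theorem fidelityRoot_mul_self (ρ σ : QState n) : fidelityRoot ρ σ * fidelityRoot ρ σ =
    cfc Real.sqrt ρ.1 * σ.1 * cfc Real.sqrt ρ.1 :=
  (ρ.sqrt_mul_mul_sqrt_posSemidef σ.2.1).cfc_sqrt_mul_self

theorem fidelityRoot_trace_nonneg (ρ σ : QState n) : 0 ≤ (fidelityRoot ρ σ).trace.re :=
  (Complex.le_def.1 (fidelityRoot_posSemidef ρ σ).trace_nonneg).1

theorem sqrt_fidelity (ρ σ : QState n) : √(fidelity ρ σ) = (fidelityRoot ρ σ).trace.re := by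
  rw [fidelity_eq, Real.sqrt_sq (fidelityRoot_trace_nonneg ρ σ)]

theorem sqrt_mul_mul_sqrt_posDef {ρ : QState n} (hρ : ρ ∈ strictlyMixed n) {A : Matrix n n ℂ}
    (hA : A.PosDef) : (cfc Real.sqrt ρ.1 * A * cfc Real.sqrt ρ.1).PosDef := by
  have h := (Matrix.IsUnit.posDef_star_right_conjugate_iff
    (Matrix.PosDef.cfc_sqrt (A := ρ.1) hρ).isUnit).2 hA
  rwa [Matrix.star_eq_conjTranspose, (Matrix.isHermitian_cfc Real.sqrt ρ.1).eq] at h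

theorem fidelityRoot_posDef {ρ σ : QState n} (hρ : ρ ∈ strictlyMixed n)
    (hσ : σ ∈ strictlyMixed n) : (fidelityRoot ρ σ).PosDef :=
  (sqrt_mul_mul_sqrt_posDef hρ hσ).cfc_sqrt

theorem tendsto_fidelityRoot {ρ : QState n} (hρ : ρ ∈ strictlyMixed n) :
    Filter.Tendsto (fun σ : QState n => fidelityRoot ρ σ) (𝓝[strictlyMixed n] ρ) (𝓝 ρ.1) := by
  have hA : (ρ.1 * ρ.1).PosDef := by
    rw [← ρ.2.1.cfc_sqrt_mul_mul]
    exact sqrt_mul_mul_sqrt_posDef hρ hρ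
  have hc : Continuous fun A : Matrix n n ℂ => cfc Real.sqrt ρ.1 * A * cfc Real.sqrt ρ.1 := by
    fun_prop
  have h := Matrix.tendsto_cfc_of_posDef (l := 𝓝[strictlyMixed n] ρ) (f := Real.sqrt)
    (B := fun σ : QState n => cfc Real.sqrt ρ.1 * σ.1 * cfc Real.sqrt ρ.1) hA
    (by filter_upwards [ρ.eventually_posDef] with σ hσ using sqrt_mul_mul_sqrt_posDef hρ hσ)
    (by
      have := (hc.tendsto ρ.1).comp (ρ.tendsto_val (strictlyMixed n))
      rwa [ρ.2.1.cfc_sqrt_mul_mul] at this)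
    Real.continuous_sqrt.continuousOn
  rwa [ρ.2.1.cfc_sqrt_sq] at h

/-- `2 (1 - √F)` as a spectral sum over the eigenbases of `ρ` and of `M = √(√ρ σ √ρ)`. It holds
because `tr ρ⁻¹ M² = tr σ = 1`, so that the left side is `∑ |⟨i|k⟩|² (λᵢ - mₖ)² / λᵢ`. -/
theorem two_mul_one_sub_trace_fidelityRoot {ρ σ : QState n} (hρ : ρ ∈ strictlyMixed n) :
    2 * (1 - (fidelityRoot ρ σ).trace.re) =
      ∑ i, ∑ k, ‖ρ.isHermitian.elt (isHermitian_fidelityRoot ρ σ)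
          (cfc Real.sqrt ρ.1 * (ρ.1 - σ.1) * cfc Real.sqrt ρ.1) i k‖ ^ 2 *
        (ρ.eigenvalue i *
          (ρ.eigenvalue i + (isHermitian_fidelityRoot ρ σ).eigenvalues k) ^ 2)⁻¹ := by
  set M := fidelityRoot ρ σ with hM
  set hMh : M.IsHermitian := isHermitian_fidelityRoot ρ σ
  set R := cfc Real.sqrt ρ.1 with hR
  have hm : ∀ k, 0 ≤ hMh.eigenvalues k := (fidelityRoot_posSemidef ρ σ).eigenvalues_nonneg
  have hMM : M * M = R * σ.1 * R := fidelityRoot_mul_self ρ σ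
  have hW : R * (ρ.1 - σ.1) * R = ρ.1 * ρ.1 - M * M := by
    rw [hMM, Matrix.mul_sub, Matrix.sub_mul, ρ.2.1.cfc_sqrt_mul_mul]
  have helt : ∀ i k, ‖ρ.isHermitian.elt hMh (R * (ρ.1 - σ.1) * R) i k‖ ^ 2 =
      (ρ.eigenvalue i - hMh.eigenvalues k) ^ 2 * (ρ.eigenvalue i + hMh.eigenvalues k) ^ 2 *
        ‖ρ.isHermitian.elt hMh 1 i k‖ ^ 2 := by
    intro i k
    rw [hW, Matrix.IsHermitian.elt_sub, Matrix.IsHermitian.elt_mul_self_left,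
      Matrix.IsHermitian.elt_mul_self_right,
      show (ρ.isHermitian.eigenvalues i : ℂ) ^ 2 * ρ.isHermitian.elt hMh 1 i k -
        hMh.eigenvalues k ^ 2 * ρ.isHermitian.elt hMh 1 i k =
        (((ρ.eigenvalue i - hMh.eigenvalues k) * (ρ.eigenvalue i + hMh.eigenvalues k) : ℝ) : ℂ) *
          ρ.isHermitian.elt hMh 1 i k by simp only [eigenvalue]; push_cast; ring,
      norm_mul, mul_pow, Complex.norm_real, Real.norm_eq_abs, sq_abs, mul_pow]
  have s1 : ∑ i, ∑ k, ‖ρ.isHermitian.elt hMh 1 i k‖ ^ 2 * ρ.eigenvalue i = 1 := by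
    have h := ρ.isHermitian.sum_norm_elt_sq_mul_left hMh (fun x => x) 1
    rw [ρ.isHermitian.cfc_id_eq] at h
    simpa [ρ.2.2, eigenvalue] using h
  have s2 : ∑ i, ∑ k, ‖ρ.isHermitian.elt hMh 1 i k‖ ^ 2 * hMh.eigenvalues k = M.trace.re := by
    have h := ρ.isHermitian.sum_norm_elt_sq_mul_right hMh (fun x => x) 1
    rw [hMh.cfc_id_eq] at h
    simpa using h
  have s3 : ∑ i, ∑ k, ‖ρ.isHermitian.elt hMh 1 i k‖ ^ 2 *
      ((ρ.eigenvalue i)⁻¹ * hMh.eigenvalues k ^ 2) = 1 := by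
    have h := ρ.isHermitian.sum_norm_elt_sq_mul hMh (fun x => x⁻¹) (fun x => x * x) 1
    have hsq : cfc (fun x : ℝ => x * x) M = R * σ.1 * R := by
      rw [← Matrix.IsHermitian.cfc_mul_cfc, hMh.cfc_id_eq, hMM]
    have hinv : R * cfc (fun x : ℝ => x⁻¹) ρ.1 * R = 1 := by
      rw [hR, Matrix.IsHermitian.cfc_mul_cfc, Matrix.IsHermitian.cfc_mul_cfc,
        ← ρ.isHermitian.cfc_one_eq]
      refine ρ.isHermitian.cfc_congr_eigenvalues fun i => ?_
      have h0 : 0 < ρ.isHermitian.eigenvalues i := eigenvalue_pos hρ i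
      have h1 : 0 < √(ρ.isHermitian.eigenvalues i) := Real.sqrt_pos.2 h0
      have h2 := Real.mul_self_sqrt h0.le
      field_simp
      rw [sq, h2]
    rw [hsq] at h
    simp only [Matrix.mul_one, Matrix.conjTranspose_one] at h
    have htr : (cfc (fun x : ℝ => x⁻¹) ρ.1 * (R * σ.1 * R)).trace = 1 := by
      rw [Matrix.mul_assoc, Matrix.trace_mul_comm, Matrix.mul_assoc, Matrix.trace_mul_comm,
        show σ.1 * R * cfc (fun x : ℝ => x⁻¹) ρ.1 * R =
          σ.1 * (R * cfc (fun x : ℝ => x⁻¹) ρ.1 * R) by simp only [Matrix.mul_assoc], hinv,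
        Matrix.mul_one, σ.2.2]
    rw [htr, Complex.one_re] at h
    simpa only [sq, eigenvalue] using h
  have h4 : ∑ i, ∑ k, ‖ρ.isHermitian.elt hMh (R * (ρ.1 - σ.1) * R) i k‖ ^ 2 *
      (ρ.eigenvalue i * (ρ.eigenvalue i + hMh.eigenvalues k) ^ 2)⁻¹ =
      ∑ i, ∑ k, ‖ρ.isHermitian.elt hMh 1 i k‖ ^ 2 * ρ.eigenvalue i +
      ∑ i, ∑ k, ‖ρ.isHermitian.elt hMh 1 i k‖ ^ 2 *
        ((ρ.eigenvalue i)⁻¹ * hMh.eigenvalues k ^ 2) -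
      2 * ∑ i, ∑ k, ‖ρ.isHermitian.elt hMh 1 i k‖ ^ 2 * hMh.eigenvalues k := by
    simp only [Finset.mul_sum, ← Finset.sum_add_distrib, ← Finset.sum_sub_distrib]
    refine Finset.sum_congr rfl fun i _ => Finset.sum_congr rfl fun k _ => ?_
    have h0 : 0 < ρ.eigenvalue i := eigenvalue_pos hρ i
    have h1 : 0 < ρ.eigenvalue i + hMh.eigenvalues k := add_pos_of_pos_of_nonneg h0 (hm k)
    rw [helt]
    field_simp
    ring
  rw [h4, s1, s2, s3]
  ring

/-- The eigenvalues of a state are at most `1`, so multiplication by `√ρ` is a contraction. -/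
theorem hsNormSq_sqrt_mul_mul_sqrt_le (ρ : QState n) (X : Matrix n n ℂ) :
    (cfc Real.sqrt ρ.1 * X * cfc Real.sqrt ρ.1).hsNormSq ≤ X.hsNormSq := by
  rw [← ρ.sum_norm_eigenEntry_sq, ← ρ.sum_norm_eigenEntry_sq]
  refine Finset.sum_le_sum fun i _ => Finset.sum_le_sum fun j _ => ?_
  rw [eigenEntry_eq_elt, eigenEntry_eq_elt, Matrix.IsHermitian.elt_mul_cfc,
    Matrix.IsHermitian.elt_cfc_mul, norm_mul, norm_mul, Complex.norm_real, Complex.norm_real]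
  have h : ∀ i, ‖√(ρ.isHermitian.eigenvalues i)‖ ≤ 1 := fun i => by
    rw [Real.norm_eq_abs, abs_of_nonneg (Real.sqrt_nonneg _)]
    exact Real.sqrt_le_one.2 (ρ.eigenvalue_le_one i)
  gcongr
  exact (mul_le_of_le_one_right (by positivity) (h j)).trans
    (mul_le_of_le_one_left (by positivity) (h i))

theorem eventually_abs_two_mul_one_sub_trace_sub_le {ρ : QState n} (hρ : ρ ∈ strictlyMixed n)
    {ε : ℝ} (hε : 0 < ε) : ∀ᶠ σ : QState n in 𝓝[strictlyMixed n] ρ,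
      |2 * (1 - (fidelityRoot ρ σ).trace.re) - ρ.buresMetric (ρ.1 - σ.1)| ≤
        ε * (ρ.1 - σ.1).hsNormSq := by
  have hcont : ∀ i, ContinuousOn (fun b => (ρ.eigenvalue i * (ρ.eigenvalue i + b) ^ 2)⁻¹)
      (Set.Ioi 0) := by
    intro i b hb
    have h1 := eigenvalue_pos hρ i
    have hb0 : 0 < b := hb
    have h2 : ρ.eigenvalue i * (ρ.eigenvalue i + b) ^ 2 ≠ 0 := by positivity
    refine ContinuousAt.continuousWithinAt ?_
    fun_prop (disch := assumption)
  filter_upwards [Matrix.eventually_abs_sum_elt_sub_le (A := ρ.1) hρ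
    (fun σ : QState n => isHermitian_fidelityRoot ρ σ)
    (by filter_upwards [ρ.eventually_posDef] with σ hσ using fidelityRoot_posDef hρ hσ)
    (tendsto_fidelityRoot hρ) hcont hε] with σ h
  set X := ρ.1 - σ.1 with hX
  have h1 := h (cfc Real.sqrt ρ.1 * X * cfc Real.sqrt ρ.1)
  rw [← two_mul_one_sub_trace_fidelityRoot hρ] at h1
  have h2 : ρ.buresMetric X = ∑ i, ∑ j, ‖ρ.isHermitian.elt ρ.isHermitian
      (cfc Real.sqrt ρ.1 * X * cfc Real.sqrt ρ.1) i j‖ ^ 2 *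
        (ρ.eigenvalue i * (ρ.eigenvalue i + ρ.eigenvalue j) ^ 2)⁻¹ := by
    -- The weights `λⱼ / (λᵢ + λⱼ)²` symmetrize to `½ / (λᵢ + λⱼ)`.
    have h3 := ρ.sum_norm_eigenEntry_sq_mul_symm (ρ.isHermitian.sub σ.isHermitian) fun i j =>
      ρ.eigenvalue j * ((ρ.eigenvalue i + ρ.eigenvalue j) ^ 2)⁻¹
    rw [buresMetric_eq_sum]
    refine Eq.trans ?_ (h3.symm.trans ?_)
    · refine Finset.sum_congr rfl fun i _ => Finset.sum_congr rfl fun j _ => ?_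
      have hi := eigenvalue_pos hρ i
      have hj := eigenvalue_pos hρ j
      congr 1
      rw [add_comm (ρ.eigenvalue j) (ρ.eigenvalue i)]
      field_simp
      ring
    · refine Finset.sum_congr rfl fun i _ => Finset.sum_congr rfl fun j _ => ?_
      have hi := eigenvalue_pos hρ i
      have hj := eigenvalue_pos hρ j
      rw [Matrix.IsHermitian.elt_mul_cfc, Matrix.IsHermitian.elt_cfc_mul, norm_mul, norm_mul,
        Complex.norm_real, Complex.norm_real, mul_pow, mul_pow, Real.norm_eq_abs, Real.norm_eq_abs,
        sq_abs, sq_abs]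
      change _ = √(ρ.eigenvalue i) ^ 2 * _ * √(ρ.eigenvalue j) ^ 2 * _
      rw [Real.sq_sqrt hi.le, Real.sq_sqrt hj.le, eigenEntry_eq_elt, ← hX]
      field_simp
  rw [h2]
  exact h1.trans (mul_le_mul_of_nonneg_left (ρ.hsNormSq_sqrt_mul_mul_sqrt_le X) hε.le)

theorem isInducedMetric_buresDist_strictlyMixed :
    IsInducedMetric (strictlyMixed n) (fun ρ σ => ((buresDist ρ σ ^ 2 : ℝ) : EReal))
      buresMetric where
  quadratic ρ _ := by simpa only [one_mul] using ρ.exists_quadraticForm_buresMetric 1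
  expansion ρ hρ ε hε := by
    filter_upwards [eventually_abs_two_mul_one_sub_trace_sub_le hρ hε,
      ρ.eventually_posDef] with σ h hσ
    change ((_ - ε * (ρ.1 - σ.1).hsNormSq : ℝ) : EReal) ≤ _ ∧
      _ ≤ ((_ + ε * (ρ.1 - σ.1).hsNormSq : ℝ) : EReal)
    have h0 : 0 ≤ 2 * (1 - (fidelityRoot ρ σ).trace.re) := by
      rw [two_mul_one_sub_trace_fidelityRoot hρ]
      refine Finset.sum_nonneg fun i _ => Finset.sum_nonneg fun k _ => ?_
      have := ρ.eigenvalue_nonneg i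
      positivity
    have h1 : buresDist ρ σ ^ 2 = 2 * (1 - (fidelityRoot ρ σ).trace.re) := by
      rw [buresDist, sqrt_fidelity, mul_pow, Real.sq_sqrt (by norm_num),
        Real.sq_sqrt (by linarith)]
    simp only [h1, EReal.coe_le_coe_iff]
    have := abs_le.1 h
    constructor <;> linarith

theorem isInducedMetric_fidelity_strictlyMixed :
    IsInducedMetric (strictlyMixed n) (fun ρ σ => ((1 - fidelity ρ σ : ℝ) : EReal))
      buresMetric where
  quadratic ρ _ := by simpa only [one_mul] using ρ.exists_quadraticForm_buresMetric 1
  expansion ρ hρ ε hε := by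
    obtain ⟨K, hK⟩ := ρ.exists_buresMetric_le
    filter_upwards [eventually_abs_two_mul_one_sub_trace_sub_le hρ (half_pos hε),
      ρ.eventually_mul_sq_le (strictlyMixed n) ρ.buresMetric_nonneg hK (half_pos hε)] with σ h h1
    change ((_ - ε * (ρ.1 - σ.1).hsNormSq : ℝ) : EReal) ≤ _ ∧
      _ ≤ ((_ + ε * (ρ.1 - σ.1).hsNormSq : ℝ) : EReal)
    have h2 := (h1 _ h).2
    have h3 := abs_le.1 h
    have h4 := (ρ.1 - σ.1).hsNormSq_nonneg
    rw [fidelity_eq]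
    simp only [EReal.coe_le_coe_iff]
    have h5 := sq_nonneg (1 - (fidelityRoot ρ σ).trace.re)
    constructor <;> nlinarith

end QState

/-! ### The local Chernoff measure on strictly mixed states -/

theorem Matrix.IsHermitian.ext_elt {n : Type*} [Fintype n] [DecidableEq n] {A B : Matrix n n ℂ}
    (hA : A.IsHermitian) (hB : B.IsHermitian) {W Z : Matrix n n ℂ}
    (h : ∀ i k, hA.elt hB W i k = hA.elt hB Z i k) : W = Z := by
  have h1 : (W - Z).hsNormSq = 0 := by
    rw [← hA.sum_norm_elt_sq hB]
    simp [Matrix.IsHermitian.elt_sub, h]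
  have h2 : ((W - Z)ᴴ * (W - Z)).trace = 0 :=
    Complex.ext h1 (Complex.le_def.1 (Matrix.posSemidef_conjTranspose_mul_self _).trace_nonneg).2.symm
  exact sub_eq_zero.1 (Matrix.trace_conjTranspose_mul_self_eq_zero_iff.1 h2)

namespace POVM

variable {n : Type*} [Fintype n] [DecidableEq n] {M : ℕ}

theorem sum_trace_effect_mul (E : POVM n M) (A : Matrix n n ℂ) :
    ∑ b, (E.effect b * A).trace.re = A.trace.re := by
  rw [← Complex.re_sum, ← Matrix.trace_sum, ← Finset.sum_mul, E.sum_effect, Matrix.one_mul]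

/-- The projective measurement in an orthonormal eigenbasis of a Hermitian matrix. -/
noncomputable def ofIsHermitian {A : Matrix n n ℂ} (hA : A.IsHermitian) :
    POVM n (Fintype.card n) where
  effect b := (hA.eigenvectorUnitary : Matrix n n ℂ) *
    Matrix.diagonal (Pi.single ((Fintype.equivFin n).symm b) 1) *
    star (hA.eigenvectorUnitary : Matrix n n ℂ)
  posSemidef b := by
    refine Matrix.PosSemidef.mul_mul_conjTranspose_same (Matrix.PosSemidef.diagonal fun i => ?_) _
    by_cases h : i = (Fintype.equivFin n).symm b <;> simp [h]
  sum_effect := by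
    rw [← Finset.sum_mul, ← Finset.mul_sum]
    have : ∑ b, Matrix.diagonal (Pi.single ((Fintype.equivFin n).symm b) (1 : ℂ)) =
        (1 : Matrix n n ℂ) := by
      rw [(Fintype.equivFin n).symm.sum_comp fun i => Matrix.diagonal (Pi.single i (1 : ℂ))]
      ext i j
      rw [Matrix.sum_apply, Matrix.one_apply]
      simp only [Matrix.diagonal_apply]
      split_ifs <;> simp
    rw [this, Matrix.mul_one]
    exact Unitary.coe_mul_star_self _

variable {A : Matrix n n ℂ} (hA : A.IsHermitian)

theorem ofIsHermitian_effect_mul (b : Fin (Fintype.card n)) :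
    (ofIsHermitian hA).effect b * A =
      (hA.eigenvalues ((Fintype.equivFin n).symm b) : ℂ) • (ofIsHermitian hA).effect b := by
  have h : star (hA.eigenvectorUnitary : Matrix n n ℂ) * A =
      Matrix.diagonal (fun i => (hA.eigenvalues i : ℂ)) *
        star (hA.eigenvectorUnitary : Matrix n n ℂ) := by
    have := hA.star_mul_cfc fun x => x
    rwa [hA.cfc_id_eq] at this
  simp only [ofIsHermitian]
  rw [Matrix.mul_assoc, h, ← Matrix.mul_assoc, Matrix.mul_assoc _ (Matrix.diagonal _)
    (Matrix.diagonal _), Matrix.diagonal_mul_diagonal, ← Matrix.smul_mul, ← Matrix.mul_smul,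
    ← Matrix.diagonal_smul]
  congr 3
  ext i
  by_cases hi : i = (Fintype.equivFin n).symm b
  · subst hi; simp
  · simp [hi]

theorem mul_ofIsHermitian_effect (b : Fin (Fintype.card n)) :
    A * (ofIsHermitian hA).effect b =
      (hA.eigenvalues ((Fintype.equivFin n).symm b) : ℂ) • (ofIsHermitian hA).effect b := by
  have h := congrArg Matrix.conjTranspose (ofIsHermitian_effect_mul hA b)
  rw [Matrix.conjTranspose_mul, Matrix.conjTranspose_smul, hA.eq,
    ((ofIsHermitian hA).posSemidef b).isHermitian.eq] at h
  rw [h]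
  simp

end POVM

namespace QState

variable {n : Type*} [Fintype n] [DecidableEq n]

/-- The symmetric logarithmic derivative: the solution `L` of `L ρ + ρ L = 2 X`. -/
noncomputable def symmLogDeriv (ρ : QState n) (X : Matrix n n ℂ) : Matrix n n ℂ :=
  (ρ.isHermitian.eigenvectorUnitary : Matrix n n ℂ) *
    Matrix.of (fun i j => ρ.eigenEntry X i j * ((2 / (ρ.eigenvalue i + ρ.eigenvalue j) : ℝ) : ℂ)) *
    star (ρ.isHermitian.eigenvectorUnitary : Matrix n n ℂ)

theorem elt_symmLogDeriv (ρ : QState n) (X : Matrix n n ℂ) (i j : n) :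
    ρ.isHermitian.elt ρ.isHermitian (ρ.symmLogDeriv X) i j =
      ρ.eigenEntry X i j * ((2 / (ρ.eigenvalue i + ρ.eigenvalue j) : ℝ) : ℂ) := by
  have h : star (ρ.isHermitian.eigenvectorUnitary : Matrix n n ℂ) *
      (ρ.isHermitian.eigenvectorUnitary : Matrix n n ℂ) = 1 := Unitary.coe_star_mul_self _
  simp only [Matrix.IsHermitian.elt, symmLogDeriv]
  rw [← Matrix.mul_assoc, ← Matrix.mul_assoc, h, Matrix.one_mul, Matrix.mul_assoc, h,
    Matrix.mul_one, Matrix.of_apply]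

theorem symmLogDeriv_isHermitian (ρ : QState n) {X : Matrix n n ℂ} (hX : X.IsHermitian) :
    (ρ.symmLogDeriv X).IsHermitian := by
  refine ρ.isHermitian.ext_elt ρ.isHermitian fun i j => ?_
  rw [Matrix.IsHermitian.elt_conjTranspose, elt_symmLogDeriv, elt_symmLogDeriv, star_mul',
    add_comm (ρ.eigenvalue j)]
  congr 1
  · rw [eigenEntry_eq_elt, ← Matrix.IsHermitian.elt_conjTranspose, hX.eq, eigenEntry_eq_elt]
  · simp

theorem symmLogDeriv_mul_add {ρ : QState n} (hρ : ρ ∈ strictlyMixed n) (X : Matrix n n ℂ) :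
    ρ.symmLogDeriv X * ρ.1 + ρ.1 * ρ.symmLogDeriv X = (2 : ℂ) • X := by
  refine ρ.isHermitian.ext_elt ρ.isHermitian fun i j => ?_
  have h1 : ρ.isHermitian.elt ρ.isHermitian ((2 : ℂ) • X) i j = 2 * ρ.eigenEntry X i j := by
    simp [Matrix.IsHermitian.elt, eigenEntry]
  rw [Matrix.IsHermitian.elt_add, Matrix.IsHermitian.elt_mul_left,
    Matrix.IsHermitian.elt_mul_right, elt_symmLogDeriv, h1]
  change _ * (ρ.eigenvalue j : ℂ) + (ρ.eigenvalue i : ℂ) * _ = _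
  have h2 : ((ρ.eigenvalue i + ρ.eigenvalue j : ℝ) : ℂ) ≠ 0 :=
    Complex.ofReal_ne_zero.2 (add_pos (eigenvalue_pos hρ i) (eigenvalue_pos hρ j)).ne'
  push_cast at h2 ⊢
  field_simp
  ring

/-- The quantum Fisher information `tr (L ρ L)` is four times the Bures-Uhlmann line element. -/
theorem trace_symmLogDeriv {ρ : QState n} (hρ : ρ ∈ strictlyMixed n) {X : Matrix n n ℂ}
    (hX : X.IsHermitian) :
    (ρ.symmLogDeriv X * ρ.1 * ρ.symmLogDeriv X).trace.re = 4 * ρ.buresMetric X := by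
  have h := ρ.isHermitian.sum_norm_elt_sq_mul_right ρ.isHermitian (fun x => x) (ρ.symmLogDeriv X)
  rw [ρ.isHermitian.cfc_id_eq, (ρ.symmLogDeriv_isHermitian hX).eq] at h
  rw [← h]
  have h3 := ρ.sum_norm_eigenEntry_sq_mul_symm hX fun i j =>
    4 * ρ.eigenvalue j * ((ρ.eigenvalue i + ρ.eigenvalue j) ^ 2)⁻¹
  rw [buresMetric_eq_sum, Finset.mul_sum]
  simp only [Finset.mul_sum]
  refine Eq.trans ?_ (h3.trans ?_)
  · refine Finset.sum_congr rfl fun i _ => Finset.sum_congr rfl fun j _ => ?_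
    rw [elt_symmLogDeriv, norm_mul, Complex.norm_real, mul_pow, Real.norm_eq_abs, sq_abs]
    change _ * ρ.eigenvalue j = _
    rw [div_pow]
    ring
  · refine Finset.sum_congr rfl fun i _ => Finset.sum_congr rfl fun j _ => ?_
    have hi := eigenvalue_pos hρ i
    have hj := eigenvalue_pos hρ j
    rw [add_comm (ρ.eigenvalue j) (ρ.eigenvalue i)]
    field_simp
    ring

variable {M : ℕ}

theorem prob_nonneg (E : POVM n M) (ρ : QState n) (b : Fin M) : 0 ≤ prob E ρ b :=
  Matrix.trace_mul_re_nonneg (E.posSemidef b) ρ.2.1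

theorem sum_prob (E : POVM n M) (ρ : QState n) : ∑ b, prob E ρ b = 1 := by
  simp only [prob]
  rw [E.sum_trace_effect_mul, ρ.2.2, Complex.one_re]

theorem prob_sub_prob (E : POVM n M) (ρ σ : QState n) (b : Fin M) :
    prob E ρ b - prob E σ b = (E.effect b * (ρ.1 - σ.1)).trace.re := by
  simp [prob, Matrix.mul_sub]

theorem abs_prob_sub_prob_le {ρ σ : QState n} {c : ℝ}
    (h1 : ((c : ℂ) • ρ.1 + (ρ.1 - σ.1)).PosSemidef) (h2 : ((c : ℂ) • ρ.1 - (ρ.1 - σ.1)).PosSemidef)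
    (E : POVM n M) (b : Fin M) : |prob E ρ b - prob E σ b| ≤ c * prob E ρ b := by
  have h3 := Matrix.trace_mul_re_nonneg (E.posSemidef b) h1
  have h4 := Matrix.trace_mul_re_nonneg (E.posSemidef b) h2
  rw [Matrix.mul_add, Matrix.trace_add, Complex.add_re, Matrix.mul_smul, Matrix.trace_smul,
    smul_eq_mul, Complex.re_ofReal_mul] at h3
  rw [Matrix.mul_sub, Matrix.trace_sub, Complex.sub_re, Matrix.mul_smul, Matrix.trace_smul,
    smul_eq_mul, Complex.re_ofReal_mul] at h4
  rw [prob_sub_prob, abs_le]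
  simp only [prob]
  constructor <;> linarith

/-- Near a strictly mixed state `-c ρ ≤ dρ ≤ c ρ`, which controls all measurements at once. -/
theorem eventually_abs_prob_sub_prob_le {ρ : QState n} (hρ : ρ ∈ strictlyMixed n)
    (S : Set (QState n)) {c : ℝ} (hc : 0 < c) :
    ∀ᶠ σ : QState n in 𝓝[S] ρ, ∀ (M : ℕ) (E : POVM n M) (b : Fin M),
      |prob E ρ b - prob E σ b| ≤ c * prob E ρ b := by
  have hpos : ((c : ℂ) • ρ.1).PosDef :=
    Matrix.PosDef.smul (x := ρ.1) hρ (by exact_mod_cast hc)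
  have t1 : Filter.Tendsto (fun σ : QState n => (c : ℂ) • ρ.1 + (ρ.1 - σ.1)) (𝓝[S] ρ)
      (𝓝 ((c : ℂ) • ρ.1)) := by
    have h : Continuous fun A : Matrix n n ℂ => (c : ℂ) • ρ.1 + (ρ.1 - A) := by fun_prop
    simpa [Function.comp_def] using (h.tendsto ρ.1).comp (ρ.tendsto_val S)
  have t2 : Filter.Tendsto (fun σ : QState n => (c : ℂ) • ρ.1 - (ρ.1 - σ.1)) (𝓝[S] ρ)
      (𝓝 ((c : ℂ) • ρ.1)) := by
    have h : Continuous fun A : Matrix n n ℂ => (c : ℂ) • ρ.1 - (ρ.1 - A) := by fun_prop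
    simpa [Function.comp_def] using (h.tendsto ρ.1).comp (ρ.tendsto_val S)
  filter_upwards [t1.eventually hpos.eventually_nhds, t2.eventually hpos.eventually_nhds]
    with σ h1 h2 M E b
  have h3 : (ρ.1 - σ.1).IsHermitian := ρ.isHermitian.sub σ.isHermitian
  exact abs_prob_sub_prob_le (h1 (hpos.isHermitian.add h3)).posSemidef
    (h2 (hpos.isHermitian.sub h3)).posSemidef E b

/-- The classical Fisher information of an outcome is bounded by its share of the quantum Fisher
information. -/
theorem sq_prob_sub_prob_div_le {ρ σ : QState n} (hρ : ρ ∈ strictlyMixed n) (E : POVM n M)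
    {b : Fin M} (hb : 0 < prob E ρ b) :
    (prob E ρ b - prob E σ b) ^ 2 / prob E ρ b ≤
      (E.effect b * (ρ.symmLogDeriv (ρ.1 - σ.1) * ρ.1 * ρ.symmLogDeriv (ρ.1 - σ.1))).trace.re := by
  set X := ρ.1 - σ.1 with hX
  set L := ρ.symmLogDeriv X with hL
  have hLh : L.IsHermitian := ρ.symmLogDeriv_isHermitian (ρ.isHermitian.sub σ.isHermitian)
  have hL2 : L * ρ.1 + ρ.1 * L = (2 : ℂ) • X := symmLogDeriv_mul_add hρ X
  set δ := prob E ρ b - prob E σ b with hδ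
  set p := prob E ρ b with hp
  -- `t = δ / p` is the optimal choice in `0 ≤ tr E (L - t) ρ (L - t)`.
  set t : ℝ := δ / p with ht
  have h0 := Matrix.trace_mul_re_nonneg (E.posSemidef b)
    (ρ.2.1.mul_mul_conjTranspose_same (L - (t : ℂ) • 1))
  have h1 : (L - (t : ℂ) • 1) * ρ.1 * (L - (t : ℂ) • 1)ᴴ =
      L * ρ.1 * L - (t : ℂ) • ((2 : ℂ) • X) + ((t ^ 2 : ℝ) : ℂ) • ρ.1 := by
    rw [Matrix.conjTranspose_sub, hLh.eq, Matrix.conjTranspose_smul, Matrix.conjTranspose_one,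
      ← hL2]
    simp only [Matrix.sub_mul, Matrix.mul_sub, Matrix.smul_mul, Matrix.mul_smul, Matrix.one_mul,
      Matrix.mul_one, RCLike.star_def, Complex.conj_ofReal]
    push_cast
    module
  rw [h1, Matrix.mul_add, Matrix.mul_sub, Matrix.trace_add, Matrix.trace_sub, Complex.add_re,
    Complex.sub_re, Matrix.mul_smul, Matrix.mul_smul, Matrix.mul_smul, Matrix.trace_smul,
    Matrix.trace_smul, Matrix.trace_smul, smul_eq_mul, smul_eq_mul, smul_eq_mul,
    Complex.re_ofReal_mul, Complex.re_ofReal_mul,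
    show ((2 : ℂ) * (E.effect b * X).trace).re = 2 * (E.effect b * X).trace.re by simp,
    ← prob_sub_prob, ← hδ] at h0
  change 0 ≤ _ - t * (2 * δ) + t ^ 2 * p at h0
  have h2 : t * (2 * δ) - t ^ 2 * p = δ ^ 2 / p := by
    rw [ht]; field_simp; ring
  linarith

/-- Every measurement has overlaps of at least about `1 - ½ ds²_BU`: each outcome loses about an
eighth of its Fisher information, and these sum to at most `tr (L ρ L) = 4 ds²_BU`. -/
theorem one_sub_le_sum_prob_rpow {ρ σ : QState n} (hρ : ρ ∈ strictlyMixed n) {c : ℝ}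
    (hc0 : 0 < c) (hc : c ≤ 1 / 4) (E : POVM n M)
    (h : ∀ b, |prob E ρ b - prob E σ b| ≤ c * prob E ρ b) {s : ℝ} (hs : s ∈ Set.Icc (0 : ℝ) 1) :
    1 - (1 / 2 + 20 * c) * ρ.buresMetric (ρ.1 - σ.1) ≤
      ∑ b, prob E ρ b ^ s * prob E σ b ^ (1 - s) := by
  set L := ρ.symmLogDeriv (ρ.1 - σ.1) with hL
  have hLh : L.IsHermitian := ρ.symmLogDeriv_isHermitian (ρ.isHermitian.sub σ.isHermitian)
  have hterm : ∀ b, s * prob E ρ b + (1 - s) * prob E σ b -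
      (1 / 8 + 5 * c) * (E.effect b * (L * ρ.1 * L)).trace.re ≤
        prob E ρ b ^ s * prob E σ b ^ (1 - s) := by
    intro b
    rcases (prob_nonneg E ρ b).eq_or_lt with h0 | h0
    · have h1 := h b
      rw [← h0, mul_zero, zero_sub, abs_neg, abs_nonpos_iff] at h1
      have h2 : 0 ≤ (E.effect b * (L * ρ.1 * L)).trace.re := by
        have := ρ.2.1.mul_mul_conjTranspose_same L
        rw [hLh.eq] at this
        exact Matrix.trace_mul_re_nonneg (E.posSemidef b) this
      have h3 : 0 ≤ prob E ρ b ^ s * prob E σ b ^ (1 - s) :=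
        mul_nonneg (Real.rpow_nonneg (prob_nonneg E ρ b) _)
          (Real.rpow_nonneg (prob_nonneg E σ b) _)
      have h4 : 0 ≤ (1 / 8 + 5 * c) * (E.effect b * (L * ρ.1 * L)).trace.re := by positivity
      rw [← h0, h1] at h3 ⊢
      linarith
    · have h1 := sub_rpow_mul_rpow_le_of_abs_sub_le h0 hc (h b) hs
      have h2 := mul_le_mul_of_nonneg_left (sq_prob_sub_prob_div_le (σ := σ) hρ E h0)
        (by positivity : 0 ≤ 1 / 8 + 5 * c)
      linarith
  refine le_trans (le_of_eq ?_) (Finset.sum_le_sum fun b _ => hterm b)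
  rw [Finset.sum_sub_distrib, Finset.sum_add_distrib, ← Finset.mul_sum, ← Finset.mul_sum,
    ← Finset.mul_sum, sum_prob, sum_prob, E.sum_trace_effect_mul,
    trace_symmLogDeriv hρ (ρ.isHermitian.sub σ.isHermitian)]
  ring

/-- Measuring in an eigenbasis of the symmetric logarithmic derivative attains the quantum Fisher
information. -/
theorem exists_sum_prob_rpow_le {ρ σ : QState n} (hρ : ρ ∈ strictlyMixed n) {c : ℝ}
    (hc : c ≤ 1 / 8)
    (h : ∀ (M : ℕ) (E : POVM n M) b, |prob E ρ b - prob E σ b| ≤ c * prob E ρ b) :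
    ∃ (M : ℕ) (E : POVM n M), ∑ b, prob E ρ b ^ (1 / 2 : ℝ) * prob E σ b ^ (1 - 1 / 2 : ℝ) ≤
      1 - (1 / 2 - 4 * c) * ρ.buresMetric (ρ.1 - σ.1) := by
  set X := ρ.1 - σ.1 with hX
  set L := ρ.symmLogDeriv X with hL
  have hXh : X.IsHermitian := ρ.isHermitian.sub σ.isHermitian
  have hLh : L.IsHermitian := ρ.symmLogDeriv_isHermitian hXh
  have hL2 : L * ρ.1 + ρ.1 * L = (2 : ℂ) • X := symmLogDeriv_mul_add hρ X
  set E := POVM.ofIsHermitian hLh with hE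
  refine ⟨_, E, ?_⟩
  set l : Fin (Fintype.card n) → ℝ := fun b => hLh.eigenvalues ((Fintype.equivFin n).symm b)
  have hEL : ∀ b, E.effect b * L = (l b : ℂ) • E.effect b := POVM.ofIsHermitian_effect_mul hLh
  have hLE : ∀ b, L * E.effect b = (l b : ℂ) • E.effect b := POVM.mul_ofIsHermitian_effect hLh
  have htr : ∀ b (A : Matrix n n ℂ), (E.effect b * (A * L)).trace.re =
      l b * (E.effect b * A).trace.re := by
    intro b A
    rw [← Matrix.mul_assoc, Matrix.trace_mul_comm, ← Matrix.mul_assoc, hLE, Matrix.smul_mul,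
      Matrix.trace_smul, smul_eq_mul, Complex.re_ofReal_mul]
  have htl : ∀ b (A : Matrix n n ℂ), (E.effect b * (L * A)).trace.re =
      l b * (E.effect b * A).trace.re := by
    intro b A
    rw [← Matrix.mul_assoc, hEL, Matrix.smul_mul, Matrix.trace_smul, smul_eq_mul,
      Complex.re_ofReal_mul]
  have hdiff : ∀ b, prob E ρ b - prob E σ b = l b * prob E ρ b := by
    intro b
    have h1 := congrArg (fun A => (E.effect b * A).trace.re) hL2
    simp only [Matrix.mul_add, Matrix.trace_add, Complex.add_re, htl, htr, Matrix.mul_smul,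
      Matrix.trace_smul, smul_eq_mul] at h1
    rw [show ((2 : ℂ) * (E.effect b * X).trace).re = 2 * (E.effect b * X).trace.re by simp,
      hX, ← prob_sub_prob] at h1
    simp only [prob] at h1 ⊢
    linarith
  have hLL : ∀ b, (E.effect b * (L * ρ.1 * L)).trace.re = l b ^ 2 * prob E ρ b := by
    intro b
    rw [htr, htl, prob]; ring
  have hterm : ∀ b, prob E ρ b ^ (1 / 2 : ℝ) * prob E σ b ^ (1 - 1 / 2 : ℝ) ≤
      1 / 2 * prob E ρ b + 1 / 2 * prob E σ b -
        (1 / 8 - c) * (E.effect b * (L * ρ.1 * L)).trace.re := by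
    intro b
    rw [show (1 - 1 / 2 : ℝ) = 1 / 2 by norm_num, ← Real.sqrt_eq_rpow, ← Real.sqrt_eq_rpow]
    have h2 := h _ E b
    rcases (prob_nonneg E ρ b).eq_or_lt with h0 | h0
    · rw [← h0, mul_zero, zero_sub, abs_neg, abs_nonpos_iff] at h2
      rw [hLL, ← h0, h2]
      simp
    · have hσ : 0 < prob E σ b := by
        have := (abs_le.1 h2).2
        nlinarith
      have h3 := le_half_sqrt_sub_sq h0 hσ h2
      have h4 : (prob E ρ b - prob E σ b) ^ 2 / prob E ρ b =
          (E.effect b * (L * ρ.1 * L)).trace.re := by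
        rw [hLL, hdiff]; field_simp
      rw [h4, sub_sq, Real.sq_sqrt h0.le, Real.sq_sqrt hσ.le] at h3
      linarith
  refine (Finset.sum_le_sum fun b _ => hterm b).trans (le_of_eq ?_)
  rw [Finset.sum_sub_distrib, Finset.sum_add_distrib, ← Finset.mul_sum, ← Finset.mul_sum,
    ← Finset.mul_sum, sum_prob, sum_prob, E.sum_trace_effect_mul, trace_symmLogDeriv hρ hXh]
  ring

theorem isInducedMetric_chernoffCC_strictlyMixed :
    IsInducedMetric (strictlyMixed n) chernoffCC (fun ρ X => 1 / 2 * buresMetric ρ X) where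
  quadratic ρ _ := ρ.exists_quadraticForm_buresMetric (1 / 2)
  expansion ρ hρ ε hε := by
    obtain ⟨K, hK⟩ := ρ.exists_buresMetric_le
    set c : ℝ := min (1 / 8) (ε / (40 * (|K| + 1))) with hc
    have hc0 : 0 < c := lt_min (by norm_num) (by positivity)
    have hc8 : c ≤ 1 / 8 := min_le_left _ _
    have hcK : ∀ X, 20 * c * ρ.buresMetric X ≤ ε / 2 * X.hsNormSq := by
      intro X
      have h1 : c * (40 * (|K| + 1)) ≤ ε := (le_div_iff₀ (by positivity)).1 (min_le_right _ _)
      have h2 := X.hsNormSq_nonneg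
      have h3 : ρ.buresMetric X ≤ (|K| + 1) * X.hsNormSq :=
        (hK X).trans (by gcongr; linarith [le_abs_self K])
      calc 20 * c * ρ.buresMetric X ≤ 20 * c * ((|K| + 1) * X.hsNormSq) := by gcongr
        _ = c * (40 * (|K| + 1)) / 2 * X.hsNormSq := by ring
        _ ≤ ε / 2 * X.hsNormSq := by gcongr
    filter_upwards [eventually_abs_prob_sub_prob_le hρ (strictlyMixed n) hc0,
      ρ.eventually_mul_sq_le (g := fun X => 1 / 2 * ρ.buresMetric X) (K := 1 / 2 * K)
        (strictlyMixed n) (fun X => mul_nonneg (by norm_num) (ρ.buresMetric_nonneg X))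
        (fun X => by rw [mul_assoc]; exact mul_le_mul_of_nonneg_left (hK X) (by norm_num))
        (half_pos hε)] with σ h1 h2
    change ((_ - ε * (ρ.1 - σ.1).hsNormSq : ℝ) : EReal) ≤ _ ∧
      _ ≤ ((_ + ε * (ρ.1 - σ.1).hsNormSq : ℝ) : EReal)
    have hX0 := (ρ.1 - σ.1).hsNormSq_nonneg
    have hB0 := ρ.buresMetric_nonneg (ρ.1 - σ.1)
    have hcX := hcK (ρ.1 - σ.1)
    constructor
    · obtain ⟨M, E, hE⟩ := exists_sum_prob_rpow_le hρ hc8 h1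
      refine le_chernoffCC E (s := 1 / 2) ⟨by norm_num, by norm_num⟩ (hE.trans ?_)
      have : c * ρ.buresMetric (ρ.1 - σ.1) ≥ 0 := by positivity
      nlinarith
    · set u := (1 / 2 + 20 * c) * ρ.buresMetric (ρ.1 - σ.1) with hu
      obtain ⟨h4, h5⟩ := h2 u (by
        rw [hu, add_mul, add_sub_cancel_left, abs_of_nonneg (by positivity)]
        exact hcX)
      refine (chernoffCC_le (u := u) ((le_abs_self _).trans h4) fun M E s hs =>
        one_sub_le_sum_prob_rpow hρ hc0 (hc8.trans (by norm_num)) E (h1 M E) hs).trans ?_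
      rw [EReal.coe_le_coe_iff]
      linarith

end QState

namespace QState

variable {n : Type*} [Fintype n]

/-! ### Pure states -/

theorem pure_mul_mul {ρ : QState n} (hρ : ρ ∈ pure n) (A : Matrix n n ℂ) :
    ρ.1 * A * ρ.1 = (ρ.1 * A).trace • ρ.1 := by
  obtain ⟨ψ, hψ⟩ := hρ
  rw [hψ, Matrix.vecMulVec_mul, Matrix.vecMulVec_mul_vecMulVec, Matrix.trace_vecMulVec,
    dotProduct_comm, Matrix.vecMulVec_smul]

variable [DecidableEq n]

theorem pure_mul_self {ρ : QState n} (hρ : ρ ∈ pure n) : ρ.1 * ρ.1 = ρ.1 := by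
  have := pure_mul_mul hρ 1
  rwa [Matrix.mul_one, ρ.2.2, one_smul] at this

theorem eigenvalue_eq_zero_or_one {ρ : QState n} (hρ : ρ ∈ pure n) (i : n) :
    ρ.eigenvalue i = 0 ∨ ρ.eigenvalue i = 1 := by
  have h1 := ρ.isHermitian.elt_mul_self_left ρ.isHermitian i i
  have h2 := ρ.isHermitian.elt_mul_left ρ.isHermitian 1 i i
  have h3 : ρ.isHermitian.elt ρ.isHermitian 1 i i = 1 := by
    simp only [Matrix.IsHermitian.elt, Matrix.mul_one]
    rw [Unitary.coe_star_mul_self, Matrix.one_apply_eq]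
  rw [pure_mul_self hρ] at h1
  rw [Matrix.mul_one, h1, h3, mul_one, mul_one, ← Complex.ofReal_pow, Complex.ofReal_inj] at h2
  have h4 : ρ.eigenvalue i * (ρ.eigenvalue i - 1) = 0 := by
    simp only [eigenvalue]; linarith
  rcases mul_eq_zero.1 h4 with h | h
  · exact Or.inl h
  · exact Or.inr (sub_eq_zero.1 h)

theorem cfc_eq_self_of_pure {ρ : QState n} (hρ : ρ ∈ pure n) {f : ℝ → ℝ} (h0 : f 0 = 0)
    (h1 : f 1 = 1) : cfc f ρ.1 = ρ.1 := by
  conv_rhs => rw [← ρ.isHermitian.cfc_id_eq]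
  refine ρ.isHermitian.cfc_congr_eigenvalues fun i => ?_
  rcases eigenvalue_eq_zero_or_one hρ i with h | h <;> simp only [eigenvalue] at h <;>
    simp only [h, h0, h1]

omit [DecidableEq n] in
theorem trace_mul_eq_ofReal (ρ σ : QState n) :
    (ρ.1 * σ.1).trace = (((ρ.1 * σ.1).trace.re : ℝ) : ℂ) := by
  have h : star (ρ.1 * σ.1).trace = (ρ.1 * σ.1).trace := by
    rw [← Matrix.trace_conjTranspose, Matrix.conjTranspose_mul, ρ.isHermitian.eq,
      σ.isHermitian.eq, Matrix.trace_mul_comm]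
  exact (Complex.conj_eq_iff_re.1 h).symm

theorem hsNormSq_sub_of_pure {ρ σ : QState n} (hρ : ρ ∈ pure n) (hσ : σ ∈ pure n) :
    (ρ.1 - σ.1).hsNormSq = 2 * (1 - (ρ.1 * σ.1).trace.re) := by
  rw [Matrix.hsNormSq, (ρ.isHermitian.sub σ.isHermitian).eq, Matrix.sub_mul, Matrix.mul_sub,
    Matrix.mul_sub, pure_mul_self hρ, pure_mul_self hσ]
  simp only [Matrix.trace_sub, Complex.sub_re, ρ.2.2, σ.2.2, Complex.one_re]
  rw [Matrix.trace_mul_comm σ.1]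
  ring

/-- Weighted sums with weights `½ λᵢ + ½ λⱼ - κ λᵢ λⱼ` in terms of traces. -/
theorem sum_norm_eigenEntry_sq_mul_affine (ρ : QState n) (X : Matrix n n ℂ) (κ : ℝ) :
    ∑ i, ∑ j, ‖ρ.eigenEntry X i j‖ ^ 2 *
        (1 / 2 * ρ.eigenvalue i + 1 / 2 * ρ.eigenvalue j - κ * (ρ.eigenvalue i * ρ.eigenvalue j)) =
      1 / 2 * (ρ.1 * X * Xᴴ).trace.re + 1 / 2 * (X * ρ.1 * Xᴴ).trace.re -
        κ * (ρ.1 * X * ρ.1 * Xᴴ).trace.re := by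
  have h1 := ρ.isHermitian.sum_norm_elt_sq_mul_left ρ.isHermitian (fun x => x) X
  have h2 := ρ.isHermitian.sum_norm_elt_sq_mul_right ρ.isHermitian (fun x => x) X
  have h3 := ρ.isHermitian.sum_norm_elt_sq_mul ρ.isHermitian (fun x => x) (fun x => x) X
  rw [ρ.isHermitian.cfc_id_eq] at h1 h2 h3
  rw [← h1, ← h2, ← h3]
  simp only [Finset.mul_sum, ← Finset.sum_add_distrib, ← Finset.sum_sub_distrib]
  refine Finset.sum_congr rfl fun i _ => Finset.sum_congr rfl fun j _ => ?_
  simp only [eigenEntry_eq_elt, eigenvalue]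
  ring

/-- The weight `½ / (λᵢ + λⱼ)` is `0`, `½` or `¼` at eigenvalues in `{0, 1}`; it vanishes at
`λᵢ = λⱼ = 0` by the convention `0⁻¹ = 0`, in accordance with the restricted sum in `ds²_BU`. -/
theorem buresMetric_of_pure {ρ : QState n} (hρ : ρ ∈ pure n) (X : Matrix n n ℂ) :
    ρ.buresMetric X = 1 / 2 * (ρ.1 * X * Xᴴ).trace.re + 1 / 2 * (X * ρ.1 * Xᴴ).trace.re -
        3 / 4 * (ρ.1 * X * ρ.1 * Xᴴ).trace.re := by
  rw [← sum_norm_eigenEntry_sq_mul_affine, buresMetric_eq_sum]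
  refine Finset.sum_congr rfl fun i _ => Finset.sum_congr rfl fun j _ => ?_
  rcases eigenvalue_eq_zero_or_one hρ i with h | h <;>
  rcases eigenvalue_eq_zero_or_one hρ j with h' | h' <;> rw [h, h'] <;> norm_num

theorem qcMetric_of_pure {ρ : QState n} (hρ : ρ ∈ pure n) (X : Matrix n n ℂ) :
    ρ.qcMetric X = 1 / 2 * (ρ.1 * X * Xᴴ).trace.re + 1 / 2 * (X * ρ.1 * Xᴴ).trace.re -
        7 / 8 * (ρ.1 * X * ρ.1 * Xᴴ).trace.re := by
  rw [← sum_norm_eigenEntry_sq_mul_affine, qcMetric_eq_sum]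
  refine Finset.sum_congr rfl fun i _ => Finset.sum_congr rfl fun j _ => ?_
  rcases eigenvalue_eq_zero_or_one hρ i with h | h <;>
  rcases eigenvalue_eq_zero_or_one hρ j with h' | h' <;> rw [h, h'] <;> norm_num

/-- The line elements at `dρ = ρ - σ` in terms of the overlap `tr ρ σ`. -/
theorem affine_sub_of_pure {ρ σ : QState n} (hρ : ρ ∈ pure n) (hσ : σ ∈ pure n) (κ : ℝ) :
    1 / 2 * (ρ.1 * (ρ.1 - σ.1) * (ρ.1 - σ.1)ᴴ).trace.re +
      1 / 2 * ((ρ.1 - σ.1) * ρ.1 * (ρ.1 - σ.1)ᴴ).trace.re -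
        κ * (ρ.1 * (ρ.1 - σ.1) * ρ.1 * (ρ.1 - σ.1)ᴴ).trace.re =
      (1 - (ρ.1 * σ.1).trace.re) - κ * (1 - (ρ.1 * σ.1).trace.re) ^ 2 := by
  have hr := pure_mul_self hρ
  have hs := pure_mul_self hσ
  have h1 : (ρ.1 * (ρ.1 - σ.1) * (ρ.1 - σ.1)).trace.re = 1 - (ρ.1 * σ.1).trace.re := by
    have : (ρ.1 * σ.1 * ρ.1).trace = (ρ.1 * σ.1).trace := by
      rw [Matrix.trace_mul_comm, ← Matrix.mul_assoc, hr]
    rw [Matrix.mul_sub ρ.1, hr, Matrix.sub_mul, Matrix.mul_sub, Matrix.mul_sub, hr,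
      Matrix.mul_assoc _ _ σ.1, hs]
    simp only [Matrix.trace_sub, Complex.sub_re, this, ρ.2.2, Complex.one_re]
    ring
  have h2 : ((ρ.1 - σ.1) * ρ.1 * (ρ.1 - σ.1)).trace = (ρ.1 * (ρ.1 - σ.1) * (ρ.1 - σ.1)).trace := by
    rw [Matrix.mul_assoc, Matrix.trace_mul_comm]
  have h3 : (ρ.1 * (ρ.1 - σ.1) * ρ.1 * (ρ.1 - σ.1)).trace.re = (1 - (ρ.1 * σ.1).trace.re) ^ 2 := by
    have h4 : (ρ.1 * (ρ.1 - σ.1)).trace = ((1 - (ρ.1 * σ.1).trace.re : ℝ) : ℂ) := by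
      rw [Matrix.mul_sub, hr, Matrix.trace_sub, ρ.2.2, trace_mul_eq_ofReal]; simp
    rw [pure_mul_mul hρ, Matrix.smul_mul, Matrix.trace_smul, h4, smul_eq_mul,
      Complex.re_ofReal_mul, Complex.ofReal_re, sq]
  rw [(ρ.isHermitian.sub σ.isHermitian).eq, h2, h1, h3]
  ring

theorem fidelity_of_pure {ρ : QState n} (hρ : ρ ∈ pure n) (σ : QState n) :
    fidelity ρ σ = (ρ.1 * σ.1).trace.re := by
  have h0 : 0 ≤ (ρ.1 * σ.1).trace.re := Matrix.trace_mul_re_nonneg ρ.2.1 σ.2.1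
  set f := (ρ.1 * σ.1).trace.re with hf
  have h1 : cfc Real.sqrt ρ.1 = ρ.1 := cfc_eq_self_of_pure hρ Real.sqrt_zero Real.sqrt_one
  have h2 : (((√f : ℝ) : ℂ) • ρ.1).PosSemidef :=
    ρ.2.1.smul (by exact_mod_cast Real.sqrt_nonneg f)
  have h3 : ρ.1 * σ.1 * ρ.1 = (((√f : ℝ) : ℂ) • ρ.1) * (((√f : ℝ) : ℂ) • ρ.1) := by
    rw [pure_mul_mul hρ, trace_mul_eq_ofReal, Matrix.smul_mul, Matrix.mul_smul, smul_smul,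
      pure_mul_self hρ, ← Complex.ofReal_mul, Real.mul_self_sqrt h0]
  rw [fidelity, h1, h3, h2.cfc_sqrt_sq, Matrix.trace_smul, ρ.2.2, smul_eq_mul, mul_one,
    Complex.ofReal_re, Real.sq_sqrt h0]

theorem overlap_le_one {ρ σ : QState n} (hρ : ρ ∈ pure n) (hσ : σ ∈ pure n) :
    (ρ.1 * σ.1).trace.re ≤ 1 := by
  have := hsNormSq_sub_of_pure hρ hσ
  have := (ρ.1 - σ.1).hsNormSq_nonneg
  linarith

omit [DecidableEq n] in
theorem overlap_nonneg (ρ σ : QState n) : 0 ≤ (ρ.1 * σ.1).trace.re :=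
  Matrix.trace_mul_re_nonneg ρ.2.1 σ.2.1

theorem eventually_one_sub_overlap_le {ρ : QState n} (hρ : ρ ∈ pure n) {δ : ℝ} (hδ : 0 < δ) :
    ∀ᶠ σ : QState n in 𝓝[pure n] ρ, σ ∈ pure n ∧ 0 ≤ 1 - (ρ.1 * σ.1).trace.re ∧
      1 - (ρ.1 * σ.1).trace.re ≤ δ := by
  filter_upwards [ρ.eventually_mul_hsNormSq_le (pure n) (1 / 2) hδ, self_mem_nhdsWithin]
    with σ h hσ
  rw [hsNormSq_sub_of_pure hρ hσ] at h
  exact ⟨hσ, by linarith [overlap_le_one hρ hσ], by linarith⟩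

theorem isInducedMetric_buresDist_pure :
    IsInducedMetric (pure n) (fun ρ σ => ((buresDist ρ σ ^ 2 : ℝ) : EReal)) buresMetric where
  quadratic ρ _ := by simpa only [one_mul] using ρ.exists_quadraticForm_buresMetric 1
  expansion ρ hρ ε hε := by
    filter_upwards [eventually_one_sub_overlap_le hρ hε] with σ ⟨hσ, h0, h1⟩
    change ((_ - ε * (ρ.1 - σ.1).hsNormSq : ℝ) : EReal) ≤ _ ∧
      _ ≤ ((_ + ε * (ρ.1 - σ.1).hsNormSq : ℝ) : EReal)
    rw [hsNormSq_sub_of_pure hρ hσ, buresMetric_of_pure hρ, affine_sub_of_pure hρ hσ, buresDist,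
      fidelity_of_pure hρ]
    have hf := overlap_nonneg ρ σ
    set f := (ρ.1 * σ.1).trace.re
    have h2 := Real.sq_sqrt hf
    have h3 := Real.sqrt_nonneg f
    have h4 : √f ≤ 1 := Real.sqrt_le_one.2 (by linarith)
    rw [mul_pow, Real.sq_sqrt (by norm_num), Real.sq_sqrt (by linarith), EReal.coe_le_coe_iff,
      EReal.coe_le_coe_iff]
    have h5 : (1 - √f) ^ 2 ≤ (1 - f) ^ 2 := by
      have : f ≤ √f := by nlinarith
      gcongr
    have h6 : (1 - f) ^ 2 ≤ ε * (1 - f) := by nlinarith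
    constructor <;> nlinarith

theorem isInducedMetric_fidelity_pure :
    IsInducedMetric (pure n) (fun ρ σ => ((1 - fidelity ρ σ : ℝ) : EReal)) buresMetric where
  quadratic ρ _ := by simpa only [one_mul] using ρ.exists_quadraticForm_buresMetric 1
  expansion ρ hρ ε hε := by
    filter_upwards [eventually_one_sub_overlap_le hρ hε] with σ ⟨hσ, h0, h1⟩
    change ((_ - ε * (ρ.1 - σ.1).hsNormSq : ℝ) : EReal) ≤ _ ∧
      _ ≤ ((_ + ε * (ρ.1 - σ.1).hsNormSq : ℝ) : EReal)
    rw [hsNormSq_sub_of_pure hρ hσ, buresMetric_of_pure hρ, affine_sub_of_pure hρ hσ,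
      fidelity_of_pure hρ, EReal.coe_le_coe_iff, EReal.coe_le_coe_iff]
    constructor <;> nlinarith

theorem pow_of_pure {ρ : QState n} (hρ : ρ ∈ pure n) {s : ℝ} (hs : s ≠ 0) : ρ.pow s = ρ.1 :=
  cfc_eq_self_of_pure hρ (Real.zero_rpow hs) (Real.one_rpow s)

theorem pow_zero_eq (ρ : QState n) : ρ.pow 0 = 1 := by
  rw [pow, ← ρ.isHermitian.cfc_one_eq]
  simp only [Real.rpow_zero]

theorem isInducedMetric_chernoffQC_pure : IsInducedMetric (pure n) chernoffQC qcMetric where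
  quadratic ρ _ := ρ.exists_quadraticForm_qcMetric
  expansion ρ hρ ε hε := by
    filter_upwards [eventually_one_sub_overlap_le hρ (half_pos hε),
      eventually_one_sub_overlap_le hρ one_half_pos] with σ ⟨hσ, h0, h1⟩ ⟨_, _, h2⟩
    change ((_ - ε * (ρ.1 - σ.1).hsNormSq : ℝ) : EReal) ≤ _ ∧
      _ ≤ ((_ + ε * (ρ.1 - σ.1).hsNormSq : ℝ) : EReal)
    rw [hsNormSq_sub_of_pure hρ hσ, qcMetric_of_pure hρ, affine_sub_of_pure hρ hσ]
    constructor
    · refine le_chernoffQC (s := 1 / 2) ⟨by norm_num, by norm_num⟩ ?_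
      rw [pow_of_pure hρ (by norm_num), pow_of_pure hσ (by norm_num)]
      nlinarith
    · refine (chernoffQC_le h2 fun s hs => ?_).trans (EReal.coe_le_coe_iff.2 ?_)
      · rw [sub_sub_cancel]
        rcases eq_or_ne s 0 with rfl | hs0
        · rw [pow_zero_eq, sub_zero, pow_of_pure hσ one_ne_zero, Matrix.one_mul, σ.2.2]
          exact overlap_le_one hρ hσ
        · rcases eq_or_ne s 1 with rfl | hs1
          · rw [sub_self, pow_zero_eq, pow_of_pure hρ one_ne_zero, Matrix.mul_one, ρ.2.2]
            exact overlap_le_one hρ hσ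
          · rw [pow_of_pure hρ hs0, pow_of_pure hσ (sub_ne_zero.2 hs1.symm)]
      · nlinarith

/-- The measurement testing for a pure state. -/
noncomputable def testPOVM {ρ : QState n} (hρ : ρ ∈ pure n) : POVM n 2 where
  effect := ![ρ.1, 1 - ρ.1]
  posSemidef b := by
    fin_cases b
    · exact ρ.2.1
    · have h : (1 - ρ.1)ᴴ * (1 - ρ.1) = 1 - ρ.1 := by
        rw [Matrix.conjTranspose_sub, Matrix.conjTranspose_one, ρ.isHermitian.eq, Matrix.sub_mul,
          Matrix.mul_sub, Matrix.mul_sub, pure_mul_self hρ]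
        simp
      have := Matrix.posSemidef_conjTranspose_mul_self (1 - ρ.1)
      rw [h] at this
      exact this
  sum_effect := by simp [Fin.sum_univ_two]

omit [DecidableEq n] in
theorem norm_star_dotProduct_sq_le (x y : n → ℂ) :
    ‖star x ⬝ᵥ y‖ ^ 2 ≤ (star x ⬝ᵥ x).re * (star y ⬝ᵥ y).re := by
  have h : ∀ u v : n → ℂ, star u ⬝ᵥ v = inner ℂ (WithLp.toLp 2 u) (WithLp.toLp 2 v) := by
    intro u v
    rw [EuclideanSpace.inner_toLp_toLp, dotProduct_comm]
  rw [h, h, h]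
  have h1 := norm_inner_le_norm (𝕜 := ℂ) (WithLp.toLp 2 x) (WithLp.toLp 2 y)
  have h2 := inner_self_eq_norm_sq (𝕜 := ℂ) (WithLp.toLp 2 x)
  have h3 := inner_self_eq_norm_sq (𝕜 := ℂ) (WithLp.toLp 2 y)
  simp only [RCLike.re_eq_complex_re] at h2 h3
  rw [h2, h3, ← mul_pow]
  gcongr

omit [DecidableEq n] in
theorem trace_mul_vecMulVec (A : Matrix n n ℂ) (x y : n → ℂ) :
    (A * Matrix.vecMulVec x (star y)).trace = star y ⬝ᵥ (A *ᵥ x) := by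
  rw [Matrix.mul_vecMulVec, Matrix.trace_vecMulVec, dotProduct_comm]

/-- The statistics of every measurement on two pure states has a Bhattacharyya coefficient of at
least `√F`. -/
theorem sqrt_overlap_le_sum {ρ σ : QState n} (hρ : ρ ∈ pure n) (hσ : σ ∈ pure n) {M : ℕ}
    (E : POVM n M) : √(ρ.1 * σ.1).trace.re ≤ ∑ b, √(prob E ρ b) * √(prob E σ b) := by
  obtain ⟨ψ, hψ⟩ := hρ
  obtain ⟨φ, hφ⟩ := hσ
  have h1 : (ρ.1 * σ.1).trace.re = ‖star φ ⬝ᵥ ψ‖ ^ 2 := by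
    rw [hφ, trace_mul_vecMulVec, hψ, Matrix.vecMulVec_mulVec, op_smul_eq_smul, dotProduct_smul,
      smul_eq_mul, ← Complex.normSq_eq_norm_sq]
    have : star ψ ⬝ᵥ φ = star (star φ ⬝ᵥ ψ) := by
      rw [Matrix.star_dotProduct]
    rw [this, mul_comm, RCLike.star_def, Complex.mul_conj, Complex.ofReal_re]
  have h2 : star φ ⬝ᵥ ψ = ∑ b, star φ ⬝ᵥ (E.effect b *ᵥ ψ) := by
    rw [← dotProduct_sum, ← Matrix.sum_mulVec, E.sum_effect, Matrix.one_mulVec]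
  rw [h1, Real.sqrt_sq (norm_nonneg _), h2]
  refine norm_sum_le_of_le _ fun b _ => ?_
  obtain ⟨C, hC⟩ : ∃ C : Matrix n n ℂ, E.effect b = Cᴴ * C := by
    open scoped MatrixOrder in
    exact CStarAlgebra.nonneg_iff_eq_star_mul_self.mp
      (Matrix.nonneg_iff_posSemidef.mpr (E.posSemidef b))
  have h3 : ∀ x y : n → ℂ, star x ⬝ᵥ (E.effect b *ᵥ y) = star (C *ᵥ x) ⬝ᵥ (C *ᵥ y) := by
    intro x y
    rw [hC, ← Matrix.mulVec_mulVec, Matrix.dotProduct_mulVec, Matrix.star_mulVec]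
  rw [← Real.sqrt_mul (prob_nonneg E ρ b), prob, prob, hψ, hφ, trace_mul_vecMulVec,
    trace_mul_vecMulVec, h3, h3, h3]
  refine Real.le_sqrt_of_sq_le ?_
  rw [mul_comm]
  exact norm_star_dotProduct_sq_le _ _

/-- By the Cauchy-Schwarz inequality the overlap of order `s` is bounded below by the square of the
Bhattacharyya coefficient, the overlap of order `1 - s` being at most `1`. -/
theorem sq_sum_sqrt_le {M : ℕ} (E : POVM n M) (ρ σ : QState n) {s : ℝ}
    (hs : s ∈ Set.Icc (0 : ℝ) 1) :
    (∑ b, √(prob E ρ b) * √(prob E σ b)) ^ 2 ≤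
      ∑ b, prob E ρ b ^ s * prob E σ b ^ (1 - s) := by
  have hp := prob_nonneg E ρ
  have hq := prob_nonneg E σ
  have hs' : 0 ≤ 1 - s := by linarith [hs.2]
  set f : Fin M → ℝ := fun b => prob E ρ b ^ s * prob E σ b ^ (1 - s)
  set g : Fin M → ℝ := fun b => prob E ρ b ^ (1 - s) * prob E σ b ^ s
  have hf : ∀ b, 0 ≤ f b := fun b =>
    mul_nonneg (Real.rpow_nonneg (hp b) _) (Real.rpow_nonneg (hq b) _)
  have hg : ∀ b, 0 ≤ g b := fun b =>
    mul_nonneg (Real.rpow_nonneg (hp b) _) (Real.rpow_nonneg (hq b) _)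
  have h1 : ∀ b, √(prob E ρ b) * √(prob E σ b) = √(f b) * √(g b) := by
    intro b
    rw [← Real.sqrt_mul (hp b), ← Real.sqrt_mul (hf b)]
    congr 1
    have e1 := Real.rpow_add_of_nonneg (hp b) hs.1 hs'
    have e2 := Real.rpow_add_of_nonneg (hq b) hs.1 hs'
    rw [add_sub_cancel, Real.rpow_one] at e1 e2
    simp only [f, g]
    conv_lhs => rw [e1, e2]
    ring
  have h2 : ∑ b, g b ≤ 1 := by
    calc ∑ b, g b ≤ ∑ b, ((1 - s) * prob E ρ b + s * prob E σ b) :=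
          Finset.sum_le_sum fun b _ => Real.geom_mean_le_arith_mean2_weighted hs' hs.1 (hp b)
            (hq b) (by ring)
      _ = 1 := by
          rw [Finset.sum_add_distrib, ← Finset.mul_sum, ← Finset.mul_sum, sum_prob, sum_prob]
          ring
  have h3 : 0 ≤ ∑ b, f b := Finset.sum_nonneg fun b _ => hf b
  calc (∑ b, √(prob E ρ b) * √(prob E σ b)) ^ 2 = (∑ b, √(f b) * √(g b)) ^ 2 := by simp only [h1]
    _ ≤ (∑ b, √(f b) ^ 2) * ∑ b, √(g b) ^ 2 := Finset.sum_mul_sq_le_sq_mul_sq _ _ _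
    _ = (∑ b, f b) * ∑ b, g b := by simp only [Real.sq_sqrt (hf _), Real.sq_sqrt (hg _)]
    _ ≤ ∑ b, f b := mul_le_of_le_one_right h3 h2

theorem isInducedMetric_chernoffCC_pure : IsInducedMetric (pure n) chernoffCC buresMetric where
  quadratic ρ _ := by simpa only [one_mul] using ρ.exists_quadraticForm_buresMetric 1
  expansion ρ hρ ε hε := by
    filter_upwards [eventually_one_sub_overlap_le hρ (half_pos hε),
      eventually_one_sub_overlap_le hρ one_half_pos] with σ ⟨hσ, h0, h1⟩ ⟨_, _, h2⟩
    change ((_ - ε * (ρ.1 - σ.1).hsNormSq : ℝ) : EReal) ≤ _ ∧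
      _ ≤ ((_ + ε * (ρ.1 - σ.1).hsNormSq : ℝ) : EReal)
    rw [hsNormSq_sub_of_pure hρ hσ, buresMetric_of_pure hρ, affine_sub_of_pure hρ hσ]
    constructor
    · -- The overlap `F ^ (1 - s)` approaches `F` as `s → 0`, while at `s = 0` the convention
      -- `0 ^ 0 = 1` makes it `1`: a small positive `s` is needed.
      set s := min ε (1 / 2) with hs
      have hs0 : 0 < s := lt_min hε one_half_pos
      have hs1 : s ≤ 1 / 2 := min_le_right _ _
      have hsε : s ≤ ε := min_le_left _ _
      refine le_chernoffCC (testPOVM hρ) (s := s) ⟨hs0.le, by linarith⟩ ?_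
      have e1 : prob (testPOVM hρ) ρ 0 = 1 := by
        simp [prob, testPOVM, pure_mul_self hρ, ρ.2.2]
      have e2 : prob (testPOVM hρ) ρ 1 = 0 := by
        simp [prob, testPOVM, Matrix.sub_mul, pure_mul_self hρ]
      have e3 : prob (testPOVM hρ) σ 0 = (ρ.1 * σ.1).trace.re := by
        simp [prob, testPOVM]
      rw [Fin.sum_univ_two, e1, e2, e3, Real.one_rpow, Real.zero_rpow hs0.ne', one_mul, zero_mul,
        add_zero]
      have h3 := rpow_one_add_le_one_add_mul_self
        (s := (ρ.1 * σ.1).trace.re - 1) (by linarith [overlap_nonneg ρ σ])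
        (p := 1 - s) (by linarith) (by linarith)
      rw [add_sub_cancel] at h3
      nlinarith
    · refine (chernoffCC_le h2 fun M E s hs => ?_).trans (EReal.coe_le_coe_iff.2 ?_)
      · rw [sub_sub_cancel]
        refine le_trans ?_ (sq_sum_sqrt_le E ρ σ hs)
        rw [← Real.sq_sqrt (overlap_nonneg ρ σ)]
        gcongr
        exact sqrt_overlap_le_sum hρ hσ E
      · nlinarith

end QState

/-! ### The Fubini-Study metric -/

theorem QState.buresMetric_eq_fubiniStudy {n : Type*} [Fintype n] [DecidableEq n] {ρ : QState n}
    {ψ φ : n → ℂ} (hψ : ρ.1 = Matrix.vecMulVec ψ (star ψ)) (h : (star ψ ⬝ᵥ φ).re = 0) :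
    QState.buresMetric ρ (Matrix.vecMulVec φ (star ψ) + Matrix.vecMulVec ψ (star φ)) =
      fubiniStudy ψ φ := by
  have hρ : ρ ∈ QState.pure n := ⟨ψ, hψ⟩
  have hnorm : star ψ ⬝ᵥ ψ = 1 := by
    rw [← ρ.2.2, hψ, Matrix.trace_vecMulVec, dotProduct_comm]
  set X := Matrix.vecMulVec φ (star ψ) + Matrix.vecMulVec ψ (star φ) with hX
  have hXh : Xᴴ = X := by
    rw [hX, Matrix.conjTranspose_add, Matrix.conjTranspose_vecMulVec,
      Matrix.conjTranspose_vecMulVec, star_star, star_star, add_comm]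
  set z := star ψ ⬝ᵥ φ with hz
  have hz' : star φ ⬝ᵥ ψ = star z := by
    rw [hz, Matrix.star_dotProduct]
  have hzz : star z = -z := by
    apply Complex.ext <;> simp [h]
  have hXψ : X *ᵥ ψ = φ - z • ψ := by
    rw [hX, Matrix.add_mulVec, Matrix.vecMulVec_mulVec, Matrix.vecMulVec_mulVec, hnorm, hz', hzz]
    simp [sub_eq_add_neg]
  have hρX : (ρ.1 * X).trace = 0 := by
    rw [Matrix.trace_mul_comm, hψ, trace_mul_vecMulVec, hXψ, dotProduct_sub, dotProduct_smul, hnorm]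
    simp [hz]
  have h1 : (ρ.1 * X * X).trace = star φ ⬝ᵥ φ + z * z := by
    have hXφ : X *ᵥ φ = z • φ + (star φ ⬝ᵥ φ) • ψ := by
      rw [hX, Matrix.add_mulVec, Matrix.vecMulVec_mulVec, Matrix.vecMulVec_mulVec, op_smul_eq_smul,
        op_smul_eq_smul]
    rw [Matrix.mul_assoc, Matrix.trace_mul_comm, hψ, trace_mul_vecMulVec, ← Matrix.mulVec_mulVec,
      hXψ, Matrix.mulVec_sub, Matrix.mulVec_smul, hXφ, hXψ]
    simp only [dotProduct_sub, dotProduct_add, dotProduct_smul, hnorm, smul_eq_mul, ← hz]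
    ring
  have h2 : (X * ρ.1 * X).trace = (ρ.1 * X * X).trace := by
    rw [Matrix.mul_assoc, Matrix.trace_mul_comm]
  rw [buresMetric_of_pure hρ, hXh, h2, h1, pure_mul_mul hρ, hρX, fubiniStudy, hnorm, ← hz,
    ← Complex.normSq_eq_norm_sq, Complex.normSq_apply, h]
  simp [h]
  ring

namespace QState

open Filter

variable {n : Type*} [Fintype n] [DecidableEq n]

/-! ### Uniqueness of the induced metric -/

open scoped Matrix.Norms.L2Operator in
omit [DecidableEq n] in
theorem continuous_quadraticForm (Q : QuadraticForm ℝ (Matrix n n ℂ)) :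
    Continuous fun X => Q X := by
  classical
  let B : Matrix n n ℂ →ₗ[ℝ] Matrix n n ℂ →L[ℝ] ℝ :=
    LinearMap.toContinuousLinearMap.toLinearMap ∘ₗ QuadraticMap.associated Q
  have hB : Continuous B := B.continuous_of_finiteDimensional
  have h : ∀ X, Q X = B X X := fun X => (QuadraticMap.associated_eq_self_apply ℝ Q X).symm
  simp only [h]
  exact hB.clm_apply continuous_id

omit [DecidableEq n] in
/-- Two metrics induced by the same function agree on the tangent vectors of curves of states. -/
theorem IsInducedMetric.eq_of_tendsto {S : Set (QState n)} {D : QState n → QState n → EReal}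
    {g g' : QState n → Matrix n n ℂ → ℝ} (hg : IsInducedMetric S D g)
    (hg' : IsInducedMetric S D g') {ρ : QState n} (hρ : ρ ∈ S) {σ : ℝ → QState n}
    {X : Matrix n n ℂ} (hS : ∀ᶠ t in 𝓝[>] (0 : ℝ), σ t ∈ S) (hσ : Tendsto σ (𝓝[>] 0) (𝓝 ρ))
    (hX : Tendsto (fun t => t⁻¹ • (ρ.1 - (σ t).1)) (𝓝[>] (0 : ℝ)) (𝓝 X)) : g ρ X = g' ρ X := by
  obtain ⟨Q, hQ⟩ := hg.quadratic ρ hρ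
  obtain ⟨Q', hQ'⟩ := hg'.quadratic ρ hρ
  have hs : Continuous fun X : Matrix n n ℂ => X.hsNormSq := by
    simp only [Matrix.hsNormSq]
    fun_prop
  have key : ∀ ε : ℝ, 0 < ε → |Q X - Q' X| ≤ 2 * ε * X.hsNormSq := by
    intro ε hε
    have hσ' : Tendsto σ (𝓝[>] 0) (𝓝[S] ρ) := tendsto_nhdsWithin_iff.2 ⟨hσ, hS⟩
    have h1 := hσ'.eventually (hg.expansion ρ hρ ε hε)
    have h2 := hσ'.eventually (hg'.expansion ρ hρ ε hε)
    have l1 := (((continuous_quadraticForm Q).tendsto X).comp hX).sub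
      (((continuous_quadraticForm Q').tendsto X).comp hX)
    have l2 := ((hs.tendsto X).comp hX).const_mul (2 * ε)
    refine le_of_tendsto_of_tendsto l1.abs l2 ?_
    filter_upwards [h1, h2] with t h1 h2
    simp only [Function.comp_apply, QuadraticMap.map_smul, smul_eq_mul]
    set Y := ρ.1 - (σ t).1 with hY
    have e1 := EReal.coe_le_coe_iff.1 (h1.1.trans h2.2)
    have e2 := EReal.coe_le_coe_iff.1 (h2.1.trans h1.2)
    change g ρ Y - ε * Y.hsNormSq ≤ g' ρ Y + ε * Y.hsNormSq at e1
    change g' ρ Y - ε * Y.hsNormSq ≤ g ρ Y + ε * Y.hsNormSq at e2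
    rw [hQ, hQ'] at e1 e2
    have e3 : (t⁻¹ • Y).hsNormSq = t⁻¹ * t⁻¹ * Y.hsNormSq := by
      simp only [Matrix.hsNormSq, Matrix.conjTranspose_smul, star_trivial, Matrix.smul_mul,
        Matrix.mul_smul, Matrix.trace_smul, Complex.smul_re, smul_eq_mul, mul_assoc]
    rw [e3, ← mul_sub, abs_mul, abs_mul_self]
    have e4 : |Q Y - Q' Y| ≤ 2 * ε * Y.hsNormSq := abs_le.2 ⟨by linarith, by linarith⟩
    calc t⁻¹ * t⁻¹ * |Q Y - Q' Y| ≤ t⁻¹ * t⁻¹ * (2 * ε * Y.hsNormSq) :=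
          mul_le_mul_of_nonneg_left e4 (mul_self_nonneg _)
      _ = _ := by ring
  rw [hQ, hQ', ← sub_eq_zero, ← abs_nonpos_iff]
  have h0 : Tendsto (fun ε : ℝ => 2 * ε * X.hsNormSq) (𝓝[>] 0) (𝓝 0) := by
    have : Continuous fun ε : ℝ => 2 * ε * X.hsNormSq := by fun_prop
    simpa using (this.tendsto 0).mono_left nhdsWithin_le_nhds
  exact ge_of_tendsto h0 (by filter_upwards [self_mem_nhdsWithin] with ε hε using key ε hε)

/-- Every traceless Hermitian matrix is tangent to the strictly mixed states, along a segment. -/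
theorem IsInducedMetric.eq_of_strictlyMixed {D : QState n → QState n → EReal}
    {g g' : QState n → Matrix n n ℂ → ℝ} (hg : IsInducedMetric (strictlyMixed n) D g)
    (hg' : IsInducedMetric (strictlyMixed n) D g') {ρ : QState n} (hρ : ρ ∈ strictlyMixed n)
    {X : Matrix n n ℂ} (hX : X.IsHermitian) (htr : X.trace = 0) : g ρ X = g' ρ X := by
  classical
  have hH : ∀ t : ℝ, (ρ.1 - t • X).IsHermitian := fun t =>
    ρ.isHermitian.sub (by rw [Matrix.IsHermitian, Matrix.conjTranspose_smul, hX.eq, star_trivial])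
  have hT : ∀ t : ℝ, (ρ.1 - t • X).trace = 1 := fun t => by
    rw [Matrix.trace_sub, Matrix.trace_smul, htr, smul_zero, sub_zero, ρ.2.2]
  have hc : Tendsto (fun t : ℝ => ρ.1 - t • X) (𝓝[>] 0) (𝓝 ρ.1) := by
    have : Continuous fun t : ℝ => ρ.1 - t • X := by fun_prop
    simpa using (this.tendsto 0).mono_left nhdsWithin_le_nhds
  have hpos : ∀ᶠ t in 𝓝[>] (0 : ℝ), (ρ.1 - t • X).PosDef := by
    filter_upwards [hc.eventually (Matrix.PosDef.eventually_nhds (A := ρ.1) hρ)] with t ht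
      using ht (hH t)
  let σ : ℝ → QState n := fun t =>
    if h : (ρ.1 - t • X).PosDef then ⟨ρ.1 - t • X, h.posSemidef, hT t⟩ else ρ
  have hσ : ∀ᶠ t in 𝓝[>] (0 : ℝ), (σ t).1 = ρ.1 - t • X := by
    filter_upwards [hpos] with t ht
    simp only [σ, dif_pos ht]
  refine hg.eq_of_tendsto hg' hρ (σ := σ) ?_ ?_ ?_
  · filter_upwards [hpos, hσ] with t h1 h2
    rw [strictlyMixed, Set.mem_ofPred_eq, h2]
    exact h1
  · refine tendsto_subtype_rng.2 (hc.congr' ?_)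
    filter_upwards [hσ] with t h using h.symm
  · refine tendsto_const_nhds.congr' ?_
    filter_upwards [hσ, self_mem_nhdsWithin] with t h ht
    rw [h, sub_sub_cancel, smul_smul, inv_mul_cancel₀ (ne_of_gt ht), one_smul]

/-- Every `[T, ρ]` with `T` antihermitian is tangent to the pure states, along the curve
`(1 - t T) ρ (1 - t T)† / tr (…)`. -/
theorem IsInducedMetric.eq_of_pure {D : QState n → QState n → EReal}
    {g g' : QState n → Matrix n n ℂ → ℝ} (hg : IsInducedMetric (pure n) D g)
    (hg' : IsInducedMetric (pure n) D g') {ρ : QState n} (hρ : ρ ∈ pure n)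
    {T : Matrix n n ℂ} (hT : Tᴴ = -T) :
    g ρ (T * ρ.1 - ρ.1 * T) = g' ρ (T * ρ.1 - ρ.1 * T) := by
  set c : ℝ := (T * ρ.1 * Tᴴ).trace.re with hc
  have hpsd := ρ.2.1.mul_mul_conjTranspose_same T
  have hc0 : 0 ≤ c := (Complex.le_def.1 hpsd.trace_nonneg).1
  have hc' : (T * ρ.1 * T).trace = -(c : ℂ) := by
    have h1 : (T * ρ.1 * Tᴴ).trace = c :=
      Complex.ext rfl (Complex.le_def.1 hpsd.trace_nonneg).2.symm
    rw [← h1, hT]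
    simp
  set N : ℝ → Matrix n n ℂ := fun t => (1 - t • T) * ρ.1 * (1 - t • T)ᴴ with hN
  have hN' : ∀ t, N t = ρ.1 - t • (T * ρ.1 - ρ.1 * T) - (t ^ 2) • (T * ρ.1 * T) := by
    intro t
    simp only [hN, Matrix.conjTranspose_sub, Matrix.conjTranspose_one, Matrix.conjTranspose_smul,
      hT, star_trivial, Matrix.sub_mul, Matrix.mul_sub, Matrix.smul_mul, Matrix.mul_smul,
      Matrix.one_mul, Matrix.mul_one, Matrix.mul_neg, smul_neg]
    module
  have htr : ∀ t, (N t).trace = ((1 + c * t ^ 2 : ℝ) : ℂ) := by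
    intro t
    rw [hN', Matrix.trace_sub, Matrix.trace_sub, Matrix.trace_smul, Matrix.trace_smul,
      Matrix.trace_sub, Matrix.trace_mul_comm T, sub_self, ρ.2.2, hc']
    simp
    ring
  have hpos : ∀ t : ℝ, 0 < 1 + c * t ^ 2 := fun t => by positivity
  let σ : ℝ → QState n := fun t => ⟨(((1 + c * t ^ 2)⁻¹ : ℝ) : ℂ) • N t,
    (ρ.2.1.mul_mul_conjTranspose_same _).smul (by exact_mod_cast (inv_pos.2 (hpos t)).le), by
      rw [Matrix.trace_smul, htr, smul_eq_mul, ← Complex.ofReal_mul,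
        inv_mul_cancel₀ (hpos t).ne', Complex.ofReal_one]⟩
  have hval : ∀ t, (σ t).1 = (1 + c * t ^ 2)⁻¹ • N t := fun t => by
    change (((1 + c * t ^ 2)⁻¹ : ℝ) : ℂ) • N t = _
    rw [Complex.coe_smul]
  have hcont : Continuous fun t : ℝ => (1 + c * t ^ 2)⁻¹ :=
    Continuous.inv₀ (by fun_prop) fun t => (hpos t).ne'
  refine hg.eq_of_tendsto hg' hρ (σ := σ) (Eventually.of_forall fun t => ?_) ?_ ?_
  · obtain ⟨ψ, hψ⟩ := hρ
    refine ⟨((√((1 + c * t ^ 2)⁻¹) : ℝ) : ℂ) • ((1 - t • T) *ᵥ ψ), ?_⟩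
    have h1 : N t = Matrix.vecMulVec ((1 - t • T) *ᵥ ψ) (star ((1 - t • T) *ᵥ ψ)) := by
      simp only [hN]
      rw [hψ, Matrix.mul_vecMulVec, Matrix.vecMulVec_mul, Matrix.star_mulVec]
    rw [star_smul, Matrix.smul_vecMulVec, Matrix.vecMulVec_smul, smul_smul, ← h1, RCLike.star_def,
      Complex.conj_ofReal, ← Complex.ofReal_mul, Real.mul_self_sqrt (inv_pos.2 (hpos t)).le]
  · refine tendsto_subtype_rng.2 ?_
    simp only [hval, hN']
    have : Continuous fun t : ℝ => (1 + c * t ^ 2)⁻¹ •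
        (ρ.1 - t • (T * ρ.1 - ρ.1 * T) - (t ^ 2) • (T * ρ.1 * T)) := by fun_prop
    simpa using (this.tendsto 0).mono_left nhdsWithin_le_nhds
  · have h1 : Continuous fun t : ℝ => (1 + c * t ^ 2)⁻¹ •
        ((T * ρ.1 - ρ.1 * T) + t • (c • ρ.1 + T * ρ.1 * T)) := by fun_prop
    have h2 := (h1.tendsto 0).mono_left (nhdsWithin_le_nhds (s := Set.Ioi 0))
    simp only [zero_smul, add_zero, ne_eq, OfNat.ofNat_ne_zero, not_false_eq_true, zero_pow,
      mul_zero, inv_one, one_smul] at h2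
    refine h2.congr' ?_
    filter_upwards [self_mem_nhdsWithin] with t ht
    have ht0 : t ≠ 0 := ne_of_gt ht
    rw [hval, hN']
    have h3 : ρ.1 = (1 + c * t ^ 2)⁻¹ • ((1 + c * t ^ 2) • ρ.1) := by
      rw [smul_smul, inv_mul_cancel₀ (hpos t).ne', one_smul]
    have h4 : t⁻¹ * t = 1 := inv_mul_cancel₀ ht0
    calc (1 + c * t ^ 2)⁻¹ • ((T * ρ.1 - ρ.1 * T) + t • (c • ρ.1 + T * ρ.1 * T))
        = (t⁻¹ * t) • (1 + c * t ^ 2)⁻¹ •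
          ((T * ρ.1 - ρ.1 * T) + t • (c • ρ.1 + T * ρ.1 * T)) := by rw [h4, one_smul]
      _ = t⁻¹ • ((1 + c * t ^ 2)⁻¹ • ((1 + c * t ^ 2) • ρ.1) - (1 + c * t ^ 2)⁻¹ •
          (ρ.1 - t • (T * ρ.1 - ρ.1 * T) - (t ^ 2) • (T * ρ.1 * T))) := by module
      _ = _ := by rw [← h3]

/-! ### Limits of the line elements at a pure state -/

theorem norm_eigenEntry_commutator_sq (ρ : QState n) (T : Matrix n n ℂ) (i j : n) :
    ‖ρ.eigenEntry (T * ρ.1 - ρ.1 * T) i j‖ ^ 2 =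
      ‖ρ.eigenEntry T i j‖ ^ 2 * (ρ.eigenvalue i - ρ.eigenvalue j) ^ 2 := by
  rw [eigenEntry_eq_elt, Matrix.IsHermitian.elt_sub, Matrix.IsHermitian.elt_mul_left,
    Matrix.IsHermitian.elt_mul_right]
  change ‖_ * (ρ.eigenvalue j : ℂ) - (ρ.eigenvalue i : ℂ) * _‖ ^ 2 = _
  rw [mul_comm (ρ.eigenvalue i : ℂ), ← mul_sub, norm_mul, mul_pow, ← Complex.ofReal_sub,
    Complex.norm_real, Real.norm_eq_abs, sq_abs, ← neg_sub, neg_sq, eigenEntry_eq_elt]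

/-- The common value of the two line elements on `[T, ρ]` at a pure state `ρ`, as a continuous
function of the state. -/
noncomputable def commutatorForm (T : Matrix n n ℂ) (ρ : QState n) : ℝ :=
  1 / 2 * (ρ.1 * T * Tᴴ).trace.re + 1 / 2 * (T * ρ.1 * Tᴴ).trace.re - (ρ.1 * T * ρ.1 * Tᴴ).trace.re

/-- `tr ((ρ - ρ²) T T†) + tr (T (ρ - ρ²) T†)`, which vanishes at the pure states. -/
noncomputable def mixednessForm (T : Matrix n n ℂ) (ρ : QState n) : ℝ :=
  ((ρ.1 - ρ.1 * ρ.1) * T * Tᴴ).trace.re + (T * (ρ.1 - ρ.1 * ρ.1) * Tᴴ).trace.re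

omit [DecidableEq n] in
theorem continuous_commutatorForm (T : Matrix n n ℂ) : Continuous (commutatorForm T) := by
  unfold commutatorForm; fun_prop

omit [DecidableEq n] in
theorem continuous_mixednessForm (T : Matrix n n ℂ) : Continuous (mixednessForm T) := by
  unfold mixednessForm; fun_prop

theorem mixednessForm_of_pure (T : Matrix n n ℂ) {ρ : QState n} (hρ : ρ ∈ pure n) :
    mixednessForm T ρ = 0 := by
  simp [mixednessForm, pure_mul_self hρ]

/-- With `a = λᵢ` and `b = λⱼ`, the weights `½ (a + b) - a b` and `½ (a - b)² / (a + b)` differ by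
`a b (2 - a - b) / (a + b)`, which lies between `0` and `a (1 - a) + b (1 - b)`. -/
theorem buresMetric_commutator_bounds (ρ : QState n) (T : Matrix n n ℂ) :
    commutatorForm T ρ - mixednessForm T ρ ≤ ρ.buresMetric (T * ρ.1 - ρ.1 * T) ∧
      ρ.buresMetric (T * ρ.1 - ρ.1 * T) ≤ commutatorForm T ρ := by
  have h1 := ρ.sum_norm_eigenEntry_sq_mul_affine T 1
  have hcfc : cfc (fun x : ℝ => x - x * x) ρ.1 = ρ.1 - ρ.1 * ρ.1 := by
    rw [cfc_sub (p := IsSelfAdjoint) (fun x : ℝ => x) (fun x : ℝ => x * x) ρ.1,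
      ← Matrix.IsHermitian.cfc_mul_cfc, ρ.isHermitian.cfc_id_eq]
  have h2 := ρ.isHermitian.sum_norm_elt_sq_mul_left ρ.isHermitian (fun x => x - x * x) T
  have h3 := ρ.isHermitian.sum_norm_elt_sq_mul_right ρ.isHermitian (fun x => x - x * x) T
  rw [hcfc] at h2 h3
  have hC : commutatorForm T ρ = ∑ i, ∑ j, ‖ρ.eigenEntry T i j‖ ^ 2 *
      (1 / 2 * ρ.eigenvalue i + 1 / 2 * ρ.eigenvalue j -
        1 * (ρ.eigenvalue i * ρ.eigenvalue j)) := by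
    rw [h1, commutatorForm, one_mul]
  have hM : mixednessForm T ρ = ∑ i, ∑ j, ‖ρ.eigenEntry T i j‖ ^ 2 *
      ((ρ.eigenvalue i - ρ.eigenvalue i * ρ.eigenvalue i) +
        (ρ.eigenvalue j - ρ.eigenvalue j * ρ.eigenvalue j)) := by
    rw [mixednessForm, ← h2, ← h3]
    simp only [← Finset.sum_add_distrib, mul_add]
    rfl
  have hscalar : ∀ a b : ℝ, 0 ≤ a → a ≤ 1 → 0 ≤ b → b ≤ 1 →
      (1 / 2 * a + 1 / 2 * b - 1 * (a * b)) - ((a - a * a) + (b - b * b)) ≤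
        (a - b) ^ 2 * (1 / 2 * (a + b)⁻¹) ∧
      (a - b) ^ 2 * (1 / 2 * (a + b)⁻¹) ≤ 1 / 2 * a + 1 / 2 * b - 1 * (a * b) := by
    intro a b ha ha' hb hb'
    rcases (add_nonneg ha hb).eq_or_lt with h | h
    · obtain ⟨rfl, rfl⟩ := (add_eq_zero_iff_of_nonneg ha hb).1 h.symm
      norm_num
    · rw [show (a - b) ^ 2 * (1 / 2 * (a + b)⁻¹) = (a - b) ^ 2 / 2 / (a + b) by
        rw [div_eq_mul_inv _ (a + b)]; ring, le_div_iff₀ h, div_le_iff₀ h]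
      have h1 : 0 ≤ a * b := mul_nonneg ha hb
      have h2 : 0 ≤ a * a * (1 - a) := by have := sub_nonneg.2 ha'; positivity
      have h3 : 0 ≤ b * b * (1 - b) := by have := sub_nonneg.2 hb'; positivity
      have h4 : 0 ≤ a * b * (1 - a) := by have := sub_nonneg.2 ha'; positivity
      have h5 : 0 ≤ a * b * (1 - b) := by have := sub_nonneg.2 hb'; positivity
      constructor <;> nlinarith
  rw [buresMetric_eq_sum, hC, hM]
  simp only [norm_eigenEntry_commutator_sq, ← Finset.sum_sub_distrib, ← mul_sub, mul_assoc]
  constructor <;>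
  · refine Finset.sum_le_sum fun i _ => Finset.sum_le_sum fun j _ =>
      mul_le_mul_of_nonneg_left ?_ (by positivity)
    have := hscalar _ _ (ρ.eigenvalue_nonneg i) (ρ.eigenvalue_le_one i) (ρ.eigenvalue_nonneg j)
      (ρ.eigenvalue_le_one j)
    first | exact this.1 | exact this.2

theorem buresMetric_commutator_of_pure {ρ : QState n} (hρ : ρ ∈ pure n) (T : Matrix n n ℂ) :
    ρ.buresMetric (T * ρ.1 - ρ.1 * T) = commutatorForm T ρ := by
  obtain ⟨h1, h2⟩ := ρ.buresMetric_commutator_bounds T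
  rw [mixednessForm_of_pure T hρ, sub_zero] at h1
  exact le_antisymm h2 h1

theorem tendsto_buresMetric_commutator {ρ₀ : QState n} (hρ : ρ₀ ∈ pure n) (T : Matrix n n ℂ) :
    Tendsto (fun ρ : QState n => ρ.buresMetric (T * ρ.1 - ρ.1 * T)) (𝓝 ρ₀)
      (𝓝 (ρ₀.buresMetric (T * ρ₀.1 - ρ₀.1 * T))) := by
  rw [buresMetric_commutator_of_pure hρ]
  have h1 := (continuous_commutatorForm T).tendsto ρ₀
  have h2 := h1.sub ((continuous_mixednessForm T).tendsto ρ₀)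
  rw [mixednessForm_of_pure T hρ, sub_zero] at h2
  exact tendsto_of_tendsto_of_tendsto_of_le_of_le h2 h1
    (fun ρ => (ρ.buresMetric_commutator_bounds T).1)
    (fun ρ => (ρ.buresMetric_commutator_bounds T).2)

/-- Here `(λᵢ - λⱼ)² / (√λᵢ + √λⱼ)² = (√λᵢ - √λⱼ)²` removes the singular denominators. -/
theorem qcMetric_commutator (ρ : QState n) (T : Matrix n n ℂ) :
    ρ.qcMetric (T * ρ.1 - ρ.1 * T) = 1 / 2 * (ρ.1 * T * Tᴴ).trace.re +
      1 / 2 * (T * ρ.1 * Tᴴ).trace.re -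
        (cfc Real.sqrt ρ.1 * T * cfc Real.sqrt ρ.1 * Tᴴ).trace.re := by
  have h1 := ρ.isHermitian.sum_norm_elt_sq_mul_left ρ.isHermitian (fun x => x) T
  have h2 := ρ.isHermitian.sum_norm_elt_sq_mul_right ρ.isHermitian (fun x => x) T
  have h3 := ρ.isHermitian.sum_norm_elt_sq_mul ρ.isHermitian Real.sqrt Real.sqrt T
  rw [ρ.isHermitian.cfc_id_eq] at h1 h2
  rw [← h1, ← h2, ← h3, qcMetric_eq_sum]
  simp only [norm_eigenEntry_commutator_sq, Finset.mul_sum, ← Finset.sum_add_distrib,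
    ← Finset.sum_sub_distrib]
  refine Finset.sum_congr rfl fun i _ => Finset.sum_congr rfl fun j _ => ?_
  have hi := ρ.eigenvalue_nonneg i
  have hj := ρ.eigenvalue_nonneg j
  have h4 : (ρ.eigenvalue i - ρ.eigenvalue j) ^ 2 *
      (1 / 2 * ((√(ρ.eigenvalue i) + √(ρ.eigenvalue j)) ^ 2)⁻¹) =
      1 / 2 * ρ.eigenvalue i + 1 / 2 * ρ.eigenvalue j -
        √(ρ.eigenvalue i) * √(ρ.eigenvalue j) := by
    have key : ∀ x y : ℝ, 0 ≤ x → 0 ≤ y →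
        (x ^ 2 - y ^ 2) ^ 2 * (1 / 2 * ((x + y) ^ 2)⁻¹) = 1 / 2 * x ^ 2 + 1 / 2 * y ^ 2 - x * y := by
      intro x y hx hy
      rcases (add_nonneg hx hy).eq_or_lt with h | h
      · obtain ⟨rfl, rfl⟩ := (add_eq_zero_iff_of_nonneg hx hy).1 h.symm
        norm_num
      · field_simp
        ring
    simpa only [Real.sq_sqrt hi, Real.sq_sqrt hj] using
      key _ _ (Real.sqrt_nonneg (ρ.eigenvalue i)) (Real.sqrt_nonneg (ρ.eigenvalue j))
  rw [mul_assoc, h4]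
  simp only [eigenEntry_eq_elt, eigenvalue]
  ring

theorem tendsto_qcMetric_commutator (ρ₀ : QState n) (T : Matrix n n ℂ) :
    Tendsto (fun ρ : QState n => ρ.qcMetric (T * ρ.1 - ρ.1 * T)) (𝓝 ρ₀)
      (𝓝 (ρ₀.qcMetric (T * ρ₀.1 - ρ₀.1 * T))) := by
  have hc : Continuous fun ρ : QState n => cfc Real.sqrt ρ.1 :=
    (Matrix.continuousOn_cfc_of_isOpen isOpen_univ Real.continuous_sqrt.continuousOn).comp_continuous
      continuous_subtype_val fun ρ => ⟨ρ.isHermitian, Set.subset_univ _⟩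
  have : Continuous fun ρ : QState n => ρ.qcMetric (T * ρ.1 - ρ.1 * T) := by
    simp only [qcMetric_commutator]
    fun_prop
  exact this.tendsto ρ₀

omit [DecidableEq n] in
theorem isHermitian_commutator (ρ : QState n) {T : Matrix n n ℂ} (hT : Tᴴ = -T) :
    (T * ρ.1 - ρ.1 * T).IsHermitian := by
  rw [Matrix.IsHermitian, Matrix.conjTranspose_sub, Matrix.conjTranspose_mul,
    Matrix.conjTranspose_mul, ρ.isHermitian.eq, hT]
  simp
  abel

omit [DecidableEq n] in
theorem trace_commutator (ρ : QState n) (T : Matrix n n ℂ) : (T * ρ.1 - ρ.1 * T).trace = 0 := by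
  rw [Matrix.trace_sub, Matrix.trace_mul_comm, sub_self]

/-- Mixing with the maximally mixed state shows that every state is a limit of strictly mixed
ones. -/
theorem neBot_nhdsWithin_strictlyMixed (ρ : QState n) : (𝓝[strictlyMixed n] ρ).NeBot := by
  classical
  rw [← mem_closure_iff_nhdsWithin_neBot]
  have hne : Nonempty n := by
    by_contra h
    rw [not_nonempty_iff] at h
    have := ρ.2.2
    simp [Matrix.trace] at this
  have hN : (0 : ℝ) < Fintype.card n := by exact_mod_cast Fintype.card_pos
  let A : ℝ → Matrix n n ℂ := fun t => ((1 - t : ℝ) : ℂ) • ρ.1 + ((t / Fintype.card n : ℝ) : ℂ) • 1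
  have hA : ∀ t ∈ Set.Ioo (0 : ℝ) 1, (A t).PosDef := fun t ht =>
    Matrix.PosDef.posSemidef_add (ρ.2.1.smul (by exact_mod_cast (sub_pos.2 ht.2).le))
      (Matrix.PosDef.one.smul (by exact_mod_cast div_pos ht.1 hN))
  have htr : ∀ t, (A t).trace = 1 := fun t => by
    have : (Fintype.card n : ℂ) ≠ 0 := by exact_mod_cast hN.ne'
    simp only [A, Matrix.trace_add, Matrix.trace_smul, ρ.2.2, Matrix.trace_one, smul_eq_mul]
    push_cast
    field_simp
    ring
  let σ : ℝ → QState n := fun t =>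
    if h : t ∈ Set.Ioo (0 : ℝ) 1 then ⟨A t, (hA t h).posSemidef, htr t⟩ else ρ
  have hev : ∀ᶠ t in 𝓝[>] (0 : ℝ), t ∈ Set.Ioo (0 : ℝ) 1 := Ioo_mem_nhdsGT one_pos
  have hσ : ∀ᶠ t in 𝓝[>] (0 : ℝ), (σ t).1 = A t := by
    filter_upwards [hev] with t ht
    simp only [σ, dif_pos ht]
  have hlim : Tendsto σ (𝓝[>] 0) (𝓝 ρ) := by
    refine tendsto_subtype_rng.2 ?_
    have : Continuous A := by fun_prop
    have h := (this.tendsto 0).mono_left (nhdsWithin_le_nhds (s := Set.Ioi 0))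
    simp only [A, sub_zero, Complex.ofReal_one, one_smul, zero_div, Complex.ofReal_zero, zero_smul,
      add_zero] at h
    refine h.congr' ?_
    filter_upwards [hσ] with t ht using ht.symm
  refine mem_closure_of_tendsto hlim ?_
  filter_upwards [hσ, hev] with t h1 h2
  rw [strictlyMixed, Set.mem_ofPred_eq, h1]
  exact hA t h2

/-- The generator `T = |χ⟩⟨ψ| - |ψ⟩⟨χ|` rotates `|ψ⟩` towards an orthogonal vector `|χ⟩`. -/
theorem exists_commutatorForm_pos [Nontrivial n] {ρ : QState n} (hρ : ρ ∈ pure n) :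
    ∃ T : Matrix n n ℂ, Tᴴ = -T ∧ 0 < commutatorForm T ρ := by
  obtain ⟨ψ, hψ⟩ := id hρ
  have hnorm : star ψ ⬝ᵥ ψ = 1 := by
    rw [← ρ.2.2, hψ, Matrix.trace_vecMulVec, dotProduct_comm]
  obtain ⟨χ, hχ0, hχ⟩ : ∃ χ : n → ℂ, χ ≠ 0 ∧ star ψ ⬝ᵥ χ = 0 := by
    obtain ⟨i, j, hij⟩ := exists_pair_ne n
    by_cases h : ψ i = 0
    · exact ⟨Pi.single i 1, by simp, by simp [h]⟩
    · refine ⟨Pi.single i (star (ψ j)) - Pi.single j (star (ψ i)), fun h0 => ?_, ?_⟩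
      · have := congrFun h0 j
        simp [hij.symm] at this
        exact h this
      · simp [dotProduct_sub, mul_comm]
  have hχ' : star χ ⬝ᵥ ψ = 0 := by
    rw [Matrix.star_dotProduct, hχ, star_zero]
  have hχpos : 0 < (star χ ⬝ᵥ χ).re := by
    have := (Complex.lt_def.1 (Matrix.dotProduct_star_self_pos_iff.2 hχ0)).1
    simpa using this
  set T := Matrix.vecMulVec χ (star ψ) - Matrix.vecMulVec ψ (star χ) with hTdef
  have hT : Tᴴ = -T := by
    rw [hTdef, Matrix.conjTranspose_sub, Matrix.conjTranspose_vecMulVec,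
      Matrix.conjTranspose_vecMulVec, star_star, star_star, neg_sub]
  refine ⟨T, hT, ?_⟩
  have hTψ : T *ᵥ ψ = χ := by
    rw [hTdef, Matrix.sub_mulVec, Matrix.vecMulVec_mulVec, Matrix.vecMulVec_mulVec, hnorm, hχ']
    simp
  have hTχ : T *ᵥ χ = -((star χ ⬝ᵥ χ) • ψ) := by
    rw [hTdef, Matrix.sub_mulVec, Matrix.vecMulVec_mulVec, Matrix.vecMulVec_mulVec, hχ]
    simp
  have h1 : (ρ.1 * T * T).trace = -(star χ ⬝ᵥ χ) := by
    rw [Matrix.mul_assoc, Matrix.trace_mul_comm, hψ, trace_mul_vecMulVec, ← Matrix.mulVec_mulVec,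
      hTψ, hTχ, dotProduct_neg, dotProduct_smul, hnorm, smul_eq_mul, mul_one]
  have h2 : (T * ρ.1 * T).trace = (ρ.1 * T * T).trace := by
    rw [Matrix.mul_assoc, Matrix.trace_mul_comm]
  have h3 : (ρ.1 * T).trace = 0 := by
    rw [Matrix.trace_mul_comm, hψ, trace_mul_vecMulVec, hTψ, hχ]
  have h4 : commutatorForm T ρ = (star χ ⬝ᵥ χ).re := by
    rw [commutatorForm, pure_mul_mul hρ, h3, hT]
    simp only [Matrix.mul_neg, Matrix.trace_neg, h2, h1, zero_smul, Matrix.zero_mul, neg_zero,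
      Matrix.trace_zero, neg_neg, Complex.zero_re]
    ring
  rw [h4]
  exact hχpos

end QState

/-! ### Induced metrics and their limits at the pure states -/

theorem mainTheorem3 {n : Type*} [Fintype n] [DecidableEq n] :
    -- strictly mixed states: `ds²_CC = ½ ds²_BU = ½ (1 - F)`
    (QState.IsInducedMetric (QState.strictlyMixed n)
        (fun ρ σ => ((QState.buresDist ρ σ ^ 2 : ℝ) : EReal)) QState.buresMetric ∧
      QState.IsInducedMetric (QState.strictlyMixed n)
        (fun ρ σ => ((1 - QState.fidelity ρ σ : ℝ) : EReal)) QState.buresMetric ∧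
      QState.IsInducedMetric (QState.strictlyMixed n)
        QState.chernoffCC (fun ρ X => 1 / 2 * QState.buresMetric ρ X)) ∧
    -- pure states: `ds²_CC = 1 - F = ds²_BU`
    (QState.IsInducedMetric (QState.pure n)
        (fun ρ σ => ((QState.buresDist ρ σ ^ 2 : ℝ) : EReal)) QState.buresMetric ∧
      QState.IsInducedMetric (QState.pure n)
        (fun ρ σ => ((1 - QState.fidelity ρ σ : ℝ) : EReal)) QState.buresMetric ∧
      QState.IsInducedMetric (QState.pure n) QState.chernoffCC QState.buresMetric) ∧
    -- on pure states this is the Fubini-Study metric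
    (∀ ρ : QState n, ∀ ψ φ : n → ℂ, ρ.1 = Matrix.vecMulVec ψ (star ψ) →
      (star ψ ⬝ᵥ φ).re = 0 →
      QState.buresMetric ρ (Matrix.vecMulVec φ (star ψ) + Matrix.vecMulVec ψ (star φ)) =
        fubiniStudy ψ φ) ∧
    -- the metric induced by the quantum Chernoff measure
    (QState.IsInducedMetric (QState.strictlyMixed n) QState.chernoffQC QState.qcMetric ∧
      QState.IsInducedMetric (QState.pure n) QState.chernoffQC QState.qcMetric) ∧
    -- `ds²_CC` is discontinuous at the pure states
    (∀ gm gp : QState n → Matrix n n ℂ → ℝ,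
      QState.IsInducedMetric (QState.strictlyMixed n) QState.chernoffCC gm →
      QState.IsInducedMetric (QState.pure n) QState.chernoffCC gp →
      ∀ ρ₀ ∈ QState.pure n,
        (∀ T : Matrix n n ℂ, Tᴴ = -T →
          Filter.Tendsto (fun ρ : QState n => gm ρ (T * ρ.1 - ρ.1 * T))
            (𝓝[QState.strictlyMixed n] ρ₀) (𝓝 (1 / 2 * gp ρ₀ (T * ρ₀.1 - ρ₀.1 * T)))) ∧
        (Nontrivial n → ∃ T : Matrix n n ℂ, Tᴴ = -T ∧
          ¬ Filter.Tendsto (fun ρ : QState n => gm ρ (T * ρ.1 - ρ.1 * T))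
            (𝓝[QState.strictlyMixed n] ρ₀) (𝓝 (gp ρ₀ (T * ρ₀.1 - ρ₀.1 * T))))) ∧
    -- `ds²_QC` is not
    (∀ gm gp : QState n → Matrix n n ℂ → ℝ,
      QState.IsInducedMetric (QState.strictlyMixed n) QState.chernoffQC gm →
      QState.IsInducedMetric (QState.pure n) QState.chernoffQC gp →
      ∀ ρ₀ ∈ QState.pure n, ∀ T : Matrix n n ℂ, Tᴴ = -T →
        Filter.Tendsto (fun ρ : QState n => gm ρ (T * ρ.1 - ρ.1 * T))
          (𝓝[QState.strictlyMixed n] ρ₀) (𝓝 (gp ρ₀ (T * ρ₀.1 - ρ₀.1 * T)))) := by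
  refine ⟨⟨QState.isInducedMetric_buresDist_strictlyMixed,
      QState.isInducedMetric_fidelity_strictlyMixed,
      QState.isInducedMetric_chernoffCC_strictlyMixed⟩,
    ⟨QState.isInducedMetric_buresDist_pure, QState.isInducedMetric_fidelity_pure,
      QState.isInducedMetric_chernoffCC_pure⟩,
    fun ρ ψ φ hψ h => QState.buresMetric_eq_fubiniStudy hψ h,
    ⟨QState.isInducedMetric_chernoffQC_strictlyMixed,
      QState.isInducedMetric_chernoffQC_pure⟩, ?_, ?_⟩
  · intro gm gp hgm hgp ρ₀ hρ₀
    have hp : ∀ T : Matrix n n ℂ, Tᴴ = -T → gp ρ₀ (T * ρ₀.1 - ρ₀.1 * T) =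
        QState.buresMetric ρ₀ (T * ρ₀.1 - ρ₀.1 * T) := fun T hT =>
      hgp.eq_of_pure QState.isInducedMetric_chernoffCC_pure hρ₀ hT
    have hlim : ∀ T : Matrix n n ℂ, Tᴴ = -T →
        Filter.Tendsto (fun ρ : QState n => gm ρ (T * ρ.1 - ρ.1 * T))
          (𝓝[QState.strictlyMixed n] ρ₀) (𝓝 (1 / 2 * gp ρ₀ (T * ρ₀.1 - ρ₀.1 * T))) := by
      intro T hT
      rw [hp T hT]
      refine (((QState.tendsto_buresMetric_commutator hρ₀ T).const_mul (1 / 2)).mono_left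
        nhdsWithin_le_nhds).congr' ?_
      filter_upwards [self_mem_nhdsWithin] with ρ hρ
      exact (hgm.eq_of_strictlyMixed QState.isInducedMetric_chernoffCC_strictlyMixed hρ
        (ρ.isHermitian_commutator hT) (ρ.trace_commutator T)).symm
    refine ⟨hlim, fun _ => ?_⟩
    -- If the limit were `gp`, then `½ gp = gp` on `[T, ρ₀]`, where `gp` is positive.
    obtain ⟨T, hT, hpos⟩ := QState.exists_commutatorForm_pos hρ₀
    refine ⟨T, hT, fun h => ?_⟩
    have := ρ₀.neBot_nhdsWithin_strictlyMixed
    have heq := tendsto_nhds_unique (hlim T hT) h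
    rw [hp T hT, QState.buresMetric_commutator_of_pure hρ₀] at heq
    linarith
  · intro gm gp hgm hgp ρ₀ hρ₀ T hT
    rw [hgp.eq_of_pure QState.isInducedMetric_chernoffQC_pure hρ₀ hT]
    refine ((QState.tendsto_qcMetric_commutator ρ₀ T).mono_left nhdsWithin_le_nhds).congr' ?_
    filter_upwards [self_mem_nhdsWithin] with ρ hρ
    exact (hgm.eq_of_strictlyMixed QState.isInducedMetric_chernoffQC_strictlyMixed hρ
      (ρ.isHermitian_commutator hT) (ρ.trace_commutator T)).symm
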